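/- Let $\omega=e^{2\pi i/3}$, $\lambda_j(z)=z\omega^j$ ($j=1,2,3$), $\Lambda(z)=\mathrm{diag}(\lambda_1,\lambda_2,\lambda_3)$, $Q(y,t,z)=y\Lambda(z)+t\Lambda(z)^{-1}$, and let $\Sigma=\{z\in\mathbb C:\operatorname{Re}\lambda_j(z)=\operatorname{Re}\lambda_l(z)\text{ for some }j\ne l\}$, i.e. the six rays $\mathbb R_+e^{i\pi(\nu-1)/3}$, $\nu=1,\dots,6$, together with $0$. The rays divide the plane into the sectors $\Omega_\nu=\{\frac\pi3(\nu-1)<\arg z<\frac\pi3\nu\}$; subscripts $+$ and $-$ denote limiting values at a point of $\Sigma\setminus\{0\}$ from the adjacent sector with $\nu$ odd and with $\nu$ even, respectively. **Cauchy problem.** Let $u_0:\mathbb R\to\mathbb R$ be smooth with $1-u_0''>0$ on $\mathbb R$, $u_0\to0$ as $|x|\to\infty$, and $u_0'',u_0''',u_0''''\in L^1(\mathbb R)$. Let $u\in C^\infty(\mathbb R\times[0,\infty))$ be a real-valued solution of $$u_{txx}-3u_x+3u_xu_{xx}+uu_{xxx}=0\quad(x\in\mathbb R,\ t>0),\qquad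 u(x,0)=u_0(x),$$ such that, for every $T>0$, $u(x,t)\to0$ as $|x|\to\infty$ uniformly in $t\in[0,T]$, and $|\partial_x^ku(x,t)|\le g_T(x)$ for $k=2,3,4$, $t\in[0,T]$, with some $g_T\in L^1(\mathbb R)$. Put $q=(1-u_{xx})^{1/3}$ and $y(x,t)=x-\int_x^\infty(q(\xi,t)-1)\,d\xi$; denote by $q_0$, $y_0$ these functions at $t=0$ (they are determined by $u_0$). **Scattering data of $u_0$.** For $z\in\mathbb C\setminus\Sigma$ consider bounded continuous $3\times3$ matrix solutions $M(\cdot,z)$ of $$M_{jl}(x,z)=\delta_{jl}+\int_{\infty_{jl}}^x e^{-\lambda_j(z)\int_x^\xi q_0}\,(U_0M)_{jl}(\xi,z)\,e^{\lambda_l(z)\int_x^\xi q_0}\,d\xi,\qquad U_0=\frac{q_0'}{3q_0}\begin{pmatrix}0&1-\omega^2&1-\omega\\1-\omega&0&1-\omega^2\\1-\omega^2&1-\omega&0\end{pmatrix},$$ where $\infty_{jl}=+\infty$ if $\operatorname{Re}\lambda_j(z)\ge\operatorname{Re}\lambda_l(z)$ and $\infty_{jl}=-\infty$ otherwise. Assume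 that $u_0$ is generic in the following sense: there are finitely many distinct points $z_1,\dots,z_N\in\mathbb C\setminus\Sigma$ $(N\ge0)$ such that there is exactly one such solution $M(\cdot,z)$ for every $z\in\mathbb C\setminus(\Sigma\cup\{z_1,\dots,z_N\})$; for each $x$ the limiting values $M_\pm(x,z)$ exist at all $z\in\Sigma\setminus\{0\}$; and for each $n$ there are column indices $l=l_n\neq j=j_n$ and a constant $v_n\in\mathbb C$ such that the columns of $M(x,\cdot)$ other than the $l$-th are regular (extend continuously) at $z_n$, while $$\operatorname*{Res}_{z=z_n}M^{(l)}(x,z)=M^{(j)}(x,z_n)\,v_n\,e^{y_0(x)(\lambda_j(z_n)-\lambda_l(z_n))},$$ in the sense that $(z-z_n)M^{(l)}(x,z)$ tends to the right-hand side as $z\to z_n$. The scattering data of $u_0$ are $\{z_n,l_n,j_n,v_n\}$ and the matrix function $S_0(z)=e^{-Q(y_0(x),0,z)}M_-(x,z)^{-1}M_+(x,z)e^{Q(y_0(x),0,z)}$, $z\in\Sigma\setminus\{0\}$, taken at $x=0$ (it does not depend on $x$). **Riemann–Hilbert problem.** For $y\in\mathbb R$, $t\ge0$ find a $3\times3$ matrix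 function $\hat M(y,t,\cdot)$ on $\mathbb C\setminus\Sigma$ such that: its $k$-th column is analytic on $\mathbb C\setminus\Sigma$ except possibly at the $z_n$ with $l_n=k$; it has limiting values on $\Sigma\setminus\{0\}$ with $\hat M_+=\hat M_-\,e^{Q(y,t,z)}S_0(z)e^{-Q(y,t,z)}$; for each $n$, with $l=l_n$, $j=j_n$, $$\operatorname*{Res}_{z=z_n}\hat M^{(l)}(y,t,z)=\hat M^{(j)}(y,t,z_n)\,v_n\,e^{y(\lambda_j(z_n)-\lambda_l(z_n))+t(\lambda_j(z_n)^{-1}-\lambda_l(z_n)^{-1})}$$ (in the same sense); $\hat M$ is bounded near $z=0$; and $\hat M=I+O(1/z)$ as $z\to\infty$. **Theorem.** For every $t\ge0$ one has $1-u_{xx}(\cdot,t)>0$ and $q(\cdot,t)-1\in L^1(\mathbb R)$, and $x\mapsto y(x,t)$ is a bijection of $\mathbb R$; let $y\mapsto x(y,t)$ be its inverse. For every $y\in\mathbb R$, $t\ge0$ the Riemann–Hilbert problem with the scattering data of $u_0$ has exactly one solution $\hat M(y,t,\cdot)$ (as a function on $\mathbb C\setminus(\Sigma\cup\{z_1,\dots,z_N\})$);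 the limit $\hat M(y,t,0)=\lim_{z\to0,\,z\notin\Sigma}\hat M(y,t,z)$ exists, $\sum_{j=1}^3\hat M_{j3}(y,t,0)\ne0$, and $u$ is given parametrically by $u(x,t)=\hat u(y(x,t),t)$, where $$x(y,t)=y+\lim_{z\to0,\ z\notin\Sigma}\left(\frac{\sum_{j=1}^3\hat M_{j3}(y,t,z)}{\sum_{j=1}^3\hat M_{j3}(y,t,0)}-1\right)\frac1z,\qquad \hat u(y,t)=\frac{\partial x(y,t)}{\partial t},$$ the limit and the derivative (one-sided at $t=0$) existing for all $y\in\mathbb R$, $t\ge0$. -/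

import Mathlib

open Filter Topology MeasureTheory
open scoped ContDiff

namespace OstrovskyVakhnenko

noncomputable section

/-- `3 × 3` complex matrices. The indices `1, 2, 3` of the text are `0, 1, 2 : Fin 3` here. -/
abbrev Mat : Type := Matrix (Fin 3) (Fin 3) ℂ

/-- `ω = exp (2πi/3)`. -/
def omega : ℂ := Complex.exp (2 * Real.pi * Complex.I / 3)

/-- `λ_j(z) = z ω^j`, `j = 1, 2, 3`. -/
def lam (z : ℂ) (j : Fin 3) : ℂ := z * omega ^ ((j : ℕ) + 1)

/-- The contour `Σ`: the six rays `ℝ₊ exp (iπ(ν-1)/3)` together with the origin. -/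
def contour : Set ℂ := {z | ∃ j l : Fin 3, j ≠ l ∧ (lam z j).re = (lam z l).re}

/-- The union of the sectors `Ω₁, Ω₃, Ω₅` (where `0 < sin (3 arg z)`): the `+` side of every ray. -/
def plusSide : Set ℂ := {z | 0 < (z ^ 3).im}

/-- The union of the sectors `Ω₂, Ω₄, Ω₆` (where `sin (3 arg z) < 0`): the `-` side of every ray. -/
def minusSide : Set ℂ := {z | (z ^ 3).im < 0}

theorem omega_eq : omega = ⟨-1/2, Real.sqrt 3 / 2⟩ := by
  have : (2 * Real.pi * Complex.I / 3 : ℂ) = ((Real.pi - Real.pi/3 : ℝ) : ℂ) * Complex.I := by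
    push_cast; ring
  rw [omega, this, Complex.exp_mul_I, ← Complex.ofReal_cos, ← Complex.ofReal_sin,
    Real.cos_pi_sub, Real.sin_pi_sub, Real.cos_pi_div_three, Real.sin_pi_div_three]
  apply Complex.ext <;> simp <;> ring

/-- The complement of the contour is the disjoint union of `plusSide` and `minusSide`. -/
theorem mem_contour_iff (z : ℂ) : z ∈ contour ↔ (z ^ 3).im = 0 := by
  have h3 : Real.sqrt 3 ^ 2 = 3 := Real.sq_sqrt (by norm_num)
  have hs : Real.sqrt 3 ≠ 0 := by positivity
  have e1 : (lam z 0).re = -z.re/2 - Real.sqrt 3 / 2 * z.im := by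
    simp [lam, omega_eq]; ring
  have e2 : (lam z 1).re = -z.re/2 + Real.sqrt 3 / 2 * z.im := by
    simp [lam, omega_eq, pow_succ]; ring_nf; rw [h3]; ring
  have e3 : (lam z 2).re = z.re := by
    simp [lam, omega_eq, pow_succ]; ring_nf; simp [h3, show Real.sqrt 3 ^ 3 = 3 * Real.sqrt 3 by rw [pow_succ, h3]]; try ring
  have e4 : (z ^ 3).im = z.im * (Real.sqrt 3 * z.re - z.im) * (Real.sqrt 3 * z.re + z.im) := by
    simp [pow_succ]; linear_combination (- z.im * z.re^2) * h3
  rw [e4]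
  constructor
  · rintro ⟨j, l, hjl, h⟩
    fin_cases j <;> fin_cases l <;> simp [e1, e2, e3] at h hjl ⊢ <;> grind
  · intro h
    rcases mul_eq_zero.1 h with h | h
    · rcases mul_eq_zero.1 h with h | h
      · exact ⟨0, 1, by decide, by rw [e1, e2, h]; ring⟩
      · exact ⟨1, 2, by decide, by rw [e2, e3]; grind⟩
    · exact ⟨0, 2, by decide, by rw [e1, e3]; grind⟩

/-- `exp Q`, where `Q = y Λ(z) + t Λ(z)⁻¹` and `Λ(z) = diag (λ₁(z), λ₂(z), λ₃(z))`. -/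
def expQ (y t : ℝ) (z : ℂ) : Mat :=
  Matrix.diagonal fun j => Complex.exp (y * lam z j + t * (lam z j)⁻¹)

/-- `q = (1 - w'')^(1/3)` for a spatial profile `w`. -/
def qOf (w : ℝ → ℝ) (x : ℝ) : ℝ := (1 - iteratedDeriv 2 w x) ^ (1 / 3 : ℝ)

/-- `y(x) = x - ∫_x^∞ (q - 1) dξ` for a spatial profile `w`. -/
def yOf (w : ℝ → ℝ) (x : ℝ) : ℝ := x - ∫ ξ in Set.Ioi x, (qOf w ξ - 1)

/-- The coefficient matrix `U` of the `x`-equation of the Lax pair, for a spatial profile `w`. -/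
def UOf (w : ℝ → ℝ) (x : ℝ) : Mat :=
  ((deriv (qOf w) x / (3 * qOf w x) : ℝ) : ℂ) •
    !![0, 1 - omega ^ 2, 1 - omega;
       1 - omega, 0, 1 - omega ^ 2;
       1 - omega ^ 2, 1 - omega, 0]

/-- The integrand of the `(j, l)` integral equation,
`exp (-λ_j ∫_x^ξ q) (U M)_{jl}(ξ) exp (λ_l ∫_x^ξ q)`. -/
def integrand (w : ℝ → ℝ) (z : ℂ) (M : ℝ → Mat) (j l : Fin 3) (x ξ : ℝ) : ℂ :=
  Complex.exp (-lam z j * ((∫ ζ in x..ξ, qOf w ζ : ℝ) : ℂ)) * (UOf w ξ * M ξ) j l *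
    Complex.exp (lam z l * ((∫ ζ in x..ξ, qOf w ζ : ℝ) : ℂ))

/-- `M` is a bounded continuous solution, at the spectral parameter `z`, of the system of integral
equations `M_{jl}(x) = I_{jl} + ∫_{∞_{jl}}^x (integrand) dξ`, where `∞_{jl} = +∞` if
`Re λ_j ≥ Re λ_l` and `∞_{jl} = -∞` if `Re λ_j < Re λ_l`. -/
structure IsEigenfunction (w : ℝ → ℝ) (z : ℂ) (M : ℝ → Mat) : Prop where
  continuous : Continuous M
  bounded : ∃ C : ℝ, ∀ x j l, ‖M x j l‖ ≤ C
  eq_right : ∀ j l, (lam z l).re ≤ (lam z j).re → ∀ x,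
    M x j l = (1 : Mat) j l - ∫ ξ in Set.Ioi x, integrand w z M j l x ξ
  eq_left : ∀ j l, (lam z j).re < (lam z l).re → ∀ x,
    M x j l = (1 : Mat) j l + ∫ ξ in Set.Iic x, integrand w z M j l x ξ

/-- Data of the Riemann--Hilbert problem: the matrix function `S₀` on the contour and finitely many
poles `z_n`, each with the column `l` in which it occurs, another column `j ≠ l`, and the residue
constant `v_n^{jl}`. Distinct indices have distinct poles, so no two columns share a pole. -/
structure ScatteringData where
  S₀ : ℂ → Mat
  N : ℕ
  pole : Fin N → ℂ
  col : Fin N → Fin 3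
  src : Fin N → Fin 3
  v : Fin N → ℂ
  pole_notMem : ∀ n, pole n ∉ contour
  pole_injective : Function.Injective pole
  src_ne_col : ∀ n, src n ≠ col n

/-- The points off the contour that are not poles. -/
def ScatteringData.regularSet (D : ScatteringData) : Set ℂ :=
  {z | z ∉ contour ∧ ∀ n, z ≠ D.pole n}

/-- The jump matrix `S(y,t,z) = exp Q · S₀(z) · exp (-Q)`. -/
def ScatteringData.jump (D : ScatteringData) (y t : ℝ) (z : ℂ) : Mat :=
  expQ y t z * D.S₀ z * expQ (-y) (-t) z

/-- The factor `v exp (y (λ_j - λ_l) + t (1/λ_j - 1/λ_l))` at the pole `z_n`. -/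
def ScatteringData.resFactor (D : ScatteringData) (n : Fin D.N) (y t : ℝ) : ℂ :=
  D.v n * Complex.exp
    (y * (lam (D.pole n) (D.src n) - lam (D.pole n) (D.col n)) +
      t * ((lam (D.pole n) (D.src n))⁻¹ - (lam (D.pole n) (D.col n))⁻¹))

/-- `D` is the scattering data of the initial profile `w` (which is thereby generic): off the
contour and off the finitely many poles the integral equations have exactly one bounded solution
`M(·, z)`; `M` has boundary values on the rays; at a pole `z_n` one column has a simple pole, with
the residue relation, and the other two columns are regular; and `S₀` is read off from the boundary
values of `M` at `t = 0` (it does not depend on the point `x` used; the point `x = 0` is used). -/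
def IsScatteringDataOf (w : ℝ → ℝ) (D : ScatteringData) : Prop :=
  ∃ M : ℝ → ℂ → Mat,
    (∀ z ∈ D.regularSet, IsEigenfunction w z (fun x => M x z) ∧
      ∀ M' : ℝ → Mat, IsEigenfunction w z M' → ∀ x, M' x = M x z) ∧
    (∀ x, ∀ z ∈ contour, z ≠ 0 →
      (∃ Mp, Tendsto (M x) (𝓝[plusSide] z) (𝓝 Mp)) ∧
      (∃ Mm, Tendsto (M x) (𝓝[minusSide] z) (𝓝 Mm))) ∧
    (∀ z ∈ contour, z ≠ 0 → ∀ Mp Mm : Mat,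
      Tendsto (M 0) (𝓝[plusSide] z) (𝓝 Mp) → Tendsto (M 0) (𝓝[minusSide] z) (𝓝 Mm) →
      D.S₀ z = expQ (-yOf w 0) 0 z * Mm⁻¹ * Mp * expQ (yOf w 0) 0 z) ∧
    (∀ n x i k, k ≠ D.col n → ContinuousAt (fun z => M x z i k) (D.pole n)) ∧
    (∀ n x i, Tendsto (fun z => (z - D.pole n) * M x z i (D.col n)) (𝓝[≠] D.pole n)
      (𝓝 (M x (D.pole n) i (D.src n) * D.resFactor n (yOf w x) 0)))

/-- `F` solves the matrix Riemann--Hilbert problem with data `D` and parameters `(y, t)`. -/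
structure IsRHSolution (D : ScatteringData) (y t : ℝ) (F : ℂ → Mat) : Prop where
  /-- piecewise meromorphic: the `k`-th column is analytic off the contour and its own poles -/
  analytic : ∀ i k, DifferentiableOn ℂ (fun z => F z i k)
    {z | z ∉ contour ∧ ∀ n, D.col n = k → z ≠ D.pole n}
  /-- the jump condition `F₊ = F₋ S` on the rays -/
  jump : ∀ z ∈ contour, z ≠ 0 → ∃ Fp Fm : Mat,
    Tendsto F (𝓝[plusSide] z) (𝓝 Fp) ∧ Tendsto F (𝓝[minusSide] z) (𝓝 Fm) ∧
      Fp = Fm * D.jump y t z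
  /-- the residue conditions -/
  residue : ∀ n i, Tendsto (fun z => (z - D.pole n) * F z i (D.col n)) (𝓝[≠] D.pole n)
    (𝓝 (F (D.pole n) i (D.src n) * D.resFactor n y t))
  /-- boundedness at the common end point of the rays -/
  bounded_zero : ∃ C r : ℝ, 0 < r ∧ ∀ z ∉ contour, ‖z‖ < r → ∀ i k, ‖F z i k‖ ≤ C
  /-- the normalization `F = I + O(1/z)` at infinity -/
  normalization : ∃ C R : ℝ, ∀ z ∉ contour, R < ‖z‖ → ∀ i k,
    ‖F z i k - (1 : Mat) i k‖ ≤ C / ‖z‖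

/-- Initial data: smooth, decaying, with `1 - u₀'' > 0`. -/
structure IsInitialDatum (u₀ : ℝ → ℝ) : Prop where
  smooth : ContDiff ℝ ∞ u₀
  tendsto_zero : Tendsto u₀ (cocompact ℝ) (𝓝 0)
  integrable : ∀ k ∈ Finset.Icc 2 4, Integrable (iteratedDeriv k u₀)
  pos : ∀ x, 0 < 1 - iteratedDeriv 2 u₀ x

/-- Smooth decaying solutions, on `ℝ × [0, ∞)`, of the Cauchy problem
`u_txx - 3 u_x + 3 u_x u_xx + u u_xxx = 0`, `u(x,0) = u₀(x)`. -/
structure IsSolution (u₀ : ℝ → ℝ) (u : ℝ → ℝ → ℝ) : Prop where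
  smooth : ContDiffOn ℝ ∞ (fun p : ℝ × ℝ => u p.1 p.2) {p | 0 ≤ p.2}
  eq : ∀ x t, 0 < t →
    iteratedDeriv 2 (fun x' => deriv (fun s => u x' s) t) x
      - 3 * deriv (fun x' => u x' t) x
      + 3 * deriv (fun x' => u x' t) x * iteratedDeriv 2 (fun x' => u x' t) x
      + u x t * iteratedDeriv 3 (fun x' => u x' t) x = 0
  initial : ∀ x, u x 0 = u₀ x
  /-- `u → 0` as `|x| → ∞`, uniformly for `t` in bounded intervals -/
  tendsto_zero : ∀ T ε : ℝ, 0 < ε → ∃ R : ℝ, ∀ t ∈ Set.Icc 0 T, ∀ x, R ≤ |x| → |u x t| ≤ ε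
  /-- `u_xx, u_xxx, u_xxxx` have an integrable bound, uniform for `t` in bounded intervals -/
  dominated : ∀ T : ℝ, ∃ g : ℝ → ℝ, Integrable g ∧ ∀ t ∈ Set.Icc 0 T, ∀ k ∈ Finset.Icc 2 4,
    ∀ x, |iteratedDeriv k (fun x' => u x' t) x| ≤ g x

/-- The new space variable `y(x,t) = x - ∫_x^∞ (q(ξ,t) - 1) dξ`. -/
def yVar (u : ℝ → ℝ → ℝ) (x t : ℝ) : ℝ := yOf (fun x' => u x' t) x

end

end OstrovskyVakhnenko

open OstrovskyVakhnenko

/-! The equation is the compatibility condition of a linear pair `Ψ_x = AΨ`, `Ψ_t = BΨ`, where `A`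
is linear in `z` and `B` is a Laurent polynomial in `z` (`zero_curvature`). From `M(0, z)` at time
`0` one reaches the point `(x, t)` by solving the `x`-equation at time `0` and then the `t`-equation
at `x`. Both transports multiply from the left and are analytic for `z ≠ 0`, so they disturb neither
the jumps nor the residue relations. A diagonal exponential factor on the right conjugates `S₀` and
rescales the residue constants exactly as the Riemann–Hilbert problem at `y = y(x, t)` requires. The
product is `rhSol`; scattering data at later times are never introduced.

What remains is the behaviour of `rhSol` at `z = 0` and `z = ∞`. At every regular `z` it is the
value at `x` of a bounded normalized solution (`IsJost`) of the `x`-equation for the profile `u(·,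
t)`, because the transport preserves both that equation and the limits at `±∞` (`isJost_evolution`).
Such solutions are estimated in two gauges. In the gauge adapted to `z = 0` the potential is
proportional to `z u_xx`. Solutions are `1 + O(z)`, and their column sums are even `1 + o(z)`: the
first-order term in row `j` is `-u_x λ_j / 3`, and `∑ λ_j = 0` (`norm_sum_sub_one_le`). In the gauge
adapted to `∞` the potential is `q' / (3q)` times a constant matrix with zero diagonal, and one
integration by parts gives `I + O(1/z)` (`isJost_norm_sub_one_le_infty`). The matrix relating the
gauges has the left eigenvector `(1, 1, 1)`, and the phase changes from `x` to `y`. Hence the third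
column sum, divided by its value at `0`, is `exp ((x - y) z) + o(z)`, from which `x - y` is read
off.

Analyticity of `M` in `z` is not among the hypotheses. It follows from uniqueness: the integral
operators are compact, so by the Fredholm alternative `1 - K(z)` is invertible, and it depends
holomorphically on `z` (`differentiableAt_of_isEigenfunction`).

For uniqueness in the Riemann–Hilbert problem, `rhSol` has determinant `1`. If `F` is another
solution, `F` times the adjugate of `rhSol` has no jump; its poles are removed by a column
operation; it is bounded at `0` and tends to `I`, so Liouville's theorem applies
(`eq_of_det_eq_one`).

Finally, `1 - u_xx` stays positive by a minimum principle (`IsSolution.isInitialDatum`). The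
conservation law `q_t + (u q)_x = 0` gives `y_t = -u q`, so the inverse `x(y, t)` moves with
velocity `u` (`hasDerivWithinAt_inverse`). -/

open scoped BoundedContinuousFunction

namespace OstrovskyVakhnenko

/-! ### Linear differential equations: existence, uniqueness, dependence on parameters -/

section LinearODE

/-- Gronwall's inequality on `[0, T]`, with a crude but convenient bound. -/
theorem norm_le_of_hasDerivWithinAt_le {E : Type*} [NormedAddCommGroup E] [NormedSpace ℝ E]
    {f f' : ℝ → E} {T δ K ε : ℝ} (hδ : 0 ≤ δ) (hK : 0 ≤ K) (hε : 0 ≤ ε)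
    (hf : ∀ t ∈ Set.Icc 0 T, HasDerivWithinAt f (f' t) (Set.Ici 0) t) (h0 : ‖f 0‖ ≤ δ)
    (hf' : ∀ t ∈ Set.Icc 0 T, ‖f' t‖ ≤ K * ‖f t‖ + ε) :
    ∀ t ∈ Set.Icc 0 T, ‖f t‖ ≤ (δ + ε * T) * Real.exp (K * T) := by
  intro t ht
  have h1 := norm_le_gronwallBound_of_norm_deriv_right_le (f := f) (f' := f') (δ := δ) (K := K)
    (ε := ε) (a := 0) (b := T)
    (fun s hs => ((hf s hs).continuousWithinAt).mono (fun r hr => hr.1))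
    (fun s hs => (hf s ⟨hs.1, hs.2.le⟩).mono (fun r hr => hs.1.trans hr)) h0
    (fun s hs => hf' s ⟨hs.1, hs.2.le⟩) t ht
  refine h1.trans ?_
  rw [sub_zero]
  have hT : 0 ≤ T := ht.1.trans ht.2
  have h2 : gronwallBound δ K ε t ≤ (δ + ε * t) * Real.exp (K * t) := by
    rcases hK.eq_or_lt with rfl | hK
    · simp [gronwallBound_K0]
    · rw [gronwallBound_of_K_ne_0 hK.ne']
      have h3 : Real.exp (K * t) - 1 ≤ K * t * Real.exp (K * t) := by
        have := Real.add_one_le_exp (-(K * t))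
        have h4 : Real.exp (-(K * t)) * Real.exp (K * t) = 1 := by rw [← Real.exp_add]; simp
        nlinarith [Real.exp_pos (K * t)]
      have h5 : ε / K * (Real.exp (K * t) - 1) ≤ ε / K * (K * t * Real.exp (K * t)) :=
        mul_le_mul_of_nonneg_left h3 (by positivity)
      have h6 : ε / K * (K * t * Real.exp (K * t)) = ε * t * Real.exp (K * t) := by
        field_simp
      linarith
  refine h2.trans ?_
  have := ht.1
  have := ht.2
  gcongr

variable {R : Type*} [NormedRing R] [NormedAlgebra ℝ R]

/-- Each integration raises the power of `s` by one and contributes the factor `1 / (n + 1)`, so the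
iterates are dominated by the terms of an exponential series. -/
theorem picard_iterate_bound {a : ℝ → R} {Y : ℕ → ℝ → R} {C B T : ℝ} (hC : 0 ≤ C)
    (hY : ∀ n s, Y (n + 1) s = ∫ τ in (0 : ℝ)..s, a τ * Y n τ)
    (ha : ∀ s ∈ Set.Icc 0 T, ‖a s‖ ≤ C) (hB : ∀ s ∈ Set.Icc 0 T, ‖Y 0 s‖ ≤ B) (n : ℕ) :
    ∀ s ∈ Set.Icc 0 T, ‖Y n s‖ ≤ B * ((C * s) ^ n / n.factorial) := by
  induction n with
  | zero => intro s hs; simpa using hB s hs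
  | succ n ih =>
    intro s hs
    rw [hY]
    have h1 : ∀ τ ∈ Set.Ioc 0 s, ‖a τ * Y n τ‖ ≤ C * (B * ((C * τ) ^ n / n.factorial)) := by
      intro τ hτ
      have hτ' : τ ∈ Set.Icc 0 T := ⟨hτ.1.le, hτ.2.trans hs.2⟩
      exact (norm_mul_le _ _).trans
        (mul_le_mul (ha τ hτ') (ih τ hτ') (norm_nonneg _) hC)
    have h2 := intervalIntegral.norm_integral_le_of_norm_le (μ := volume) hs.1
      (Filter.Eventually.of_forall h1) (by
        apply Continuous.intervalIntegrable; fun_prop)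
    refine h2.trans (le_of_eq ?_)
    have h3 : ∀ τ : ℝ, C * (B * ((C * τ) ^ n / n.factorial))
        = (B * C ^ (n + 1) / n.factorial) * τ ^ n := by
      intro τ; rw [mul_pow, pow_succ]; ring
    simp_rw [h3]
    rw [intervalIntegral.integral_const_mul, integral_pow, Nat.factorial_succ, mul_pow]
    push_cast
    have : (n.factorial : ℝ) ≠ 0 := by positivity
    have : (n : ℝ) + 1 ≠ 0 := by positivity
    simp
    field_simp

/-- The solution is the sum of the iterated integrals. The exponential majorant holds on every
bounded interval, so the series is differentiated term by term and the solution is global, with no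
continuation of local solutions. -/
theorem exists_linearODE [CompleteSpace R] {a g : ℝ → R} (ha : Continuous a) (hg : Continuous g)
    (y₀ : R) : ∃ Y : ℝ → R, Y 0 = y₀ ∧ ∀ s, HasDerivAt Y (a s * Y s + g s) s := by
  let Y : ℕ → ℝ → R := fun n => Nat.rec (fun s => y₀ + ∫ τ in (0 : ℝ)..s, g τ)
    (fun _ F s => ∫ τ in (0 : ℝ)..s, a τ * F τ) n
  have Y0 : ∀ s, Y 0 s = y₀ + ∫ τ in (0 : ℝ)..s, g τ := fun s => rfl
  have YS : ∀ n s, Y (n + 1) s = ∫ τ in (0 : ℝ)..s, a τ * Y n τ := fun n s => rfl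
  have D0 : ∀ s, HasDerivAt (Y 0) (g s) s := fun s =>
    (intervalIntegral.integral_hasDerivAt_right (hg.intervalIntegrable _ _)
      (hg.stronglyMeasurableAtFilter _ _) hg.continuousAt).const_add y₀
  have Yc : ∀ n, Continuous (Y n) := by
    intro n
    induction n with
    | zero => exact continuous_iff_continuousAt.2 fun s => (D0 s).continuousAt
    | succ n ih =>
      exact intervalIntegral.continuous_primitive
        (fun _ _ => (ha.mul ih).intervalIntegrable _ _) 0
  have DS : ∀ n s, HasDerivAt (Y (n + 1)) (a s * Y n s) s := fun n s =>
    intervalIntegral.integral_hasDerivAt_right ((ha.mul (Yc n)).intervalIntegrable _ _)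
      ((ha.mul (Yc n)).stronglyMeasurableAtFilter _ _) (ha.mul (Yc n)).continuousAt
  have bound : ∀ T : ℝ, 0 < T → ∃ C B G : ℝ, 0 ≤ C ∧ 0 ≤ B ∧
      (∀ s ∈ Set.Icc (-T) T, ‖a s‖ ≤ C) ∧ (∀ s ∈ Set.Icc (-T) T, ‖g s‖ ≤ G) ∧
      ∀ n, ∀ s ∈ Set.Icc (-T) T, ‖Y n s‖ ≤ B * ((C * T) ^ n / n.factorial) := by
    intro T hT
    obtain ⟨C, hC⟩ := isCompact_Icc.exists_bound_of_continuousOn (s := Set.Icc (-T) T)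
      ha.continuousOn
    obtain ⟨G, hG⟩ := isCompact_Icc.exists_bound_of_continuousOn (s := Set.Icc (-T) T)
      hg.continuousOn
    obtain ⟨B, hB⟩ := isCompact_Icc.exists_bound_of_continuousOn (s := Set.Icc (-T) T)
      (Yc 0).continuousOn
    have h0 : (0 : ℝ) ∈ Set.Icc (-T) T := ⟨by linarith, hT.le⟩
    have hC0 : 0 ≤ C := (norm_nonneg _).trans (hC 0 h0)
    have hB0 : 0 ≤ B := (norm_nonneg _).trans (hB 0 h0)
    refine ⟨C, B, G, hC0, hB0, hC, hG, fun n s hs => ?_⟩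
    have key : ‖Y n s‖ ≤ B * ((C * |s|) ^ n / n.factorial) := by
      rcases le_total 0 s with h | h
      · rw [abs_of_nonneg h]
        exact picard_iterate_bound (a := a) (T := T) hC0 YS
          (fun r hr => hC r ⟨by linarith [hr.1], hr.2⟩)
          (fun r hr => hB r ⟨by linarith [hr.1], hr.2⟩) n s ⟨h, hs.2⟩
      · have := picard_iterate_bound (a := fun r => -a (-r)) (Y := fun n r => Y n (-r)) (T := T)
          (B := B) hC0 (fun n r => by
            simp only [YS]
            have := intervalIntegral.integral_comp_neg (a := 0) (b := r)
              (fun τ => a τ * Y n τ)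
            simp only [neg_mul, intervalIntegral.integral_neg, this, neg_zero]
            rw [intervalIntegral.integral_symm])
          (fun r hr => by rw [norm_neg]; exact hC _ ⟨by linarith [hr.2], by linarith [hr.1]⟩)
          (fun r hr => hB _ ⟨by linarith [hr.2], by linarith [hr.1]⟩) n (-s)
          ⟨by linarith, by linarith [hs.1]⟩
        rw [abs_of_nonpos h]
        simpa using this
    refine key.trans ?_
    have := abs_le.2 hs
    gcongr
  have summ : ∀ s, Summable fun n => Y n s := by
    intro s
    obtain ⟨C, B, G, hC, hB, -, -, h⟩ := bound (|s| + 1) (by positivity)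
    refine Summable.of_norm_bounded
      (((Real.summable_pow_div_factorial (C * (|s| + 1))).mul_left B)) fun n => ?_
    exact h n s (abs_le.1 (by linarith))
  refine ⟨fun s => ∑' n, Y n s, ?_, fun s => ?_⟩
  · change ∑' n, Y n 0 = y₀
    rw [tsum_eq_single 0]
    · simp [Y0]
    · intro n hn
      obtain ⟨k, rfl⟩ := Nat.exists_eq_succ_of_ne_zero hn
      simp [YS]
  · obtain ⟨C, B, G, hC, hB, hCa, hGg, h⟩ := bound (|s| + 1) (by positivity)
    let Y' : ℕ → ℝ → R := fun n => Nat.casesOn n g (fun k r => a r * Y k r)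
    let v : ℕ → ℝ := fun n => Nat.casesOn n G
      (fun k => C * (B * ((C * (|s| + 1)) ^ k / k.factorial)))
    have hv : Summable v := by
      rw [← summable_nat_add_iff 1]
      exact ((Real.summable_pow_div_factorial (C * (|s| + 1))).mul_left B).mul_left C
    have hmem : ∀ r ∈ Set.Ioo (-(|s| + 1)) (|s| + 1), r ∈ Set.Icc (-(|s| + 1)) (|s| + 1) :=
      fun r hr => ⟨hr.1.le, hr.2.le⟩
    have hs : s ∈ Set.Ioo (-(|s| + 1)) (|s| + 1) := abs_lt.1 (by linarith)
    have key := hasDerivAt_tsum_of_isPreconnected (g := Y) (g' := Y') hv isOpen_Ioo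
      isPreconnected_Ioo (fun n r hr => by
        cases n with
        | zero => exact D0 r
        | succ k => exact DS k r) (fun n r hr => by
        cases n with
        | zero => exact hGg r (hmem r hr)
        | succ k =>
          exact (norm_mul_le _ _).trans (mul_le_mul (hCa r (hmem r hr)) (h k r (hmem r hr))
            (norm_nonneg _) hC)) hs (summ s) hs
    convert! key using 1
    have hs' : Summable fun n => Y' n s := by
      rw [← summable_nat_add_iff 1]
      exact (summ s).mul_left (a s)
    rw [hs'.tsum_eq_zero_add]
    change _ = g s + ∑' k, a s * Y k s
    rw [(summ s).tsum_mul_left, add_comm]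

/-- Uniqueness for linear equations on `[0, ∞)`. -/
theorem linearODE_unique_of_nonneg {a : ℝ → R} (ha : ContinuousOn a (Set.Ici 0)) {f g b : ℝ → R}
    (hf : ∀ s, 0 ≤ s → HasDerivWithinAt f (a s * f s + b s) (Set.Ici 0) s)
    (hg : ∀ s, 0 ≤ s → HasDerivWithinAt g (a s * g s + b s) (Set.Ici 0) s)
    (h : f 0 = g 0) {s : ℝ} (hs : 0 ≤ s) : f s = g s := by
  obtain ⟨C, hC⟩ := isCompact_Icc.exists_bound_of_continuousOn (s := Set.Icc 0 s)
    (ha.mono fun r hr => hr.1)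
  have hC0 : 0 ≤ C := (norm_nonneg _).trans (hC 0 ⟨le_rfl, hs⟩)
  have := norm_le_of_hasDerivWithinAt_le (f := fun r => f r - g r)
    (f' := fun r => a r * (f r - g r)) (T := s) le_rfl hC0 le_rfl
    (fun r hr => by
      have := (hf r hr.1).sub (hg r hr.1)
      convert! this using 1
      rw [mul_sub]; abel) (by simp [h])
    (fun r hr => by
      rw [add_zero]
      exact (norm_mul_le _ _).trans (mul_le_mul_of_nonneg_right (hC r hr) (norm_nonneg _)))
    s ⟨hs, le_rfl⟩
  simp only [zero_mul, add_zero] at this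
  exact sub_eq_zero.1 (norm_le_zero_iff.1 this)

theorem linearODE_unique {a : ℝ → R} (ha : Continuous a) {f g b : ℝ → R}
    (hf : ∀ s, HasDerivAt f (a s * f s + b s) s)
    (hg : ∀ s, HasDerivAt g (a s * g s + b s) s) (h : f 0 = g 0) (s : ℝ) : f s = g s := by
  rcases le_total 0 s with hs | hs
  · exact linearODE_unique_of_nonneg ha.continuousOn (fun r _ => (hf r).hasDerivWithinAt)
      (fun r _ => (hg r).hasDerivWithinAt) h hs
  · have key : ∀ {f : ℝ → R}, (∀ s, HasDerivAt f (a s * f s + b s) s) → ∀ r,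
        HasDerivAt (fun r => f (-r)) (-a (-r) * f (-r) + -b (-r)) r := by
      intro f hf r
      have := (hf (-r)).scomp r (hasDerivAt_neg r)
      convert! this using 1
      simp
    have := linearODE_unique_of_nonneg (R := R) (a := fun r => -a (-r)) (b := fun r => -b (-r))
      (f := fun r => f (-r)) (g := fun r => g (-r)) (by fun_prop)
      (fun r _ => (key hf r).hasDerivWithinAt) (fun r _ => (key hg r).hasDerivWithinAt)
      (by simp [h]) (neg_nonneg.2 hs)
    simpa using this

/-- First order Taylor expansion in a parameter, uniformly in a compact set. -/
theorem eventually_norm_sub_sub_le {𝕜 E : Type*} [RCLike 𝕜] [NormedAddCommGroup E]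
    [NormedSpace 𝕜 E] {f f' : 𝕜 → ℝ → E} {p₀ : 𝕜} {r T : ℝ} (hr : 0 < r)
    (hf : ∀ p ∈ Metric.closedBall p₀ r, ∀ t ∈ Set.Icc 0 T,
      HasDerivAt (fun p => f p t) (f' p t) p)
    (hf' : ContinuousOn (fun x : 𝕜 × ℝ => f' x.1 x.2) (Metric.closedBall p₀ r ×ˢ Set.Icc 0 T))
    {ε : ℝ} (hε : 0 < ε) :
    ∀ᶠ p in 𝓝 p₀, ∀ t ∈ Set.Icc 0 T,
      ‖f p t - f p₀ t - (p - p₀) • f' p₀ t‖ ≤ ε * ‖p - p₀‖ := by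
  have hcomp : IsCompact (Metric.closedBall p₀ r ×ˢ Set.Icc (0 : ℝ) T) :=
    (isCompact_closedBall p₀ r).prod isCompact_Icc
  have hu := hcomp.uniformContinuousOn_of_continuous hf'
  rw [Metric.uniformContinuousOn_iff] at hu
  obtain ⟨δ, hδ, hu⟩ := hu ε hε
  have hmin : 0 < min r (δ / 2) := by positivity
  filter_upwards [Metric.ball_mem_nhds p₀ hmin] with p hp t ht
  have hsub : ∀ x ∈ Metric.ball p₀ (min r (δ / 2)), x ∈ Metric.closedBall p₀ r ∧ dist x p₀ < δ := by
    intro x hx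
    have := Metric.mem_ball.1 hx
    exact ⟨Metric.mem_closedBall.2 (this.le.trans (min_le_left _ _)),
      this.trans_le ((min_le_right _ _).trans (by linarith))⟩
  have key := (convex_ball p₀ (min r (δ / 2))).norm_image_sub_le_of_norm_hasDerivWithin_le
    (𝕜 := 𝕜) (f := fun p => f p t - p • f' p₀ t) (f' := fun p => f' p t - f' p₀ t) (C := ε)
    (fun x hx => by
      have := ((hf x (hsub x hx).1 t ht).sub ((hasDerivAt_id x).smul_const (f' p₀ t)))
      rw [one_smul] at this
      exact this.hasDerivWithinAt)
    (fun x hx => by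
      rw [← dist_eq_norm]
      refine (hu (x, t) ⟨(hsub x hx).1, ht⟩ (p₀, t)
        ⟨Metric.mem_closedBall_self hr.le, ht⟩ ?_).le
      simpa [Prod.dist_eq] using (hsub x hx).2)
    (Metric.mem_ball_self hmin) hp
  convert! key using 2
  rw [sub_smul]; abel

/-- Differentiability of solutions of linear equations with respect to a parameter. -/
theorem hasDerivAt_linearODE_param {𝕜 : Type*} [RCLike 𝕜] [NormedAlgebra 𝕜 R]
    [IsScalarTower ℝ 𝕜 R]
    {a a' : 𝕜 → ℝ → R} {Y : 𝕜 → ℝ → R} {Z : ℝ → R} {p₀ : 𝕜} {r T : ℝ} (hr : 0 < r) (hT : 0 ≤ T)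
    (ha : ∀ p ∈ Metric.closedBall p₀ r, ∀ t ∈ Set.Icc 0 T,
      HasDerivAt (fun p => a p t) (a' p t) p)
    (hac : ContinuousOn (fun x : 𝕜 × ℝ => a x.1 x.2) (Metric.closedBall p₀ r ×ˢ Set.Icc 0 T))
    (ha' : ContinuousOn (fun x : 𝕜 × ℝ => a' x.1 x.2) (Metric.closedBall p₀ r ×ˢ Set.Icc 0 T))
    (hY : ∀ p ∈ Metric.closedBall p₀ r, ∀ t ∈ Set.Icc 0 T,
      HasDerivWithinAt (Y p) (a p t * Y p t) (Set.Ici 0) t)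
    (hZ : ∀ t ∈ Set.Icc 0 T,
      HasDerivWithinAt Z (a p₀ t * Z t + a' p₀ t * Y p₀ t) (Set.Ici 0) t)
    (h0 : HasDerivAt (fun p => Y p 0) (Z 0) p₀) :
    HasDerivAt (fun p => Y p T) (Z T) p₀ := by
  have hcomp : IsCompact (Metric.closedBall p₀ r ×ˢ Set.Icc (0 : ℝ) T) :=
    (isCompact_closedBall p₀ r).prod isCompact_Icc
  obtain ⟨C, hC⟩ := hcomp.exists_bound_of_continuousOn hac
  obtain ⟨C', hC'⟩ := hcomp.exists_bound_of_continuousOn ha'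
  have hp₀ : p₀ ∈ Metric.closedBall p₀ r := Metric.mem_closedBall_self hr.le
  have h0T : (0 : ℝ) ∈ Set.Icc 0 T := ⟨le_rfl, hT⟩
  have hC0 : 0 ≤ C := (norm_nonneg _).trans (hC (p₀, 0) ⟨hp₀, h0T⟩)
  have hC'0 : 0 ≤ C' := (norm_nonneg _).trans (hC' (p₀, 0) ⟨hp₀, h0T⟩)
  set B : ℝ := (‖Y p₀ 0‖ + 1) * Real.exp (C * T) with hB
  have hB0 : 0 ≤ B := by positivity
  -- boundedness
  have e1 : ∀ᶠ p in 𝓝 p₀, ∀ t ∈ Set.Icc 0 T, ‖Y p t‖ ≤ B := by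
    have hc : ∀ᶠ p in 𝓝 p₀, ‖Y p 0‖ < ‖Y p₀ 0‖ + 1 :=
      (h0.continuousAt.norm).eventually_lt continuousAt_const (by simp)
    filter_upwards [hc, Metric.closedBall_mem_nhds p₀ hr] with p hp hpr t ht
    have := norm_le_of_hasDerivWithinAt_le (δ := ‖Y p₀ 0‖ + 1) (K := C) (ε := 0) (T := T)
      (by positivity) hC0 le_rfl (hY p hpr) hp.le (fun s hs => by
        rw [add_zero]
        exact (norm_mul_le _ _).trans
          (mul_le_mul_of_nonneg_right (hC (p, s) ⟨hpr, hs⟩) (norm_nonneg _))) t ht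
    simpa using this
  -- Taylor expansion of the coefficients
  have e2 : ∀ ε : ℝ, 0 < ε → ∀ᶠ p in 𝓝 p₀, ∀ t ∈ Set.Icc 0 T,
      ‖a p t - a p₀ t - (p - p₀) • a' p₀ t‖ ≤ ε * ‖p - p₀‖ :=
    fun ε hε => eventually_norm_sub_sub_le hr ha ha' hε
  -- Lipschitz estimate
  obtain ⟨c, hc⟩ := h0.isBigO_sub.bound
  set L : ℝ := (|c| + (1 + C') * B * T) * Real.exp (C * T) with hL
  have hL0 : 0 ≤ L := by positivity
  have e3 : ∀ᶠ p in 𝓝 p₀, ∀ t ∈ Set.Icc 0 T, ‖Y p t - Y p₀ t‖ ≤ L * ‖p - p₀‖ := by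
    filter_upwards [e1, e2 1 one_pos, hc, Metric.closedBall_mem_nhds p₀ hr]
      with p h1 h2 h3 hpr t ht
    have := norm_le_of_hasDerivWithinAt_le (f := fun t => Y p t - Y p₀ t)
      (f' := fun t => a p t * Y p t - a p₀ t * Y p₀ t) (δ := |c| * ‖p - p₀‖) (K := C)
      (ε := (1 + C') * ‖p - p₀‖ * B) (T := T) (by positivity) hC0 (by positivity)
      (fun s hs => (hY p hpr s hs).sub (hY p₀ hp₀ s hs))
      (h3.trans (mul_le_mul_of_nonneg_right (le_abs_self c) (norm_nonneg _)))
      (fun s hs => by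
        have e : a p s * Y p s - a p₀ s * Y p₀ s
            = a p₀ s * (Y p s - Y p₀ s) + (a p s - a p₀ s) * Y p s := by noncomm_ring
        have e' : ‖a p s - a p₀ s‖ ≤ (1 + C') * ‖p - p₀‖ := by
          have : a p s - a p₀ s = (a p s - a p₀ s - (p - p₀) • a' p₀ s) + (p - p₀) • a' p₀ s := by
            abel
          rw [this]
          refine (norm_add_le _ _).trans ?_
          have i1 := h2 s hs
          have i2 : ‖(p - p₀) • a' p₀ s‖ ≤ ‖p - p₀‖ * C' := by
            rw [norm_smul]
            exact mul_le_mul_of_nonneg_left (hC' (p₀, s) ⟨hp₀, hs⟩) (norm_nonneg _)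
          linarith
        rw [e]
        refine (norm_add_le _ _).trans (add_le_add ?_ ?_)
        · exact (norm_mul_le _ _).trans
            (mul_le_mul_of_nonneg_right (hC (p₀, s) ⟨hp₀, hs⟩) (norm_nonneg _))
        · exact (norm_mul_le _ _).trans (mul_le_mul e' (h1 s hs) (norm_nonneg _) (by positivity)))
      t ht
    refine this.trans (le_of_eq ?_)
    rw [hL]; ring
  -- the derivative
  rw [hasDerivAt_iff_isLittleO]
  rw [Asymptotics.isLittleO_iff]
  intro η hη
  set κ : ℝ := (1 + (1 + B + C' * L) * T) * Real.exp (C * T) with hκ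
  have hκ0 : 0 < κ := by
    have : 0 ≤ (1 + B + C' * L) * T := by positivity
    positivity
  have hε : 0 < η / κ := by positivity
  have hsmall : ∀ᶠ p in 𝓝 p₀, ‖p - p₀‖ < η / κ := by
    have : ContinuousAt (fun p => ‖p - p₀‖) p₀ := by fun_prop
    exact this.eventually_lt continuousAt_const (by simpa using hε)
  have h0' := (Asymptotics.isLittleO_iff.1 (hasDerivAt_iff_isLittleO.1 h0)) hε
  filter_upwards [e1, e2 _ hε, e3, hsmall, h0', Metric.closedBall_mem_nhds p₀ hr]
    with p h1 h2 h3 h4 h5 hpr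
  have := norm_le_of_hasDerivWithinAt_le (f := fun t => Y p t - Y p₀ t - (p - p₀) • Z t)
    (f' := fun t => a p t * Y p t - a p₀ t * Y p₀ t
      - (p - p₀) • (a p₀ t * Z t + a' p₀ t * Y p₀ t))
    (δ := η / κ * ‖p - p₀‖) (K := C)
    (ε := η / κ * ‖p - p₀‖ * (1 + B + C' * L)) (T := T) (by positivity) hC0 (by positivity)
    (fun s hs => ((hY p hpr s hs).sub (hY p₀ hp₀ s hs)).sub ((hZ s hs).const_smul (p - p₀))) h5
    (fun s hs => by
      have e : a p s * Y p s - a p₀ s * Y p₀ s - (p - p₀) • (a p₀ s * Z s + a' p₀ s * Y p₀ s)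
          = a p₀ s * (Y p s - Y p₀ s - (p - p₀) • Z s)
            + ((a p s - a p₀ s - (p - p₀) • a' p₀ s) * Y p s
              + (p - p₀) • (a' p₀ s * (Y p s - Y p₀ s))) := by
        simp only [smul_add, mul_sub, sub_mul, smul_sub, smul_mul_assoc, mul_smul_comm]
        abel
      rw [e]
      refine (norm_add_le _ _).trans (add_le_add ?_ ?_)
      · exact (norm_mul_le _ _).trans
          (mul_le_mul_of_nonneg_right (hC (p₀, s) ⟨hp₀, hs⟩) (norm_nonneg _))
      · refine (norm_add_le _ _).trans ?_
        have i1 : ‖(a p s - a p₀ s - (p - p₀) • a' p₀ s) * Y p s‖ ≤ η / κ * ‖p - p₀‖ * B :=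
          (norm_mul_le _ _).trans (mul_le_mul (h2 s hs) (h1 s hs) (norm_nonneg _) (by positivity))
        have i2 : ‖(p - p₀) • (a' p₀ s * (Y p s - Y p₀ s))‖
            ≤ η / κ * (C' * (L * ‖p - p₀‖)) := by
          rw [norm_smul]
          refine mul_le_mul h4.le ?_ (norm_nonneg _) hε.le
          exact (norm_mul_le _ _).trans
            (mul_le_mul (hC' (p₀, s) ⟨hp₀, hs⟩) (h3 s hs) (norm_nonneg _) hC'0)
        have i3 : 0 ≤ η / κ * ‖p - p₀‖ := by positivity
        nlinarith)
    T ⟨hT, le_rfl⟩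
  refine this.trans (le_of_eq ?_)
  have : η * ‖p - p₀‖ = η / κ * κ * ‖p - p₀‖ := by field_simp
  rw [this, hκ]; ring

end LinearODE

/-! ### Decay and regularity of a spatial profile and of `q`, `y`, `q' / (3q)` -/

section Profile

theorem eq_neg_integral_Ioi_of_tendsto_zero {f f' : ℝ → ℝ} (hf : ∀ x, HasDerivAt f (f' x) x)
    (hi : Integrable f') (h : Tendsto f atTop (𝓝 0)) (x : ℝ) : f x = -∫ ξ in Set.Ioi x, f' ξ := by
  rw [integral_Ioi_of_hasDerivAt_of_tendsto' (fun y _ => hf y) hi.integrableOn h]; ring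

theorem eq_integral_Iic_of_tendsto_zero {f f' : ℝ → ℝ} (hf : ∀ x, HasDerivAt f (f' x) x)
    (hi : Integrable f') (h : Tendsto f atBot (𝓝 0)) (x : ℝ) : f x = ∫ ξ in Set.Iic x, f' ξ := by
  rw [integral_Iic_of_hasDerivAt_of_tendsto' (fun y _ => hf y) hi.integrableOn h]; ring

theorem abs_le_integral_Ioi_of_tendsto_zero {f f' g : ℝ → ℝ} (hf : ∀ x, HasDerivAt f (f' x) x)
    (hi : Integrable f') (hg : Integrable g) (hfg : ∀ x, |f' x| ≤ g x)
    (h : Tendsto f atTop (𝓝 0)) (x : ℝ) : |f x| ≤ ∫ ξ in Set.Ioi x, g ξ := by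
  rw [eq_neg_integral_Ioi_of_tendsto_zero hf hi h, abs_neg, ← Real.norm_eq_abs]
  exact norm_integral_le_of_norm_le hg.integrableOn (Eventually.of_forall fun ξ => hfg ξ)

theorem abs_le_integral_Iic_of_tendsto_zero {f f' g : ℝ → ℝ} (hf : ∀ x, HasDerivAt f (f' x) x)
    (hi : Integrable f') (hg : Integrable g) (hfg : ∀ x, |f' x| ≤ g x)
    (h : Tendsto f atBot (𝓝 0)) (x : ℝ) : |f x| ≤ ∫ ξ in Set.Iic x, g ξ := by
  rw [eq_integral_Iic_of_tendsto_zero hf hi h, ← Real.norm_eq_abs]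
  exact norm_integral_le_of_norm_le hg.integrableOn (Eventually.of_forall fun ξ => hfg ξ)

theorem tendsto_integral_Ioi_atTop {g : ℝ → ℝ} (hg : Integrable g) :
    Tendsto (fun x => ∫ ξ in Set.Ioi x, g ξ) atTop (𝓝 0) := by
  have h := intervalIntegral_tendsto_integral_Ioi 0 hg.integrableOn tendsto_id
  have : (fun x => ∫ ξ in Set.Ioi x, g ξ)
      = fun x => (∫ ξ in Set.Ioi 0, g ξ) - ∫ ξ in (0 : ℝ)..x, g ξ := by
    ext x
    rw [← intervalIntegral.integral_Ioi_sub_Ioi' hg.integrableOn hg.integrableOn]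
    ring
  rw [this]
  simpa using h.const_sub (∫ ξ in Set.Ioi 0, g ξ)

theorem tendsto_integral_Iic_atBot {g : ℝ → ℝ} (hg : Integrable g) :
    Tendsto (fun x => ∫ ξ in Set.Iic x, g ξ) atBot (𝓝 0) := by
  have h := (tendsto_integral_Ioi_atTop hg.comp_neg).comp tendsto_neg_atBot_atTop
  refine h.congr fun x => ?_
  simp [integral_comp_neg_Ioi]

/-- By the mean value theorem on `[x, x + 1]`, the derivative takes the value `f (x + 1) - f x` at
points tending to infinity. -/
theorem deriv_limit_eq_zero_atTop {f f' : ℝ → ℝ} {L : ℝ} (hf : ∀ x, HasDerivAt f (f' x) x)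
    (h0 : Tendsto f atTop (𝓝 0)) (hL : Tendsto f' atTop (𝓝 L)) : L = 0 := by
  have h1 : ∀ x : ℝ, ∃ c ∈ Set.Ioo x (x + 1), f' c = f (x + 1) - f x := by
    intro x
    obtain ⟨c, hc, h⟩ := exists_hasDerivAt_eq_slope f f' (lt_add_one x)
      (fun y _ => (hf y).continuousAt.continuousWithinAt) (fun y _ => hf y)
    exact ⟨c, hc, by simpa using h⟩
  choose c hc h using h1
  have hc' : Tendsto c atTop atTop := tendsto_atTop_mono (fun x => (hc x).1.le) tendsto_id
  have h2 := hL.comp hc'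
  have h3 : Tendsto (fun x => f (x + 1) - f x) atTop (𝓝 (0 - 0)) :=
    (h0.comp (tendsto_atTop_add_const_right _ 1 tendsto_id)).sub h0
  rw [sub_zero] at h3
  exact tendsto_nhds_unique h2 (h3.congr fun x => (h x).symm)

theorem tendsto_zero_atTop_of_integrable {f f' : ℝ → ℝ} (hf : ∀ x, HasDerivAt f (f' x) x)
    (hi : Integrable f) (hi' : Integrable f') : Tendsto f atTop (𝓝 0) :=
  tendsto_zero_of_hasDerivAt_of_integrableOn_Ioi (a := 0) (fun x _ => hf x) hi'.integrableOn
    hi.integrableOn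

theorem hasDerivAt_comp_neg {f f' : ℝ → ℝ} (hf : ∀ x, HasDerivAt f (f' x) x) (x : ℝ) :
    HasDerivAt (fun x => f (-x)) (-f' (-x)) x := by
  have := (hf (-x)).comp x (hasDerivAt_neg x)
  rw [mul_neg_one] at this
  exact this

theorem tendsto_zero_atBot_of_integrable {f f' : ℝ → ℝ} (hf : ∀ x, HasDerivAt f (f' x) x)
    (hi : Integrable f) (hi' : Integrable f') : Tendsto f atBot (𝓝 0) := by
  have := (tendsto_zero_atTop_of_integrable (hasDerivAt_comp_neg hf) hi.comp_neg
    hi'.comp_neg.neg).comp tendsto_neg_atBot_atTop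
  simpa [Function.comp_def] using this

/-- Serves for `u_x`, which is not assumed to be integrable: integrability of `u_xx` gives a limit,
and decay of `u` forces the limit to be `0`. -/
theorem deriv_tendsto_zero_atTop {f f' f'' : ℝ → ℝ} (hf : ∀ x, HasDerivAt f (f' x) x)
    (hf' : ∀ x, HasDerivAt f' (f'' x) x)
    (h0 : Tendsto f atTop (𝓝 0)) (hi : Integrable f'') : Tendsto f' atTop (𝓝 0) := by
  have h1 := tendsto_limUnder_of_hasDerivAt_of_integrableOn_Ioi (a := 0) (fun x _ => hf' x)
    hi.integrableOn
  rwa [deriv_limit_eq_zero_atTop hf h0 h1] at h1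

theorem deriv_tendsto_zero_atBot {f f' f'' : ℝ → ℝ} (hf : ∀ x, HasDerivAt f (f' x) x)
    (hf' : ∀ x, HasDerivAt f' (f'' x) x)
    (h0 : Tendsto f atBot (𝓝 0)) (hi : Integrable f'') : Tendsto f' atBot (𝓝 0) := by
  have h := deriv_tendsto_zero_atTop (hasDerivAt_comp_neg hf)
    (fun x => (hasDerivAt_comp_neg hf' x).neg) (h0.comp tendsto_neg_atTop_atBot)
    (by simpa using hi.comp_neg)
  have := (h.comp tendsto_neg_atBot_atTop).neg
  simpa [Function.comp_def] using this

/-- `1 - w''`. -/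
noncomputable def mOf (w : ℝ → ℝ) (x : ℝ) : ℝ := 1 - iteratedDeriv 2 w x

/-- `q' / (3 q)`, expressed by derivatives of `w`. -/
noncomputable def kapOf (w : ℝ → ℝ) (x : ℝ) : ℝ := -iteratedDeriv 3 w x / (9 * mOf w x)

/-- The derivative of `kapOf w`. -/
noncomputable def kapOf' (w : ℝ → ℝ) (x : ℝ) : ℝ :=
  -(iteratedDeriv 4 w x * mOf w x + iteratedDeriv 3 w x ^ 2) / (9 * mOf w x ^ 2)

/-- The regularity and decay of a profile, without the sign condition. -/
structure IsDecaying (w : ℝ → ℝ) : Prop where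
  smooth : ContDiff ℝ ∞ w
  tendsto_zero : Tendsto w (cocompact ℝ) (𝓝 0)
  integrable : ∀ k ∈ Finset.Icc 2 4, Integrable (iteratedDeriv k w)

namespace IsDecaying

variable {w : ℝ → ℝ} (h : IsDecaying w)
include h

theorem hasDerivAt (k : ℕ) (x : ℝ) :
    HasDerivAt (iteratedDeriv k w) (iteratedDeriv (k + 1) w x) x := by
  rw [iteratedDeriv_succ]
  exact ((h.smooth.differentiable_iteratedDeriv k (by exact_mod_cast WithTop.coe_lt_top _)) x).hasDerivAt

theorem continuous_iteratedDeriv (k : ℕ) : Continuous (iteratedDeriv k w) :=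
  continuous_iff_continuousAt.2 fun x => (h.hasDerivAt k x).continuousAt

theorem tendsto_atTop {k : ℕ} (hk : k ≤ 3) : Tendsto (iteratedDeriv k w) atTop (𝓝 0) := by
  have h0 : Tendsto (iteratedDeriv 0 w) atTop (𝓝 0) := by
    rw [iteratedDeriv_zero]
    exact h.tendsto_zero.mono_left atTop_le_cocompact
  interval_cases k
  · exact h0
  · exact deriv_tendsto_zero_atTop (h.hasDerivAt 0) (h.hasDerivAt 1) h0 (h.integrable 2 (by simp))
  · exact tendsto_zero_atTop_of_integrable (h.hasDerivAt 2) (h.integrable 2 (by simp))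
      (h.integrable 3 (by simp))
  · exact tendsto_zero_atTop_of_integrable (h.hasDerivAt 3) (h.integrable 3 (by simp))
      (h.integrable 4 (by simp))

theorem tendsto_atBot {k : ℕ} (hk : k ≤ 3) : Tendsto (iteratedDeriv k w) atBot (𝓝 0) := by
  have h0 : Tendsto (iteratedDeriv 0 w) atBot (𝓝 0) := by
    rw [iteratedDeriv_zero]
    exact h.tendsto_zero.mono_left atBot_le_cocompact
  interval_cases k
  · exact h0
  · exact deriv_tendsto_zero_atBot (h.hasDerivAt 0) (h.hasDerivAt 1) h0 (h.integrable 2 (by simp))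
  · exact tendsto_zero_atBot_of_integrable (h.hasDerivAt 2) (h.integrable 2 (by simp))
      (h.integrable 3 (by simp))
  · exact tendsto_zero_atBot_of_integrable (h.hasDerivAt 3) (h.integrable 3 (by simp))
      (h.integrable 4 (by simp))

end IsDecaying

namespace IsInitialDatum

variable {w : ℝ → ℝ} (h : IsInitialDatum w)
include h

theorem isDecaying : IsDecaying w := ⟨h.smooth, h.tendsto_zero, h.integrable⟩

theorem hasDerivAt (k : ℕ) (x : ℝ) :
    HasDerivAt (iteratedDeriv k w) (iteratedDeriv (k + 1) w x) x := h.isDecaying.hasDerivAt k x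

theorem continuous_iteratedDeriv (k : ℕ) : Continuous (iteratedDeriv k w) :=
  h.isDecaying.continuous_iteratedDeriv k

theorem tendsto_atTop {k : ℕ} (hk : k ≤ 3) : Tendsto (iteratedDeriv k w) atTop (𝓝 0) :=
  h.isDecaying.tendsto_atTop hk

theorem tendsto_atBot {k : ℕ} (hk : k ≤ 3) : Tendsto (iteratedDeriv k w) atBot (𝓝 0) :=
  h.isDecaying.tendsto_atBot hk

theorem exists_bound {k : ℕ} (hk : k ≤ 3) : ∃ C, ∀ x, |iteratedDeriv k w x| ≤ C := by
  have h1 : ∀ᶠ x in cocompact ℝ, |iteratedDeriv k w x| < 1 := by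
    rw [cocompact_eq_atBot_atTop, eventually_sup]
    exact ⟨(h.tendsto_atBot hk).abs.eventually_lt_const (by simp),
      (h.tendsto_atTop hk).abs.eventually_lt_const (by simp)⟩
  obtain ⟨K, hK, hK'⟩ := mem_cocompact.1 h1
  obtain ⟨C, hC⟩ := hK.exists_bound_of_continuousOn (h.continuous_iteratedDeriv k).continuousOn
  refine ⟨max C 1, fun x => ?_⟩
  by_cases hx : x ∈ K
  · exact (hC x hx).trans (le_max_left _ _)
  · exact (le_of_lt (hK' hx)).trans (le_max_right _ _)

theorem mOf_pos (x : ℝ) : 0 < mOf w x := h.pos x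

theorem hasDerivAt_mOf (x : ℝ) : HasDerivAt (mOf w) (-iteratedDeriv 3 w x) x := by
  exact (h.hasDerivAt 2 x).const_sub 1

theorem continuous_mOf : Continuous (mOf w) :=
  continuous_iff_continuousAt.2 fun x => (h.hasDerivAt_mOf x).continuousAt

theorem tendsto_mOf_cocompact : Tendsto (mOf w) (cocompact ℝ) (𝓝 1) := by
  rw [cocompact_eq_atBot_atTop, tendsto_sup]
  constructor
  · have := (h.tendsto_atBot (k := 2) (by norm_num)).const_sub 1
    rwa [sub_zero] at this
  · have := (h.tendsto_atTop (k := 2) (by norm_num)).const_sub 1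
    rwa [sub_zero] at this

theorem exists_le_mOf : ∃ c, 0 < c ∧ ∀ x, c ≤ mOf w x := by
  have h1 : ∀ᶠ x in cocompact ℝ, 1 / 2 < mOf w x :=
    h.tendsto_mOf_cocompact.eventually_const_lt (by norm_num)
  obtain ⟨K, hK, hK'⟩ := mem_cocompact.1 h1
  rcases K.eq_empty_or_nonempty with rfl | hne
  · exact ⟨1 / 2, by norm_num, fun x => le_of_lt (hK' (by simp))⟩
  · obtain ⟨x₀, -, hx₀⟩ := hK.exists_isMinOn hne h.continuous_mOf.continuousOn
    refine ⟨min (mOf w x₀) (1 / 2), lt_min (h.mOf_pos _) (by norm_num), fun x => ?_⟩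
    by_cases hx : x ∈ K
    · exact (min_le_left _ _).trans (hx₀ hx)
    · exact (min_le_right _ _).trans (le_of_lt (hK' hx))

theorem exists_mOf_le : ∃ C, ∀ x, mOf w x ≤ C := by
  obtain ⟨C, hC⟩ := h.exists_bound (k := 2) (by norm_num)
  exact ⟨1 + C, fun x => by have := (abs_le.1 (hC x)).1; unfold mOf; linarith⟩

theorem qOf_pos (x : ℝ) : 0 < qOf w x := Real.rpow_pos_of_pos (h.pos x) _

theorem qOf_pow (x : ℝ) : qOf w x ^ 3 = mOf w x := by
  rw [qOf, ← Real.rpow_natCast, ← Real.rpow_mul (h.pos x).le]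
  norm_num [mOf]

theorem hasDerivAt_qOf (x : ℝ) : HasDerivAt (qOf w) (3 * kapOf w x * qOf w x) x := by
  have h1 := (h.hasDerivAt_mOf x).rpow_const (p := 1 / 3) (Or.inl (h.mOf_pos x).ne')
  have h2 : (mOf w x) ^ ((1 / 3 : ℝ) - 1) = qOf w x / mOf w x := by
    rw [Real.rpow_sub (h.mOf_pos x), Real.rpow_one]; rfl
  rw [h2] at h1
  convert! h1 using 1
  have := (h.mOf_pos x).ne'
  unfold kapOf
  field_simp
  ring

theorem continuous_qOf : Continuous (qOf w) :=
  continuous_iff_continuousAt.2 fun x => (h.hasDerivAt_qOf x).continuousAt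

theorem exists_le_qOf : ∃ c, 0 < c ∧ ∀ x, c ≤ qOf w x := by
  obtain ⟨c, hc, hm⟩ := h.exists_le_mOf
  exact ⟨c ^ (1 / 3 : ℝ), by positivity, fun x =>
    Real.rpow_le_rpow hc.le (hm x) (by norm_num)⟩

theorem exists_qOf_le : ∃ C, ∀ x, qOf w x ≤ C := by
  obtain ⟨C, hC⟩ := h.exists_mOf_le
  exact ⟨C ^ (1 / 3 : ℝ), fun x => Real.rpow_le_rpow (h.pos x).le (hC x) (by norm_num)⟩

/-- Since `q³ = 1 - w''`, one has `w'' = (1 - q)(1 + q + q²)`, and the second factor is at least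
`1`. Integrability and decay pass from `w''` to `q - 1`. -/
theorem abs_qOf_sub_one_le (x : ℝ) : |qOf w x - 1| ≤ |iteratedDeriv 2 w x| := by
  have h1 : iteratedDeriv 2 w x = (1 - qOf w x) * (1 + qOf w x + qOf w x ^ 2) := by
    have := h.qOf_pow x
    unfold mOf at this
    linarith [this]
  have hq := h.qOf_pos x
  rw [h1, abs_mul, abs_sub_comm]
  have : 1 ≤ |1 + qOf w x + qOf w x ^ 2| := by
    rw [abs_of_pos (by positivity)]; nlinarith
  nlinarith [abs_nonneg (1 - qOf w x)]

theorem integrable_qOf_sub_one : Integrable (fun x => qOf w x - 1) :=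
  (h.integrable 2 (by simp)).norm.mono'
    (h.continuous_qOf.sub continuous_const).aestronglyMeasurable
    (Eventually.of_forall fun x => h.abs_qOf_sub_one_le x)

theorem tendsto_qOf_atTop : Tendsto (qOf w) atTop (𝓝 1) := by
  rw [tendsto_iff_norm_sub_tendsto_zero]
  have := (h.tendsto_atTop (k := 2) (by norm_num)).abs
  rw [abs_zero] at this
  exact squeeze_zero (fun _ => norm_nonneg _) (fun x => h.abs_qOf_sub_one_le x) this

theorem tendsto_qOf_atBot : Tendsto (qOf w) atBot (𝓝 1) := by
  rw [tendsto_iff_norm_sub_tendsto_zero]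
  have := (h.tendsto_atBot (k := 2) (by norm_num)).abs
  rw [abs_zero] at this
  exact squeeze_zero (fun _ => norm_nonneg _) (fun x => h.abs_qOf_sub_one_le x) this

theorem hasDerivAt_kapOf (x : ℝ) : HasDerivAt (kapOf w) (kapOf' w x) x := by
  have hm := (h.mOf_pos x).ne'
  have := (h.hasDerivAt 3 x).neg.div ((h.hasDerivAt_mOf x).const_mul 9) (by simpa using hm)
  convert! this using 1
  unfold kapOf'
  simp only [Pi.neg_apply]
  field_simp
  ring

theorem continuous_kapOf : Continuous (kapOf w) :=
  continuous_iff_continuousAt.2 fun x => (h.hasDerivAt_kapOf x).continuousAt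

theorem continuous_kapOf' : Continuous (kapOf' w) := by
  unfold kapOf'
  have := h.continuous_iteratedDeriv 4
  have := h.continuous_iteratedDeriv 3
  have := h.continuous_mOf
  refine Continuous.div (by fun_prop) (by fun_prop) fun x => ?_
  have := (h.mOf_pos x).ne'
  positivity

theorem exists_abs_kapOf_le : ∃ C, 0 ≤ C ∧ ∀ x, |kapOf w x| ≤ C * |iteratedDeriv 3 w x| := by
  obtain ⟨c, hc, hm⟩ := h.exists_le_mOf
  refine ⟨1 / (9 * c), by positivity, fun x => ?_⟩
  have := hm x
  have hp := h.mOf_pos x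
  rw [kapOf, abs_div, abs_neg, abs_of_pos (by positivity : 0 < 9 * mOf w x), div_eq_mul_one_div,
    mul_comm]
  gcongr

theorem integrable_kapOf : Integrable (kapOf w) := by
  obtain ⟨C, -, hC⟩ := h.exists_abs_kapOf_le
  exact ((h.integrable 3 (by simp)).norm.const_mul C).mono'
    h.continuous_kapOf.aestronglyMeasurable (Eventually.of_forall hC)

theorem tendsto_kapOf_atTop : Tendsto (kapOf w) atTop (𝓝 0) := by
  obtain ⟨C, -, hC⟩ := h.exists_abs_kapOf_le
  have := ((h.tendsto_atTop (k := 3) (by norm_num)).abs).const_mul C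
  rw [abs_zero, mul_zero] at this
  exact squeeze_zero_norm hC this

theorem tendsto_kapOf_atBot : Tendsto (kapOf w) atBot (𝓝 0) := by
  obtain ⟨C, -, hC⟩ := h.exists_abs_kapOf_le
  have := ((h.tendsto_atBot (k := 3) (by norm_num)).abs).const_mul C
  rw [abs_zero, mul_zero] at this
  exact squeeze_zero_norm hC this

theorem exists_abs_kapOf_bound : ∃ C, 0 ≤ C ∧ ∀ x, |kapOf w x| ≤ C := by
  obtain ⟨C, hC0, hC⟩ := h.exists_abs_kapOf_le
  obtain ⟨D, hD⟩ := h.exists_bound (k := 3) (by norm_num)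
  exact ⟨C * D, mul_nonneg hC0 ((abs_nonneg _).trans (hD 0)),
    fun x => (hC x).trans (mul_le_mul_of_nonneg_left (hD x) hC0)⟩

theorem integrable_kapOf' : Integrable (kapOf' w) := by
  obtain ⟨c, hc, hm⟩ := h.exists_le_mOf
  obtain ⟨D, hD⟩ := h.exists_bound (k := 3) (by norm_num)
  have hD0 : 0 ≤ D := (abs_nonneg _).trans (hD 0)
  have hi := ((h.integrable 4 (by simp)).norm.const_mul (1 / (9 * c))).add
    ((h.integrable 3 (by simp)).norm.const_mul (D / (9 * c ^ 2)))
  refine hi.mono' h.continuous_kapOf'.aestronglyMeasurable (Eventually.of_forall fun x => ?_)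
  have hp := h.mOf_pos x
  have e : kapOf' w x = -(iteratedDeriv 4 w x / (9 * mOf w x))
      - iteratedDeriv 3 w x ^ 2 / (9 * mOf w x ^ 2) := by
    unfold kapOf'; field_simp; ring
  rw [e]
  refine (norm_sub_le _ _).trans (add_le_add ?_ ?_)
  · rw [norm_neg, norm_div, Real.norm_of_nonneg (by positivity : 0 ≤ 9 * mOf w x),
      div_eq_mul_one_div, mul_comm]
    have := hm x
    dsimp only
    gcongr
  · rw [norm_div, Real.norm_of_nonneg (by positivity : 0 ≤ 9 * mOf w x ^ 2), norm_pow, pow_two]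
    dsimp only
    rw [div_mul_eq_mul_div]
    have := hm x
    have := hD x
    simp only [Real.norm_eq_abs] at *
    gcongr

theorem deriv_qOf_div (x : ℝ) : deriv (qOf w) x / (3 * qOf w x) = kapOf w x := by
  rw [(h.hasDerivAt_qOf x).deriv]
  have := (h.qOf_pos x).ne'
  field_simp

theorem integral_qOf (x ξ : ℝ) : ∫ ζ in x..ξ, qOf w ζ = yOf w ξ - yOf w x := by
  have hi := h.integrable_qOf_sub_one
  have h1 := intervalIntegral.integral_Ioi_sub_Ioi' (a := x) (b := ξ) hi.integrableOn
    hi.integrableOn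
  have h2 : ∫ ζ in x..ξ, qOf w ζ = (∫ ζ in x..ξ, (qOf w ζ - 1)) + ∫ ζ in x..ξ, (1 : ℝ) := by
    rw [← intervalIntegral.integral_add (hi.intervalIntegrable) (by simp)]
    simp
  rw [h2, yOf, yOf]
  simp at h1 ⊢
  linarith

theorem hasDerivAt_yOf (x : ℝ) : HasDerivAt (yOf w) (qOf w x) x := by
  have h1 : yOf w = fun ξ => yOf w 0 + ∫ ζ in (0 : ℝ)..ξ, qOf w ζ := by
    ext ξ; rw [h.integral_qOf]; ring
  rw [h1]
  exact (h.continuous_qOf.integral_hasStrictDerivAt 0 x).hasDerivAt.const_add _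

theorem continuous_yOf : Continuous (yOf w) :=
  continuous_iff_continuousAt.2 fun x => (h.hasDerivAt_yOf x).continuousAt

theorem strictMono_yOf : StrictMono (yOf w) :=
  strictMono_of_deriv_pos fun x => by rw [(h.hasDerivAt_yOf x).deriv]; exact h.qOf_pos x

theorem abs_yOf_sub_le (x : ℝ) : |yOf w x - x| ≤ ∫ ξ, |qOf w ξ - 1| := by
  have hi := h.integrable_qOf_sub_one
  rw [yOf, sub_sub_cancel_left, abs_neg]
  refine (abs_integral_le_integral_abs).trans ?_
  exact setIntegral_le_integral hi.abs (Eventually.of_forall fun _ => abs_nonneg _)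

theorem tendsto_yOf_sub_atTop : Tendsto (fun x => yOf w x - x) atTop (𝓝 0) := by
  have := (tendsto_integral_Ioi_atTop h.integrable_qOf_sub_one).neg
  simpa [yOf] using this

theorem bijective_yOf : Function.Bijective (yOf w) := by
  refine ⟨h.strictMono_yOf.injective, h.continuous_yOf.surjective ?_ ?_⟩
  · refine tendsto_atTop_mono (fun x => ?_)
      (tendsto_atTop_add_const_right atTop (-∫ ξ, |qOf w ξ - 1|) tendsto_id)
    have := (abs_le.1 (h.abs_yOf_sub_le x)).1
    simp only [id]; linarith
  · refine tendsto_atBot_mono (fun x => ?_)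
      (tendsto_atBot_add_const_right atBot (∫ ξ, |qOf w ξ - 1|) tendsto_id)
    have := (abs_le.1 (h.abs_yOf_sub_le x)).2
    simp only [id]; linarith

end IsInitialDatum

end Profile

/-! ### Algebra of the cube roots of unity and of the gauge matrix -/

section Algebra

theorem omega_sq_add : omega ^ 2 + omega + 1 = 0 := by
  have h3 : Real.sqrt 3 ^ 2 = 3 := Real.sq_sqrt (by norm_num)
  rw [omega_eq]
  apply Complex.ext <;> simp [pow_two]
  · nlinarith
  · ring

theorem omega_cube : omega ^ 3 = 1 := by
  linear_combination (omega - 1) * omega_sq_add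

theorem omega_ne_zero : omega ≠ 0 := Complex.exp_ne_zero _

theorem norm_omega : ‖omega‖ = 1 := by
  have h : ‖omega‖ ^ 3 = 1 := by rw [← norm_pow, omega_cube, norm_one]
  exact (pow_eq_one_iff_of_nonneg (norm_nonneg _) (by norm_num)).1 h

theorem norm_lam (z : ℂ) (j : Fin 3) : ‖lam z j‖ = ‖z‖ := by
  simp [lam, norm_omega]

theorem lam_zero (z : ℂ) : lam z 0 = z * omega := by simp [lam]

theorem lam_one (z : ℂ) : lam z 1 = z * (-1 - omega) := by
  have := omega_sq_add
  simp only [lam, Fin.val_one]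
  linear_combination z * this

theorem lam_two (z : ℂ) : lam z 2 = z := by
  simp [lam, omega_cube]

theorem lam_cube (z : ℂ) (j : Fin 3) : lam z j ^ 3 = z ^ 3 := by
  rw [lam, mul_pow, ← pow_mul, mul_comm ((j : ℕ) + 1) 3, pow_mul, omega_cube, one_pow, mul_one]

theorem sum_lam (z : ℂ) : ∑ j, lam z j = 0 := by
  rw [Fin.sum_univ_three, lam_zero, lam_one, lam_two]; ring

theorem lam_ne_zero {z : ℂ} (hz : z ≠ 0) (j : Fin 3) : lam z j ≠ 0 :=
  mul_ne_zero hz (pow_ne_zero _ omega_ne_zero)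

theorem lam_eq_mul (z : ℂ) (j : Fin 3) : lam z j = z * lam 1 j := by simp [lam]

theorem lam_one_injective : Function.Injective (lam 1) := by
  have h0 := omega_sq_add
  intro j l h
  have hw : omega ≠ 1 := by
    intro h1; rw [h1] at h0; norm_num at h0
  have hw2 : 2 * omega ≠ -1 := by
    intro h1
    have : (4 : ℂ) * (omega ^ 2 + omega + 1) = 3 := by linear_combination (2 * omega + 1) * h1
    rw [h0] at this; norm_num at this
  have hw3 : omega ≠ -2 := by
    intro h1; rw [h1] at h0; norm_num at h0
  fin_cases j <;> fin_cases l <;> simp [lam_zero, lam_one, lam_two] at h ⊢ <;>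
    grind

/-- `Λ(z)`. -/
noncomputable def lamMat (z : ℂ) : Mat := Matrix.diagonal (lam z)

/-- The constant matrix in `UOf`. -/
noncomputable def potMat : Mat :=
  !![0, 1 - omega ^ 2, 1 - omega;
     1 - omega, 0, 1 - omega ^ 2;
     1 - omega ^ 2, 1 - omega, 0]

/-- `P⁻¹ diag (q, 1, q⁻¹) P`, where `P` has the rows `(1, 1, 1)`, `(ω, ω², 1)`, `(ω², ω, 1)`. -/
noncomputable def gaugeMat (q : ℝ) : Mat :=
  (1 / 3 : ℂ) •
  !![q + 1 + (q : ℂ)⁻¹, q + omega + omega ^ 2 * (q : ℂ)⁻¹, q + omega ^ 2 + omega * (q : ℂ)⁻¹;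
     q + omega ^ 2 + omega * (q : ℂ)⁻¹, q + 1 + (q : ℂ)⁻¹, q + omega + omega ^ 2 * (q : ℂ)⁻¹;
     q + omega + omega ^ 2 * (q : ℂ)⁻¹, q + omega ^ 2 + omega * (q : ℂ)⁻¹, q + 1 + (q : ℂ)⁻¹]

/-- `Λ(z) 1 1ᵀ`. -/
noncomputable def lamOnes (z : ℂ) : Mat := Matrix.of fun j _ => lam z j

theorem gaugeMat_one : gaugeMat 1 = 1 := by
  have := omega_sq_add
  ext j k
  fin_cases j <;> fin_cases k <;> simp [gaugeMat] <;> grind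

theorem gaugeMat_mul_inv {q : ℝ} (hq : q ≠ 0) : gaugeMat q * gaugeMat q⁻¹ = 1 := by
  have h1 := omega_sq_add
  have h2 : (q : ℂ) * (q : ℂ)⁻¹ = 1 := mul_inv_cancel₀ (by exact_mod_cast hq)
  ext j k
  fin_cases j <;> fin_cases k <;> simp [gaugeMat, Matrix.mul_apply, Fin.sum_univ_three] <;> grind

/-- Separates the dependence on `q` from constant matrices: the gauge matrix is `q`, `1`, `q⁻¹`
times the spectral projections of a fixed basis, and in that basis `potMat` is `diag (3, 0, -3)`.
This is why `q' = 3κq` makes the derivative of the gauge matrix `κ` times `potMat` times itself. -/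
theorem exists_gaugeMat_apply : ∃ α β : Mat,
    (∀ (q : ℝ) j k, gaugeMat q j k = 1 / 3 * (q + α j k + β j k * (q : ℂ)⁻¹)) ∧
    ∀ q : ℝ, q ≠ 0 → ∀ j k, (potMat * gaugeMat q) j k = q - β j k * (q : ℂ)⁻¹ := by
  have h0 := omega_sq_add
  refine ⟨!![1, omega, omega ^ 2; omega ^ 2, 1, omega; omega, omega ^ 2, 1],
    !![1, omega ^ 2, omega; omega, 1, omega ^ 2; omega ^ 2, omega, 1], fun q j k => ?_,
    fun q hq j k => ?_⟩
  · fin_cases j <;> fin_cases k <;> simp [gaugeMat]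
  · have h2 : (q : ℂ) * (q : ℂ)⁻¹ = 1 := mul_inv_cancel₀ (by exact_mod_cast hq)
    fin_cases j <;> fin_cases k <;>
      simp [gaugeMat, potMat, Matrix.mul_apply, Fin.sum_univ_three] <;> grind

theorem hasDerivAt_gaugeMat {q : ℝ → ℝ} {κ : ℝ} {x : ℝ} (h : HasDerivAt q (3 * κ * q x) x)
    (hq : q x ≠ 0) (j k : Fin 3) : HasDerivAt (fun x => gaugeMat (q x) j k)
      ((((κ : ℂ) • potMat) * gaugeMat (q x)) j k) x := by
  obtain ⟨α, β, h1, h2⟩ := exists_gaugeMat_apply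
  simp only [h1, Matrix.smul_mul, Matrix.smul_apply, h2 _ hq, smul_eq_mul]
  have h3 : HasDerivAt (fun x => (q x : ℂ)) (3 * κ * q x : ℝ) x := h.ofReal_comp
  have hq' : (q x : ℂ) ≠ 0 := by exact_mod_cast hq
  have key := (((h3.add_const (α j k)).add ((h3.inv hq').const_mul (β j k)))).const_mul (1 / 3)
  convert! key using 1
  push_cast
  field_simp
  ring

/-- In the basis given by the rows of `P`, `Λ(1)` is the cyclic shift and `Λ(1) 1 1ᵀ` has a single
entry `3` in the lower left corner. The bracket is therefore `z` times the companion matrix with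
corner entry `q³`, and conjugation by `diag (q, 1, q⁻¹)` spreads `q³` evenly over the cycle. -/
theorem gaugeMat_mul_free {q : ℝ} (hq : q ≠ 0) (z : ℂ) :
    gaugeMat q * (lamMat z + ((q ^ 3 - 1) / 3 : ℂ) • lamOnes z)
      = (q : ℂ) • (lamMat z * gaugeMat q) := by
  have h1 := omega_sq_add
  have h2 : (q : ℂ) * (q : ℂ)⁻¹ = 1 := mul_inv_cancel₀ (by exact_mod_cast hq)
  ext j k
  fin_cases j <;> fin_cases k <;>
    simp [gaugeMat, lamMat, lamOnes, Matrix.mul_apply, Fin.sum_univ_three,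
      lam_zero, lam_one, lam_two, Matrix.diagonal] <;> grind

end Algebra

/-! ### Scalar linear equations normalized at `+∞` or at `-∞` -/

section Scalar

variable {f g : ℝ → ℂ} {p Y : ℝ → ℝ} {μ c : ℂ}

theorem norm_cexp_le_one {μ : ℂ} {s : ℝ} (hμ : 0 ≤ μ.re) (hs : 0 ≤ s) :
    ‖Complex.exp (-μ * s)‖ ≤ 1 := by
  rw [Complex.norm_exp, Real.exp_le_one_iff]
  simp only [Complex.mul_re, Complex.neg_re, Complex.ofReal_re, Complex.neg_im,
    Complex.ofReal_im, mul_zero, sub_zero]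
  nlinarith

theorem integrableOn_cexp_mul (hY : Continuous Y) (hm : Monotone Y) (hμ : 0 ≤ μ.re)
    (hgi : Integrable g) (x : ℝ) :
    IntegrableOn (fun ξ => Complex.exp (-μ * ((Y ξ - Y x : ℝ) : ℂ)) * g ξ) (Set.Ioi x) := by
  refine (hgi.norm.integrableOn (s := Set.Ioi x)).mono' ?_ ?_
  · exact (Continuous.aestronglyMeasurable (by fun_prop)).mul hgi.aestronglyMeasurable.restrict
  · refine (ae_restrict_iff' measurableSet_Ioi).2 (Eventually.of_forall fun ξ hξ => ?_)
    rw [norm_mul]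
    exact mul_le_of_le_one_left (norm_nonneg _)
      (norm_cexp_le_one hμ (sub_nonneg.2 (hm (le_of_lt hξ))))

theorem norm_integral_cexp_mul_le (hm : Monotone Y) (hμ : 0 ≤ μ.re)
    (hgi : Integrable g) (x : ℝ) :
    ‖∫ ξ in Set.Ioi x, Complex.exp (-μ * ((Y ξ - Y x : ℝ) : ℂ)) * g ξ‖
      ≤ ∫ ξ in Set.Ioi x, ‖g ξ‖ := by
  refine norm_integral_le_of_norm_le hgi.norm.integrableOn
    ((ae_restrict_iff' measurableSet_Ioi).2 (Eventually.of_forall fun ξ hξ => ?_))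
  rw [norm_mul]
  exact mul_le_of_le_one_left (norm_nonneg _)
    (norm_cexp_le_one hμ (sub_nonneg.2 (hm (le_of_lt hξ))))

/-- Variation of constants: the integrating factor stays bounded towards `+∞` because `Re μ ≥ 0` and
`Y` increases. The condition `μ * c = 0` makes the constant `c` a solution of the homogeneous
equation; for entry `(j, l)` it holds since either `μ = 0` on the diagonal or `c = 0` off it. -/
theorem sub_eq_neg_integral_Ioi (hf : ∀ x, HasDerivAt f (p x * μ * f x + g x) x)
    (hY : ∀ x, HasDerivAt Y (p x) x) (hp : ∀ x, 0 ≤ p x) (hμ : 0 ≤ μ.re) (hc : μ * c = 0)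
    (hgi : Integrable g) (hlim : Tendsto f atTop (𝓝 c)) (x : ℝ) :
    f x - c = -∫ ξ in Set.Ioi x, Complex.exp (-μ * ((Y ξ - Y x : ℝ) : ℂ)) * g ξ := by
  have hm : Monotone Y := monotone_of_deriv_nonneg (fun x => (hY x).differentiableAt)
    fun x => by rw [(hY x).deriv]; exact hp x
  have hYc : Continuous Y := continuous_iff_continuousAt.2 fun x => (hY x).continuousAt
  have hd : ∀ ξ, HasDerivAt (fun ξ => Complex.exp (-μ * ((Y ξ - Y x : ℝ) : ℂ)) * (f ξ - c))
      (Complex.exp (-μ * ((Y ξ - Y x : ℝ) : ℂ)) * g ξ) ξ := by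
    intro ξ
    have h1 : HasDerivAt (fun ξ => ((Y ξ - Y x : ℝ) : ℂ)) (p ξ) ξ :=
      ((hY ξ).sub_const (Y x)).ofReal_comp
    have h2 := ((h1.const_mul (-μ)).cexp).mul ((hf ξ).sub_const c)
    convert! h2 using 1
    linear_combination (-Complex.exp (-μ * ((Y ξ - Y x : ℝ) : ℂ)) * p ξ) * hc
  have hl : Tendsto (fun ξ => Complex.exp (-μ * ((Y ξ - Y x : ℝ) : ℂ)) * (f ξ - c)) atTop
      (𝓝 0) := by
    have h0 : Tendsto (fun ξ => ‖f ξ - c‖) atTop (𝓝 0) := by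
      simpa using (hlim.sub_const c).norm
    refine squeeze_zero_norm' ?_ h0
    filter_upwards [eventually_ge_atTop x] with ξ hξ
    rw [norm_mul]
    exact mul_le_of_le_one_left (norm_nonneg _) (norm_cexp_le_one hμ (sub_nonneg.2 (hm hξ)))
  have := integral_Ioi_of_hasDerivAt_of_tendsto' (fun ξ _ => hd ξ)
    (integrableOn_cexp_mul hYc hm hμ hgi x) hl
  rw [this]
  simp

theorem hasDerivAt_of_eq_integral_Ioi (hY : ∀ x, HasDerivAt Y (p x) x) (hp : ∀ x, 0 ≤ p x)
    (hμ : 0 ≤ μ.re) (hc : μ * c = 0) (hgi : Integrable g) (hg : Continuous g)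
    (hf : ∀ x, f x = c - ∫ ξ in Set.Ioi x, Complex.exp (-μ * ((Y ξ - Y x : ℝ) : ℂ)) * g ξ) :
    (∀ x, HasDerivAt f (p x * μ * f x + g x) x) ∧ Tendsto f atTop (𝓝 c) := by
  have hm : Monotone Y := monotone_of_deriv_nonneg (fun x => (hY x).differentiableAt)
    fun x => by rw [(hY x).deriv]; exact hp x
  have hYc : Continuous Y := continuous_iff_continuousAt.2 fun x => (hY x).continuousAt
  constructor
  · intro x
    -- With a base point strictly to the left of `x`, the integral over the half-line becomes a
    -- constant minus an integral over `[a, y]` for `y` near `x`, and the latter is differentiable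
    -- in its upper limit.
    set a := x - 1
    set G : ℝ → ℂ := fun ξ => Complex.exp (-μ * ((Y ξ - Y a : ℝ) : ℂ)) * g ξ with hG
    have hGc : Continuous G := by fun_prop
    have hGi : IntegrableOn G (Set.Ioi a) := integrableOn_cexp_mul hYc hm hμ hgi a
    have e1 : ∀ y, a < y → f y = c - Complex.exp (μ * ((Y y - Y a : ℝ) : ℂ)) *
        ((∫ ξ in Set.Ioi a, G ξ) - ∫ ξ in a..y, G ξ) := by
      intro y hy
      rw [hf, ← intervalIntegral.integral_Ioi_sub_Ioi hGi hy.le, sub_sub_cancel,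
        ← integral_const_mul]
      congr 2
      ext ξ
      rw [hG]
      simp only
      rw [← mul_assoc, ← Complex.exp_add]
      congr 2
      push_cast; ring
    have h1 : HasDerivAt (fun ξ => ((Y ξ - Y a : ℝ) : ℂ)) (p x) x :=
      ((hY x).sub_const (Y a)).ofReal_comp
    have h2 := (((h1.const_mul μ).cexp).mul
      ((hGc.integral_hasStrictDerivAt a x).hasDerivAt.const_sub (∫ ξ in Set.Ioi a, G ξ))).const_sub c
    have h3 := h2.congr_of_eventuallyEq (f₁ := f) (by
      filter_upwards [lt_mem_nhds (show a < x by simp [a])] with y hy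
      exact e1 y hy)
    convert! h3 using 1
    have e2 : Complex.exp (μ * ((Y x - Y a : ℝ) : ℂ)) * G x = g x := by
      rw [hG]; simp only
      rw [← mul_assoc, ← Complex.exp_add]
      simp
    have := e1 x (by simp [a])
    rw [this]
    linear_combination (-1) * e2 + p x * hc
  · have h0 := tendsto_integral_Ioi_atTop hgi.norm
    rw [tendsto_iff_norm_sub_tendsto_zero]
    refine squeeze_zero (fun _ => norm_nonneg _) (fun x => ?_) h0
    rw [hf, sub_sub_cancel_left, norm_neg]
    exact norm_integral_cexp_mul_le hm hμ hgi x

theorem norm_sub_le_of_right (hf : ∀ x, HasDerivAt f (p x * μ * f x + g x) x)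
    (hY : ∀ x, HasDerivAt Y (p x) x) (hp : ∀ x, 0 ≤ p x) (hμ : 0 ≤ μ.re) (hc : μ * c = 0)
    (hg : Continuous g) {v : ℝ → ℝ} (hv : Integrable v) (hgv : ∀ x, ‖g x‖ ≤ v x)
    (hlim : Tendsto f atTop (𝓝 c)) (x : ℝ) : ‖f x - c‖ ≤ ∫ ξ, v ξ := by
  have hm : Monotone Y := monotone_of_deriv_nonneg (fun x => (hY x).differentiableAt)
    fun x => by rw [(hY x).deriv]; exact hp x
  have hgi : Integrable g := hv.mono' hg.aestronglyMeasurable (Eventually.of_forall hgv)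
  rw [sub_eq_neg_integral_Ioi hf hY hp hμ hc hgi hlim, norm_neg]
  refine (norm_integral_cexp_mul_le hm hμ hgi x).trans ?_
  refine (setIntegral_le_integral hgi.norm (Eventually.of_forall fun _ => norm_nonneg _)).trans ?_
  exact integral_mono hgi.norm hv hgv

/-- The reflection `x ↦ -x` exchanges the two ends of the line and replaces `μ` by `-μ`, while
`-Y(-x)` is again increasing. All statements at `-∞` are obtained in this way. -/
theorem hasDerivAt_reflect (hf : ∀ x, HasDerivAt f (p x * μ * f x + g x) x) (x : ℝ) :
    HasDerivAt (fun x => f (-x)) (p (-x) * (-μ) * f (-x) + -g (-x)) x := by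
  have := (hf (-x)).scomp x (hasDerivAt_neg x)
  convert! this using 1
  rw [neg_one_smul]; ring

theorem hasDerivAt_neg_comp_neg (hY : ∀ x, HasDerivAt Y (p x) x) (x : ℝ) :
    HasDerivAt (fun x => -Y (-x)) (p (-x)) x := by
  have := (hasDerivAt_comp_neg hY x).neg
  rw [neg_neg] at this
  exact this

theorem sub_eq_integral_Iic (hf : ∀ x, HasDerivAt f (p x * μ * f x + g x) x)
    (hY : ∀ x, HasDerivAt Y (p x) x) (hp : ∀ x, 0 ≤ p x) (hμ : μ.re ≤ 0) (hc : μ * c = 0)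
    (hgi : Integrable g) (hlim : Tendsto f atBot (𝓝 c)) (x : ℝ) :
    f x - c = ∫ ξ in Set.Iic x, Complex.exp (-μ * ((Y ξ - Y x : ℝ) : ℂ)) * g ξ := by
  have := sub_eq_neg_integral_Ioi (hasDerivAt_reflect hf) (hasDerivAt_neg_comp_neg hY)
    (fun x => hp (-x)) (by simpa using hμ) (c := c) (by rw [neg_mul, hc, neg_zero])
    hgi.comp_neg.neg (hlim.comp tendsto_neg_atTop_atBot) (-x)
  rw [neg_neg] at this
  rw [this, ← integral_neg]
  have e := integral_comp_neg_Ioi (-x)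
    (fun ξ => Complex.exp (-μ * ((Y ξ - Y x : ℝ) : ℂ)) * g ξ)
  rw [neg_neg] at e
  rw [← e]
  congr 1
  ext ξ
  rw [mul_neg, neg_neg]
  congr 2
  push_cast; ring

theorem hasDerivAt_of_eq_integral_Iic (hY : ∀ x, HasDerivAt Y (p x) x) (hp : ∀ x, 0 ≤ p x)
    (hμ : μ.re ≤ 0) (hc : μ * c = 0) (hgi : Integrable g) (hg : Continuous g)
    (hf : ∀ x, f x = c + ∫ ξ in Set.Iic x, Complex.exp (-μ * ((Y ξ - Y x : ℝ) : ℂ)) * g ξ) :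
    (∀ x, HasDerivAt f (p x * μ * f x + g x) x) ∧ Tendsto f atBot (𝓝 c) := by
  have := hasDerivAt_of_eq_integral_Ioi (f := fun x => f (-x)) (g := fun x => -g (-x))
    (p := fun x => p (-x)) (Y := fun x => -Y (-x)) (μ := -μ) (c := c)
    (hasDerivAt_neg_comp_neg hY) (fun x => hp (-x)) (by simpa using hμ)
    (by rw [neg_mul, hc, neg_zero]) hgi.comp_neg.neg (by fun_prop) (fun x => by
      rw [hf, sub_eq_add_neg, ← integral_neg, ← integral_comp_neg_Ioi]
      congr 2
      ext ξ
      rw [mul_neg, neg_neg]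
      congr 2
      push_cast; ring)
  constructor
  · intro x
    have h := (this.1 (-x)).scomp x (hasDerivAt_neg x)
    simp only [Function.comp_def, neg_neg] at h
    convert! h using 1
    rw [neg_one_smul]; ring
  · have h := this.2.comp tendsto_neg_atBot_atTop
    simpa [Function.comp_def] using h

theorem norm_sub_le_of_left (hf : ∀ x, HasDerivAt f (p x * μ * f x + g x) x)
    (hY : ∀ x, HasDerivAt Y (p x) x) (hp : ∀ x, 0 ≤ p x) (hμ : μ.re ≤ 0) (hc : μ * c = 0)
    (hg : Continuous g) {v : ℝ → ℝ} (hv : Integrable v) (hgv : ∀ x, ‖g x‖ ≤ v x)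
    (hlim : Tendsto f atBot (𝓝 c)) (x : ℝ) : ‖f x - c‖ ≤ ∫ ξ, v ξ := by
  have := norm_sub_le_of_right (hasDerivAt_reflect hf) (hasDerivAt_neg_comp_neg hY)
    (fun x => hp (-x)) (by simpa using hμ) (c := c) (by rw [neg_mul, hc, neg_zero])
    (by fun_prop) hv.comp_neg (fun x => by simpa using hgv (-x))
    (hlim.comp tendsto_neg_atTop_atBot) (-x)
  rw [neg_neg] at this
  rwa [integral_neg_eq_self v volume] at this

end Scalar

/-! ### Bounded normalized solutions: a priori bound, determinant, gauge transformations -/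

section Jost

/-- Bounded normalized solutions of `f' = p [Λ(z), f] + V f`. -/
structure IsJost (p : ℝ → ℝ) (V : ℝ → Mat) (z : ℂ) (f : ℝ → Mat) : Prop where
  deriv : ∀ x j l, HasDerivAt (fun x => f x j l)
    (p x * (lam z j - lam z l) * f x j l + (V x * f x) j l) x
  bounded : ∃ C : ℝ, ∀ x j l, ‖f x j l‖ ≤ C
  right : ∀ j l, (lam z l).re ≤ (lam z j).re →
    Tendsto (fun x => f x j l) atTop (𝓝 ((1 : Mat) j l))
  left : ∀ j l, (lam z j).re < (lam z l).re →
    Tendsto (fun x => f x j l) atBot (𝓝 ((1 : Mat) j l))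

namespace IsJost

variable {p : ℝ → ℝ} {V : ℝ → Mat} {z : ℂ} {f : ℝ → Mat}

theorem continuous_apply (h : IsJost p V z f) (j l : Fin 3) : Continuous fun x => f x j l :=
  continuous_iff_continuousAt.2 fun x => (h.deriv x j l).continuousAt

theorem lam_sub_mul_one (z : ℂ) (j l : Fin 3) : (lam z j - lam z l) * (1 : Mat) j l = 0 := by
  rcases eq_or_ne j l with rfl | h
  · simp
  · simp [Matrix.one_apply_ne h]

theorem continuous_mul_apply {A B : ℝ → Mat} (hA : ∀ j l, Continuous fun x => A x j l)
    (hB : ∀ j l, Continuous fun x => B x j l) (j l : Fin 3) :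
    Continuous fun x => (A x * B x) j l := by
  simp only [Matrix.mul_apply]
  exact continuous_finsetSum _ fun k _ => (hA j k).mul (hB k l)

theorem norm_sub_one_le (h : IsJost p V z f) {Y : ℝ → ℝ} (hY : ∀ x, HasDerivAt Y (p x) x)
    (hp : ∀ x, 0 ≤ p x) (hV : ∀ j l, Continuous fun x => V x j l) {v : ℝ → ℝ} (hv : Integrable v)
    (hVf : ∀ x j l, ‖(V x * f x) j l‖ ≤ v x) (x : ℝ) (j l : Fin 3) :
    ‖f x j l - (1 : Mat) j l‖ ≤ ∫ ξ, v ξ := by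
  have hc := continuous_mul_apply hV h.continuous_apply j l
  rcases le_or_gt (lam z l).re (lam z j).re with hle | hlt
  · exact norm_sub_le_of_right (fun x => h.deriv x j l) hY hp (by simpa using hle)
      (lam_sub_mul_one z j l) hc hv (fun x => hVf x j l) (h.right j l hle) x
  · exact norm_sub_le_of_left (fun x => h.deriv x j l) hY hp (by simpa using hlt.le)
      (lam_sub_mul_one z j l) hc hv (fun x => hVf x j l) (h.left j l hlt) x

theorem tendsto_mul_mul_zero {a b c : ℝ → ℂ} {C : ℝ} {l : Filter ℝ} (hb : ∀ x, ‖b x‖ ≤ C)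
    (hc : ∀ x, ‖c x‖ ≤ C) (ha : Tendsto a l (𝓝 0)) :
    Tendsto (fun x => a x * b x * c x) l (𝓝 0) := by
  have h0 : Tendsto (fun x => ‖a x‖ * C * C) l (𝓝 0) := by
    simpa using (ha.norm.mul_const C).mul_const C
  refine squeeze_zero_norm (fun x => ?_) h0
  rw [norm_mul, norm_mul]
  have hC : 0 ≤ C := (norm_nonneg _).trans (hb x)
  have := hb x
  have := hc x
  gcongr

/-- The commutator does not contribute to the derivative of the determinant and `V` has trace zero,
so the determinant is constant; its value is found at `+∞`. Some entries need not converge there.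
But going once round a cycle, `Re λ` cannot increase at every step, so each non-identity permutation
contains an entry tending to `0` times bounded ones. -/
theorem det_eq_one (h : IsJost p V z f) (hV : ∀ x, (V x).trace = 0) (x : ℝ) :
    (f x).det = 1 := by
  have hd : ∀ x, HasDerivAt (fun x => (f x).det) 0 x := by
    intro x
    simp only [Matrix.det_fin_three]
    have key := ((((((((h.deriv x 0 0).mul (h.deriv x 1 1)).mul (h.deriv x 2 2)).sub
      (((h.deriv x 0 0).mul (h.deriv x 1 2)).mul (h.deriv x 2 1))).sub
      (((h.deriv x 0 1).mul (h.deriv x 1 0)).mul (h.deriv x 2 2))).add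
      (((h.deriv x 0 1).mul (h.deriv x 1 2)).mul (h.deriv x 2 0))).add
      (((h.deriv x 0 2).mul (h.deriv x 1 0)).mul (h.deriv x 2 1))).sub
      (((h.deriv x 0 2).mul (h.deriv x 1 1)).mul (h.deriv x 2 0)))
    convert! key using 1
    have ht := hV x
    rw [Matrix.trace_fin_three] at ht
    simp only [Matrix.mul_apply, Fin.sum_univ_three, Pi.mul_apply]
    have e : (f x 0 0 * f x 1 1 * f x 2 2 - f x 0 0 * f x 1 2 * f x 2 1
      - f x 0 1 * f x 1 0 * f x 2 2 + f x 0 1 * f x 1 2 * f x 2 0 + f x 0 2 * f x 1 0 * f x 2 1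
      - f x 0 2 * f x 1 1 * f x 2 0) * (V x 0 0 + V x 1 1 + V x 2 2) = 0 := by rw [ht, mul_zero]
    linear_combination -e
  have hconst : ∀ y, (f y).det = (f x).det := fun y =>
    is_const_of_deriv_eq_zero (fun x => (hd x).differentiableAt) (fun x => (hd x).deriv) y x
  obtain ⟨C, hC⟩ := h.bounded
  have hz : ∀ {j l : Fin 3}, j ≠ l → (lam z l).re ≤ (lam z j).re →
      Tendsto (fun x => f x j l) atTop (𝓝 0) := by
    intro j l hjl hle
    simpa [Matrix.one_apply_ne hjl] using h.right j l hle
  have h1 : ∀ j, Tendsto (fun x => f x j j) atTop (𝓝 1) := fun j => by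
    simpa using h.right j j le_rfl
  have t2 : ∀ {i j k l m n : Fin 3}, j ≠ k → Tendsto (fun x => f x j k * f x k j * f x m n)
      atTop (𝓝 0) := by
    intro i j k l m n hjk
    rcases le_total (lam z k).re (lam z j).re with hle | hle
    · exact tendsto_mul_mul_zero (fun x => hC x k j) (fun x => hC x m n) (hz hjk hle)
    · refine (tendsto_mul_mul_zero (fun x => hC x j k) (fun x => hC x m n)
        (hz hjk.symm hle)).congr fun x => by ring
  have t3 : ∀ {i j k : Fin 3}, i ≠ j → j ≠ k → k ≠ i →
      Tendsto (fun x => f x i j * f x j k * f x k i) atTop (𝓝 0) := by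
    intro i j k hij hjk hki
    rcases le_or_gt (lam z j).re (lam z i).re with hle | hlt
    · exact tendsto_mul_mul_zero (fun x => hC x j k) (fun x => hC x k i) (hz hij hle)
    rcases le_or_gt (lam z k).re (lam z j).re with hle | hlt'
    · refine (tendsto_mul_mul_zero (fun x => hC x i j) (fun x => hC x k i)
        (hz hjk hle)).congr fun x => by ring
    · refine (tendsto_mul_mul_zero (fun x => hC x i j) (fun x => hC x j k)
        (hz hki (hlt.trans hlt').le)).congr fun x => by ring
  have hlim : Tendsto (fun x => (f x).det) atTop (𝓝 1) := by
    simp only [Matrix.det_fin_three]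
    have := (((((((h1 0).mul (h1 1)).mul (h1 2)).sub
      ((t2 (i := 0) (l := 0) (j := 1) (k := 2) (m := 0) (n := 0) (by decide)))).sub
      (t2 (i := 0) (l := 0) (j := 0) (k := 1) (m := 2) (n := 2) (by decide))).add
      (t3 (i := 0) (j := 1) (k := 2) (by decide) (by decide) (by decide))).add
      (t3 (i := 0) (j := 2) (k := 1) (by decide) (by decide) (by decide))).sub
      (t2 (i := 0) (l := 0) (j := 0) (k := 2) (m := 1) (n := 1) (by decide))
    simp only [mul_one, sub_zero, add_zero] at this
    exact this.congr fun x => by ring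
  have hlim' : Tendsto (fun y => (f y).det) atTop (𝓝 (f x).det) :=
    tendsto_const_nhds.congr fun y => (hconst y).symm
  exact tendsto_nhds_unique hlim' hlim

/-- Gauge transformations `f ↦ G f exp (s Λ)`. -/
theorem gauge (h : IsJost p V z f) {p' s : ℝ → ℝ} {V' G G' : ℝ → Mat}
    (hG : ∀ x j k, HasDerivAt (fun x => G x j k) (G' x j k) x)
    (hs : ∀ x, HasDerivAt s (p x - p' x) x)
    (hGV : ∀ x, G' x + G x * ((p x : ℂ) • lamMat z + V x)
      = ((p' x : ℂ) • lamMat z + V' x) * G x)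
    (hG1 : ∀ j k, Tendsto (fun x => G x j k) atTop (𝓝 ((1 : Mat) j k)))
    (hG2 : ∀ j k, Tendsto (fun x => G x j k) atBot (𝓝 ((1 : Mat) j k)))
    (hGb : ∃ C : ℝ, ∀ x j k, ‖G x j k‖ ≤ C) (hs1 : Tendsto s atTop (𝓝 0))
    (hsb : ∃ C : ℝ, ∀ x, |s x| ≤ C) :
    IsJost p' V' z (fun x => G x * f x * Matrix.diagonal fun l => Complex.exp (s x * lam z l)) := by
  have happ : ∀ x j l, (G x * f x * Matrix.diagonal fun l => Complex.exp (s x * lam z l)) j l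
      = (∑ k, G x j k * f x k l) * Complex.exp (s x * lam z l) := by
    intro x j l
    rw [Matrix.mul_diagonal, Matrix.mul_apply]
  obtain ⟨C, hC⟩ := h.bounded
  obtain ⟨D, hD⟩ := hGb
  obtain ⟨S, hS⟩ := hsb
  have hC0 : 0 ≤ C := (norm_nonneg _).trans (hC 0 0 0)
  have hD0 : 0 ≤ D := (norm_nonneg _).trans (hD 0 0 0)
  have hsum : ∀ x j l, ‖∑ k, G x j k * f x k l‖ ≤ 3 * (D * C) := by
    intro x j l
    refine (norm_sum_le _ _).trans ?_
    refine (Finset.sum_le_card_nsmul _ _ (D * C) fun k _ => ?_).trans (by simp)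
    rw [norm_mul]
    exact mul_le_mul (hD x j k) (hC x k l) (norm_nonneg _) hD0
  have hexp : ∀ x l, ‖Complex.exp (s x * lam z l)‖ ≤ Real.exp (S * ‖z‖) := by
    intro x l
    rw [Complex.norm_exp]
    refine Real.exp_le_exp.2 ((Complex.re_le_norm _).trans ?_)
    rw [norm_mul, norm_lam, Complex.norm_real]
    exact mul_le_mul_of_nonneg_right (hS x) (norm_nonneg _)
  have hsumlim : ∀ {F : Filter ℝ} {j l : Fin 3}, (∀ j k, Tendsto (fun x => G x j k) F
      (𝓝 ((1 : Mat) j k))) → Tendsto (fun x => f x j l) F (𝓝 ((1 : Mat) j l)) →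
      Tendsto (fun x => ∑ k, G x j k * f x k l) F (𝓝 ((1 : Mat) j l)) := by
    intro F j l hGF hf
    have e : ∀ x, ∑ k, G x j k * f x k l
        = (∑ k, (G x j k - (1 : Mat) j k) * f x k l) + f x j l := by
      intro x
      have : f x j l = ∑ k, (1 : Mat) j k * f x k l := by
        rw [← Matrix.mul_apply, Matrix.one_mul]
      rw [this, ← Finset.sum_add_distrib]
      exact Finset.sum_congr rfl fun k _ => by ring
    have h0 : Tendsto (fun x => ∑ k, (G x j k - (1 : Mat) j k) * f x k l) F (𝓝 0) := by
      rw [show (0 : ℂ) = ∑ k : Fin 3, 0 by simp]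
      refine tendsto_finsetSum _ fun k _ => ?_
      have := (hGF j k).sub_const ((1 : Mat) j k)
      rw [sub_self] at this
      have h2 := tendsto_mul_mul_zero (C := max C 1) (b := fun x => f x k l) (c := fun _ => 1)
        (fun x => (hC x k l).trans (le_max_left _ _)) (fun x => by simp) this
      simpa using h2
    have := h0.add hf
    rw [zero_add] at this
    exact this.congr fun x => (e x).symm
  refine ⟨fun x j l => ?_, ⟨3 * (D * C) * Real.exp (S * ‖z‖), fun x j l => ?_⟩,
    fun j l hle => ?_, fun j l hlt => ?_⟩
  · simp only [happ]
    have h1 : HasDerivAt (fun x => ∑ k, G x j k * f x k l)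
        (∑ k, (G' x j k * f x k l + G x j k *
          (p x * (lam z k - lam z l) * f x k l + (V x * f x) k l))) x :=
      HasDerivAt.fun_sum fun k _ => (hG x j k).mul (h.deriv x k l)
    have h2 : HasDerivAt (fun x => Complex.exp (s x * lam z l))
        (Complex.exp (s x * lam z l) * (((p x - p' x : ℝ) : ℂ) * lam z l)) x :=
      (((hs x).ofReal_comp).mul_const (lam z l)).cexp
    convert! h1.mul h2 using 1
    have key := congrFun (congrFun (congrArg (fun A => A * f x) (hGV x)) j) l
    have e1 : ((G' x + G x * ((p x : ℂ) • lamMat z + V x)) * f x) j l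
        = ∑ k, (G' x j k * f x k l + G x j k * (p x * lam z k * f x k l + (V x * f x) k l)) := by
      rw [Matrix.add_mul, Matrix.mul_assoc, Matrix.add_apply, Matrix.mul_apply, Matrix.mul_apply,
        ← Finset.sum_add_distrib]
      refine Finset.sum_congr rfl fun k _ => ?_
      rw [Matrix.add_mul, Matrix.smul_mul, Matrix.add_apply, Matrix.smul_apply, lamMat,
        Matrix.diagonal_mul, smul_eq_mul, mul_assoc]
    have e2 : (((p' x : ℂ) • lamMat z + V' x) * G x * f x) j l
        = p' x * lam z j * (∑ k, G x j k * f x k l) + (V' x * (G x * f x)) j l := by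
      rw [Matrix.mul_assoc, Matrix.add_mul, Matrix.smul_mul, Matrix.add_apply, Matrix.smul_apply,
        lamMat, Matrix.diagonal_mul, smul_eq_mul, mul_assoc, Matrix.mul_apply (M := G x)]
    have e3 : (V' x * (G x * f x * Matrix.diagonal fun l => Complex.exp (s x * lam z l))) j l
        = (V' x * (G x * f x)) j l * Complex.exp (s x * lam z l) := by
      rw [← Matrix.mul_assoc, Matrix.mul_diagonal]
    replace key := e1.symm.trans (key.trans e2)
    have e4 : ∑ k, (G' x j k * f x k l + G x j k *
          (p x * (lam z k - lam z l) * f x k l + (V x * f x) k l))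
        = ∑ k, (G' x j k * f x k l + G x j k * (p x * lam z k * f x k l + (V x * f x) k l))
          - p x * lam z l * ∑ k, G x j k * f x k l := by
      rw [Finset.mul_sum, ← Finset.sum_sub_distrib]
      exact Finset.sum_congr rfl fun k _ => by ring
    rw [e3, e4, key]
    push_cast
    ring
  · rw [happ, norm_mul]
    exact mul_le_mul (hsum x j l) (hexp x l) (norm_nonneg _) (by positivity)
  · simp only [happ]
    have h1 : Tendsto (fun x => Complex.exp (s x * lam z l)) atTop (𝓝 1) := by
      have : Tendsto (fun x => (s x : ℂ) * lam z l) atTop (𝓝 ((0 : ℝ) * lam z l)) :=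
        ((Complex.continuous_ofReal.tendsto 0).comp hs1).mul_const _
      have := (Complex.continuous_exp.tendsto _).comp this
      simpa [Function.comp_def] using this
    simpa using (hsumlim hG1 (h.right j l hle)).mul h1
  · simp only [happ]
    -- At `-∞` the phase `s` is only bounded. That suffices, because the entries normalized there
    -- are off-diagonal and tend to `0`.
    have hjl : j ≠ l := by rintro rfl; exact lt_irrefl _ hlt
    have h0 := hsumlim hG2 (h.left j l hlt)
    rw [Matrix.one_apply_ne hjl] at h0 ⊢
    have := tendsto_mul_mul_zero (C := max (Real.exp (S * ‖z‖)) 1)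
      (b := fun x => Complex.exp (s x * lam z l)) (c := fun _ => 1)
      (fun x => (hexp x l).trans (le_max_left _ _)) (fun x => by simp) h0
    simpa using this

end IsJost

/-- A self-improving bound. -/
theorem forall_le_two_of_self_improving {ι : Type*} {F : ι → ℝ} {θ : ℝ} (hθ : θ ≤ 1 / 2)
    (hθ0 : 0 ≤ θ) (hb : ∃ C, ∀ i, F i ≤ C) (h : ∀ K, 0 ≤ K → (∀ i, F i ≤ K) → ∀ i, F i ≤ 1 + θ * K)
    (i : ι) : F i ≤ 2 := by
  obtain ⟨C, hC⟩ := hb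
  have hbdd : BddAbove (Set.range F) := ⟨C, by rintro _ ⟨i, rfl⟩; exact hC i⟩
  have : Nonempty ι := ⟨i⟩
  set K := max 0 (⨆ i, F i) with hK
  have hFK : ∀ i, F i ≤ K := fun i => (le_ciSup hbdd i).trans (le_max_right _ _)
  have h1 : ⨆ i, F i ≤ 1 + θ * K := ciSup_le fun i => h K (le_max_left _ _) hFK i
  have h2 : K ≤ 1 + θ * K := max_le (by positivity) h1
  have h3 : K ≤ 2 := by nlinarith [le_max_left 0 (⨆ i, F i)]
  exact (hFK i).trans h3

end Jost

/-! ### The two gauges of the `x`-equation, and the estimates near `z = 0` and `z = ∞` -/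

section ProfileJost

/-- The potential of the Lax pair in the gauge adapted to `z = 0`. -/
noncomputable def zeroPot (w : ℝ → ℝ) (z : ℂ) (x : ℝ) : Mat :=
  ((-iteratedDeriv 2 w x / 3 : ℝ) : ℂ) • lamOnes z

theorem potMat_mul_gaugeMat (q : ℝ) : potMat * gaugeMat q = gaugeMat q * potMat := by
  ext j k
  fin_cases j <;> fin_cases k <;>
    simp [gaugeMat, potMat, Matrix.mul_apply, Fin.sum_univ_three] <;> ring

theorem trace_potMat : potMat.trace = 0 := by
  simp [potMat, Matrix.trace_fin_three]

theorem zeroPot_mul_apply (w : ℝ → ℝ) (z : ℂ) (x : ℝ) (A : Mat) (j l : Fin 3) :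
    (zeroPot w z x * A) j l = ((-iteratedDeriv 2 w x / 3 : ℝ) : ℂ) * (lam z j * ∑ k, A k l) := by
  rw [zeroPot, Matrix.smul_mul, Matrix.smul_apply, Matrix.mul_apply, Finset.mul_sum]
  simp [lamOnes]

theorem norm_mul_apply_le {A B : Mat} {a b : ℝ} (hA : ∀ j k, ‖A j k‖ ≤ a) (hB : ∀ j k, ‖B j k‖ ≤ b)
    (j l : Fin 3) : ‖(A * B) j l‖ ≤ 3 * (a * b) := by
  rw [Matrix.mul_apply]
  refine (norm_sum_le _ _).trans ((Finset.sum_le_card_nsmul _ _ (a * b) fun k _ => ?_).trans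
    (by simp))
  rw [norm_mul]
  exact mul_le_mul (hA j k) (hB k l) (norm_nonneg _) ((norm_nonneg _).trans (hA j k))

theorem exists_norm_apply_le (A : Mat) : ∃ C : ℝ, 0 ≤ C ∧ ∀ j k, ‖A j k‖ ≤ C := by
  refine ⟨∑ j, ∑ k, ‖A j k‖, by positivity, fun j k => ?_⟩
  exact (Finset.single_le_sum (f := fun k => ‖A j k‖) (fun _ _ => norm_nonneg _)
    (Finset.mem_univ k)).trans (Finset.single_le_sum (f := fun j => ∑ k, ‖A j k‖)
      (fun _ _ => Finset.sum_nonneg fun _ _ => norm_nonneg _) (Finset.mem_univ j))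

theorem exists_gaugeMat_bound {r : ℝ → ℝ} (hr : ∃ c C : ℝ, 0 < c ∧ ∀ x, c ≤ r x ∧ r x ≤ C) :
    ∃ C : ℝ, ∀ x j k, ‖gaugeMat (r x) j k‖ ≤ C := by
  obtain ⟨c, C, hc, hr⟩ := hr
  obtain ⟨α, β, h1, -⟩ := exists_gaugeMat_apply
  obtain ⟨a, ha0, ha⟩ := exists_norm_apply_le α
  obtain ⟨b, hb0, hb⟩ := exists_norm_apply_le β
  refine ⟨1 / 3 * (C + a + b * c⁻¹), fun x j k => ?_⟩
  rw [h1, norm_mul]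
  have hrx : 0 < r x := hc.trans_le (hr x).1
  have i1 : ‖(r x : ℂ)‖ ≤ C := by
    rw [Complex.norm_real, Real.norm_of_nonneg hrx.le]; exact (hr x).2
  have i2 : ‖β j k * (r x : ℂ)⁻¹‖ ≤ b * c⁻¹ := by
    rw [norm_mul, norm_inv, Complex.norm_real, Real.norm_of_nonneg hrx.le]
    have := (hr x).1
    have := hb j k
    gcongr
  have i3 : ‖(1 / 3 : ℂ)‖ = 1 / 3 := by norm_num
  rw [i3]
  have := norm_add₃_le (a := (r x : ℂ)) (b := α j k) (c := β j k * (r x : ℂ)⁻¹)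
  have := ha j k
  nlinarith

theorem tendsto_gaugeMat {r : ℝ → ℝ} {F : Filter ℝ} (hr : Tendsto r F (𝓝 1)) (j k : Fin 3) :
    Tendsto (fun x => gaugeMat (r x) j k) F (𝓝 ((1 : Mat) j k)) := by
  obtain ⟨α, β, h1, -⟩ := exists_gaugeMat_apply
  rw [← gaugeMat_one]
  simp only [h1]
  have h2 : Tendsto (fun x => (r x : ℂ)) F (𝓝 ((1 : ℝ) : ℂ)) :=
    (Complex.continuous_ofReal.tendsto 1).comp hr
  exact (((h2.add_const _)).add ((h2.inv₀ (by simp)).const_mul _)).const_mul _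

/-- The solution of `[Λ(1), F] = -potMat` with zero diagonal. -/
noncomputable def infMat : Mat := Matrix.of fun j k => -potMat j k / (lam 1 j - lam 1 k)

theorem lam_sub_mul_infMat (j k : Fin 3) : (lam 1 j - lam 1 k) * infMat j k = -potMat j k := by
  rw [infMat, Matrix.of_apply]
  rcases eq_or_ne j k with rfl | hjk
  · fin_cases j <;> simp [potMat]
  · have : lam 1 j - lam 1 k ≠ 0 := sub_ne_zero.2 (lam_one_injective.ne hjk)
    field_simp

namespace IsInitialDatum

variable {w : ℝ → ℝ} (h : IsInitialDatum w)
include h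

theorem UOf_eq (x : ℝ) : UOf w x = (kapOf w x : ℂ) • potMat := by
  rw [UOf, h.deriv_qOf_div]; rfl

theorem continuous_UOf (j l : Fin 3) : Continuous fun x => UOf w x j l := by
  have := h.continuous_kapOf
  simp only [h.UOf_eq, Matrix.smul_apply, smul_eq_mul]
  fun_prop

theorem trace_UOf (x : ℝ) : (UOf w x).trace = 0 := by
  rw [h.UOf_eq, Matrix.trace_smul, trace_potMat, smul_zero]

theorem integrable_UOf_mul {f : ℝ → Mat} (hf : ∀ j l, Continuous fun x => f x j l)
    (hb : ∃ C : ℝ, ∀ x j l, ‖f x j l‖ ≤ C) (j l : Fin 3) :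
    Integrable fun x => (UOf w x * f x) j l := by
  obtain ⟨C, hC⟩ := hb
  obtain ⟨D, hD0, hD⟩ := exists_norm_apply_le potMat
  refine (h.integrable_kapOf.norm.const_mul (3 * (D * C))).mono'
    (IsJost.continuous_mul_apply h.continuous_UOf hf j l).aestronglyMeasurable
    (Eventually.of_forall fun x => ?_)
  rw [h.UOf_eq, Matrix.smul_mul, Matrix.smul_apply, norm_smul, mul_comm, Complex.norm_real]
  exact mul_le_mul_of_nonneg_right (norm_mul_apply_le hD (hC x) j l) (norm_nonneg _)

theorem integrand_eq (z : ℂ) (M : ℝ → Mat) (j l : Fin 3) (x ξ : ℝ) :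
    integrand w z M j l x ξ
      = Complex.exp (-(lam z j - lam z l) * ((yOf w ξ - yOf w x : ℝ) : ℂ))
        * (UOf w ξ * M ξ) j l := by
  rw [integrand, h.integral_qOf, mul_right_comm, ← Complex.exp_add]
  congr 2
  ring

theorem isJost_of_isEigenfunction {z : ℂ} {M : ℝ → Mat} (hM : IsEigenfunction w z M) :
    IsJost (qOf w) (UOf w) z M := by
  have hMc : ∀ j l, Continuous fun x => M x j l := fun j l => hM.continuous.matrix_elem j l
  have hgi := fun j l => h.integrable_UOf_mul hMc hM.bounded j l
  have hgc := fun j l => IsJost.continuous_mul_apply h.continuous_UOf hMc j l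
  have hr : ∀ j l, (lam z l).re ≤ (lam z j).re → _ := fun j l hle =>
    hasDerivAt_of_eq_integral_Ioi (f := fun x => M x j l) (g := fun x => (UOf w x * M x) j l)
      (μ := lam z j - lam z l) h.hasDerivAt_yOf (fun x => (h.qOf_pos x).le) (by simpa using hle)
      (IsJost.lam_sub_mul_one z j l) (hgi j l) (hgc j l) (fun x => by
        rw [hM.eq_right j l hle x]; simp only [h.integrand_eq])
  have hl : ∀ j l, (lam z j).re < (lam z l).re → _ := fun j l hlt =>
    hasDerivAt_of_eq_integral_Iic (f := fun x => M x j l) (g := fun x => (UOf w x * M x) j l)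
      (μ := lam z j - lam z l) h.hasDerivAt_yOf (fun x => (h.qOf_pos x).le)
      (by simpa using hlt.le)
      (IsJost.lam_sub_mul_one z j l) (hgi j l) (hgc j l) (fun x => by
        rw [hM.eq_left j l hlt x]; simp only [h.integrand_eq])
  refine ⟨fun x j l => ?_, hM.bounded, fun j l hle => (hr j l hle).2,
    fun j l hlt => (hl j l hlt).2⟩
  rcases le_or_gt (lam z l).re (lam z j).re with hle | hlt
  · exact (hr j l hle).1 x
  · exact (hl j l hlt).1 x

theorem abs_yOf_sub_bound : ∃ C : ℝ, ∀ x, |yOf w x - x| ≤ C := ⟨_, h.abs_yOf_sub_le⟩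

theorem gaugeMat_mul_zeroPot (z : ℂ) (x : ℝ) :
    gaugeMat (qOf w x) * (lamMat z + zeroPot w z x)
      = (qOf w x : ℂ) • (lamMat z * gaugeMat (qOf w x)) := by
  rw [← gaugeMat_mul_free (h.qOf_pos x).ne']
  congr 2
  rw [zeroPot]
  congr 1
  have : (qOf w x : ℂ) ^ 3 = (mOf w x : ℂ) := by exact_mod_cast h.qOf_pow x
  rw [this, mOf]
  push_cast; ring

/-- Passage from the gauge adapted to `z = 0`, with phase `x`, to the gauge of the integral
equations, with phase `y`. The normalization survives because `q → 1` at both ends and `y - x → 0`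
at `+∞`. -/
theorem isJost_gauge_of_zeroPot {z : ℂ} {f : ℝ → Mat} (hf : IsJost (fun _ => 1) (zeroPot w z) z f) :
    IsJost (qOf w) (UOf w) z (fun x => gaugeMat (qOf w x) * f x *
      Matrix.diagonal fun l => Complex.exp ((x - yOf w x : ℝ) * lam z l)) := by
  refine hf.gauge (G' := fun x => ((kapOf w x : ℂ) • potMat) * gaugeMat (qOf w x))
    (s := fun x => x - yOf w x)
    (fun x j k => hasDerivAt_gaugeMat (h.hasDerivAt_qOf x) (h.qOf_pos x).ne' j k)
    (fun x => (hasDerivAt_id x).sub (h.hasDerivAt_yOf x)) (fun x => ?_)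
    (fun j k => tendsto_gaugeMat h.tendsto_qOf_atTop j k)
    (fun j k => tendsto_gaugeMat h.tendsto_qOf_atBot j k) ?_ ?_ ?_
  · rw [Complex.ofReal_one, one_smul, h.gaugeMat_mul_zeroPot, h.UOf_eq, Matrix.add_mul,
      Matrix.smul_mul (qOf w x : ℂ), add_comm]
  · obtain ⟨c, hc, h1⟩ := h.exists_le_qOf
    obtain ⟨C, h2⟩ := h.exists_qOf_le
    exact exists_gaugeMat_bound ⟨c, C, hc, fun x => ⟨h1 x, h2 x⟩⟩
  · simpa using h.tendsto_yOf_sub_atTop.neg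
  · obtain ⟨C, hC⟩ := h.abs_yOf_sub_bound
    exact ⟨C, fun x => by rw [abs_sub_comm]; exact hC x⟩

theorem isJost_zeroPot_of_gauge {z : ℂ} {f : ℝ → Mat} (hf : IsJost (qOf w) (UOf w) z f) :
    IsJost (fun _ => 1) (zeroPot w z) z (fun x => gaugeMat (qOf w x)⁻¹ * f x *
      Matrix.diagonal fun l => Complex.exp ((yOf w x - x : ℝ) * lam z l)) := by
  have hinv : ∀ x, HasDerivAt (fun x => (qOf w x)⁻¹) (3 * (-kapOf w x) * (qOf w x)⁻¹) x := by
    intro x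
    have := (h.hasDerivAt_qOf x).inv (h.qOf_pos x).ne'
    convert! this using 1
    have := (h.qOf_pos x).ne'
    field_simp
  refine hf.gauge (G' := fun x => (((-kapOf w x : ℝ) : ℂ) • potMat) * gaugeMat (qOf w x)⁻¹)
    (s := fun x => yOf w x - x)
    (fun x j k => hasDerivAt_gaugeMat (hinv x) (inv_ne_zero (h.qOf_pos x).ne') j k)
    (fun x => (h.hasDerivAt_yOf x).sub (hasDerivAt_id x)) (fun x => ?_)
    (fun j k => tendsto_gaugeMat (by simpa using h.tendsto_qOf_atTop.inv₀ one_ne_zero) j k)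
    (fun j k => tendsto_gaugeMat (by simpa using h.tendsto_qOf_atBot.inv₀ one_ne_zero) j k)
    ?_ h.tendsto_yOf_sub_atTop h.abs_yOf_sub_bound
  · have hq := (h.qOf_pos x).ne'
    have h1 : gaugeMat (qOf w x)⁻¹ * gaugeMat (qOf w x) = 1 := by
      have := gaugeMat_mul_inv (inv_ne_zero hq)
      rwa [inv_inv] at this
    have h2 : gaugeMat (qOf w x) * gaugeMat (qOf w x)⁻¹ = 1 := gaugeMat_mul_inv hq
    have h3 := congrArg (fun A => gaugeMat (qOf w x)⁻¹ * A * gaugeMat (qOf w x)⁻¹)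
      (h.gaugeMat_mul_zeroPot z x)
    rw [← Matrix.mul_assoc, h1, Matrix.one_mul, Matrix.mul_smul, Matrix.smul_mul,
      ← Matrix.mul_assoc, Matrix.mul_assoc _ (gaugeMat (qOf w x)), h2, Matrix.mul_one] at h3
    rw [Complex.ofReal_one, one_smul, h3, h.UOf_eq, Matrix.mul_add, Matrix.smul_mul,
      potMat_mul_gaugeMat, Matrix.mul_smul, Matrix.mul_smul, Complex.ofReal_neg, neg_smul]
    abel
  · obtain ⟨c, hc, h1⟩ := h.exists_le_qOf
    obtain ⟨C, h2⟩ := h.exists_qOf_le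
    refine exists_gaugeMat_bound ⟨C⁻¹, c⁻¹, inv_pos.2 ((h.qOf_pos 0).trans_le (h2 0)),
      fun x => ⟨?_, ?_⟩⟩
    · have := h.qOf_pos x; have := h2 x; gcongr
    · have := h1 x; gcongr

theorem continuous_zeroPot (z : ℂ) (j l : Fin 3) : Continuous fun x => zeroPot w z x j l := by
  have := h.continuous_iteratedDeriv 2
  simp only [zeroPot, Matrix.smul_apply, smul_eq_mul]
  fun_prop

/-- The potential in this gauge is `O(z)`. An a priori bound `K` on the entries improves to `1 + θK`
with `θ = ‖z‖ ∫ |w''| ≤ 1/2`, hence to `2`; inserting `2` in the integral estimate gives the claim.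
-/
theorem isJost_norm_sub_one_le_zero {z : ℂ} {f : ℝ → Mat}
    (hf : IsJost (fun _ => 1) (zeroPot w z) z f)
    (hz : ‖z‖ * (∫ ξ, |iteratedDeriv 2 w ξ|) ≤ 1 / 2) (x : ℝ) (j l : Fin 3) :
    ‖f x j l - (1 : Mat) j l‖ ≤ ‖z‖ * (∫ ξ, |iteratedDeriv 2 w ξ|) * 2 := by
  set I := ∫ ξ, |iteratedDeriv 2 w ξ|
  have hI : 0 ≤ I := integral_nonneg fun _ => abs_nonneg _
  have step : ∀ K : ℝ, 0 ≤ K → (∀ x j l, ‖f x j l‖ ≤ K) → ∀ x j l,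
      ‖f x j l - (1 : Mat) j l‖ ≤ ‖z‖ * I * K := by
    intro K hK0 hK x j l
    have := hf.norm_sub_one_le (Y := id) (fun x => hasDerivAt_id x) (fun _ => zero_le_one)
      (h.continuous_zeroPot z) (v := fun x => ‖z‖ * K * |iteratedDeriv 2 w x|)
      ((h.integrable 2 (by simp)).abs.const_mul _) (fun x j l => by
        rw [zeroPot_mul_apply, norm_mul, norm_mul, norm_lam, Complex.norm_real, norm_div, norm_neg]
        have h1 : ‖∑ k, f x k l‖ ≤ 3 * K := by
          refine (norm_sum_le _ _).trans ?_
          exact (Finset.sum_le_card_nsmul _ _ K fun k _ => hK x k l).trans (by simp)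
        have h2 : ‖(3 : ℝ)‖ = 3 := by norm_num
        rw [h2, Real.norm_eq_abs]
        have h3 : 0 ≤ |iteratedDeriv 2 w x| * ‖z‖ := by positivity
        nlinarith) x j l
    rw [integral_const_mul] at this
    calc _ ≤ _ := this
      _ = _ := by ring
  have hb := forall_le_two_of_self_improving (ι := ℝ × Fin 3 × Fin 3)
    (F := fun i => ‖f i.1 i.2.1 i.2.2‖) hz (by positivity)
    (by obtain ⟨C, hC⟩ := hf.bounded; exact ⟨C, fun i => hC _ _ _⟩)
    (fun K hK0 hK i => by
      have h1 := step K hK0 (fun x j l => hK (x, j, l)) i.1 i.2.1 i.2.2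
      have h2 : ‖(1 : Mat) i.2.1 i.2.2‖ ≤ 1 := by
        rw [Matrix.one_apply]; split_ifs <;> simp
      have h3 := norm_sub_norm_le (f i.1 i.2.1 i.2.2) ((1 : Mat) i.2.1 i.2.2)
      change ‖f i.1 i.2.1 i.2.2‖ ≤ _
      linarith)
  exact step 2 zero_le_two (fun x j l => hb (x, j, l)) x j l

set_option maxHeartbeats 1000000 in
-- The potential does not become small as `z → ∞`, so it is first removed to leading order. With `φ
-- = κ/q` and `F = φ • infMat`, the commutator of `Λ(1)` with `infMat` is `-potMat`, which is
-- solvable because `potMat` has zero diagonal. The function `(1 - F/z) f` then satisfies an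
-- equation whose remaining forcing is `O(1/z)` with an integrable weight. The weight contains `φ'`,
-- hence the fourth derivative of `w`.
theorem isJost_norm_sub_one_le_infty : ∃ C R : ℝ, 0 < R ∧ ∀ z : ℂ, R < ‖z‖ → ∀ f : ℝ → Mat,
    IsJost (qOf w) (UOf w) z f → ∀ x j l, ‖f x j l - (1 : Mat) j l‖ ≤ C / ‖z‖ := by
  obtain ⟨φ, hφ⟩ : ∃ φ : ℝ → ℝ, φ = fun x => kapOf w x / qOf w x := ⟨_, rfl⟩
  obtain ⟨φ', hφ'⟩ : ∃ φ' : ℝ → ℝ, φ' = fun x =>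
    kapOf' w x / qOf w x - 3 * kapOf w x ^ 2 / qOf w x := ⟨_, rfl⟩
  obtain ⟨c, hc, hcq⟩ := h.exists_le_qOf
  obtain ⟨κ, hκ0, hκ⟩ := h.exists_abs_kapOf_bound
  have hφd : ∀ x, HasDerivAt φ (φ' x) x := by
    intro x
    have := (h.hasDerivAt_kapOf x).div (h.hasDerivAt_qOf x) (h.qOf_pos x).ne'
    rw [hφ]
    convert! this using 1
    have := (h.qOf_pos x).ne'
    simp only [hφ']
    field_simp
  have hinvc : ∀ x, |(qOf w x)⁻¹| ≤ c⁻¹ := by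
    intro x
    rw [abs_of_pos (inv_pos.2 (h.qOf_pos x))]
    have := hcq x
    gcongr
  have hφb : ∀ x, |φ x| ≤ c⁻¹ * |kapOf w x| := by
    intro x
    rw [hφ]; simp only
    rw [div_eq_mul_inv, abs_mul, mul_comm]
    exact mul_le_mul_of_nonneg_right (hinvc x) (abs_nonneg _)
  have hφ0 : ∀ {F : Filter ℝ}, Tendsto (kapOf w) F (𝓝 0) → Tendsto φ F (𝓝 0) := by
    intro F hF
    have := hF.abs.const_mul c⁻¹
    rw [abs_zero, mul_zero] at this
    exact squeeze_zero_norm hφb this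
  have hφ'b : ∀ x, |φ' x| ≤ c⁻¹ * (|kapOf' w x| + 3 * κ * |kapOf w x|) := by
    intro x
    have e : φ' x = (qOf w x)⁻¹ * (kapOf' w x - 3 * kapOf w x * kapOf w x) := by
      rw [hφ']; simp only; ring
    rw [e, abs_mul]
    refine mul_le_mul (hinvc x) ?_ (abs_nonneg _) (inv_pos.2 hc).le
    refine (abs_sub _ _).trans ?_
    rw [abs_mul, abs_mul, abs_of_pos (by norm_num : (0 : ℝ) < 3)]
    have := hκ x
    gcongr
  obtain ⟨a, ha0, ha⟩ := exists_norm_apply_le infMat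
  obtain ⟨b, hb0, hb⟩ := exists_norm_apply_le (infMat * potMat)
  obtain ⟨v, hv⟩ : ∃ v : ℝ → ℝ, v = fun x => 3 * (c⁻¹ * (|kapOf' w x| + 3 * κ * |kapOf w x|) * a
    + c⁻¹ * κ * |kapOf w x| * b) := ⟨_, rfl⟩
  have hvi : Integrable v := by
    have h1 := h.integrable_kapOf.abs
    have h2 := h.integrable_kapOf'.abs
    rw [hv]
    exact (((((h2.add (h1.const_mul (3 * κ))).const_mul c⁻¹).mul_const a).add
      ((h1.const_mul (c⁻¹ * κ)).mul_const b)).const_mul 3)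
  obtain ⟨I, hI⟩ : ∃ I : ℝ, I = ∫ ξ, v ξ := ⟨_, rfl⟩
  have hI0 : 0 ≤ I := hI ▸ integral_nonneg fun x => by simp only [hv]; positivity
  obtain ⟨C, hC⟩ : ∃ C : ℝ, C = I + 3 * (c⁻¹ * κ * a) := ⟨_, rfl⟩
  have hC0 : 0 ≤ C := by rw [hC]; positivity
  -- For `‖z‖ > 2C + 1` the improvement factor `C / ‖z‖` is at most `1/2`. The entries are then
  -- bounded by `2`, which produces the constant `2C`.
  refine ⟨C * 2, 2 * C + 1, by positivity, fun z hz f hf => ?_⟩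
  have hzpos : 0 < ‖z‖ := lt_trans (by positivity) hz
  have hz0 : z ≠ 0 := norm_pos_iff.1 hzpos
  have step : ∀ K : ℝ, 0 ≤ K → (∀ x j l, ‖f x j l‖ ≤ K) → ∀ x j l,
      ‖f x j l - (1 : Mat) j l‖ ≤ C / ‖z‖ * K := by
    intro K hK0 hK x j l
    -- `N = (1 - F / z) f` with `F = φ • infMat`
    obtain ⟨N, hN⟩ : ∃ N : ℝ → ℂ, N = fun x => f x j l - φ x / z * (infMat * f x) j l := ⟨_, rfl⟩
    obtain ⟨g, hg⟩ : ∃ g : ℝ → ℂ, g = fun x => -(1 / z) * (φ' x * (infMat * f x) j l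
      + φ x * kapOf w x * (infMat * potMat * f x) j l) := ⟨_, rfl⟩
    have hFd : ∀ x, HasDerivAt (fun x => (infMat * f x) j l)
        (∑ k, infMat j k * (qOf w x * (lam z k - lam z l) * f x k l
          + (UOf w x * f x) k l)) x := by
      intro x
      simp only [Matrix.mul_apply]
      exact HasDerivAt.fun_sum fun k _ => (hf.deriv x k l).const_mul _
    have hNd : ∀ x, HasDerivAt N (qOf w x * (lam z j - lam z l) * N x + g x) x := by
      intro x
      have h1 : HasDerivAt (fun x => (φ x : ℂ) / z) (φ' x / z) x := (hφd x).ofReal_comp.div_const z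
      have h2 := (hf.deriv x j l).sub (h1.mul (hFd x))
      have hN' : N = (fun x => f x j l) - (fun x => (φ x : ℂ) / z) * fun x => (infMat * f x) j l := hN
      rw [hN']
      convert! h2 using 1
      have e1 : ∑ k, infMat j k * (qOf w x * (lam z k - lam z l) * f x k l + (UOf w x * f x) k l)
          = qOf w x * (lam z j - lam z l) * (infMat * f x) j l
            + qOf w x * z * (potMat * f x) j l + kapOf w x * (infMat * potMat * f x) j l := by
        have e2 : ∀ k, infMat j k * (qOf w x * (lam z k - lam z l) * f x k l)
            = qOf w x * (lam z j - lam z l) * (infMat j k * f x k l)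
              + qOf w x * z * (potMat j k * f x k l) := by
          intro k
          have := lam_sub_mul_infMat j k
          rw [lam_eq_mul z j, lam_eq_mul z k]
          linear_combination (-qOf w x * z * f x k l) * this
        simp only [mul_add, e2, Finset.sum_add_distrib, ← Finset.mul_sum]
        rw [Matrix.mul_assoc infMat, Matrix.mul_apply (M := infMat) (N := f x),
          Matrix.mul_apply (M := potMat) (N := f x),
          Matrix.mul_apply (M := infMat) (N := potMat * f x), h.UOf_eq]
        congr 1
        rw [Finset.mul_sum]
        refine Finset.sum_congr rfl fun k _ => ?_
        rw [Matrix.smul_mul, Matrix.smul_apply, smul_eq_mul]; ring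
      rw [e1, h.UOf_eq, Matrix.smul_mul, Matrix.smul_apply, smul_eq_mul]
      have hq : (qOf w x : ℂ) ≠ 0 := by exact_mod_cast (h.qOf_pos x).ne'
      have e3 : (φ x : ℂ) * qOf w x = kapOf w x := by
        rw [hφ]; push_cast; field_simp
      have e4 : (z⁻¹ : ℂ) * z = 1 := inv_mul_cancel₀ hz0
      simp only [hg, Pi.sub_apply, Pi.mul_apply]
      simp only [div_eq_mul_inv, one_mul]
      linear_combination ((φ x : ℂ) * qOf w x * (potMat * f x) j l) * e4
        + ((potMat * f x) j l) * e3
    have hFb : ∀ x, ‖(infMat * f x) j l‖ ≤ 3 * (a * K) := fun x =>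
      norm_mul_apply_le ha (hK x) j l
    have hFP : ∀ x, ‖(infMat * potMat * f x) j l‖ ≤ 3 * (b * K) := fun x =>
      norm_mul_apply_le hb (hK x) j l
    have hfc : ∀ A : Mat, Continuous fun x => (A * f x) j l := fun A =>
      IsJost.continuous_mul_apply (A := fun _ => A) (fun _ _ => continuous_const)
        hf.continuous_apply j l
    have hgc : Continuous g := by
      have c1 := h.continuous_kapOf
      have c2 := h.continuous_kapOf'
      have c3 := h.continuous_qOf
      have c4 : ∀ x, qOf w x ≠ 0 := fun x => (h.qOf_pos x).ne'
      have c5 : Continuous φ := hφ ▸ c1.div c3 c4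
      have c6 : Continuous φ' := hφ' ▸ (c2.div c3 c4).sub ((continuous_const.mul (c1.pow 2)).div c3 c4)
      have c7 := hfc infMat
      have c8 := hfc (infMat * potMat)
      rw [hg]
      exact continuous_const.mul (((Complex.continuous_ofReal.comp c6).mul c7).add
        (((Complex.continuous_ofReal.comp c5).mul (Complex.continuous_ofReal.comp c1)).mul c8))
    have hgb : ∀ x, ‖g x‖ ≤ K / ‖z‖ * v x := by
      intro x
      simp only [hg]
      rw [norm_mul, norm_neg, norm_div, norm_one]
      have h1 : ‖(φ' x : ℂ) * (infMat * f x) j l‖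
          ≤ c⁻¹ * (|kapOf' w x| + 3 * κ * |kapOf w x|) * (3 * (a * K)) := by
        rw [norm_mul, Complex.norm_real]
        exact mul_le_mul (hφ'b x) (hFb x) (norm_nonneg _) (by positivity)
      have h2 : ‖(φ x : ℂ) * kapOf w x * (infMat * potMat * f x) j l‖
          ≤ c⁻¹ * |kapOf w x| * κ * (3 * (b * K)) := by
        rw [norm_mul, norm_mul, Complex.norm_real, Complex.norm_real]
        exact mul_le_mul (mul_le_mul (hφb x) (hκ x) (norm_nonneg _) (by positivity)) (hFP x)
          (norm_nonneg _) (by positivity)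
      have h3 := (norm_add_le ((φ' x : ℂ) * (infMat * f x) j l)
        ((φ x : ℂ) * kapOf w x * (infMat * potMat * f x) j l)).trans (add_le_add h1 h2)
      refine (mul_le_mul_of_nonneg_left h3 (by positivity)).trans (le_of_eq ?_)
      simp only [hv]
      ring
    have hNlim : ∀ {F : Filter ℝ}, Tendsto (kapOf w) F (𝓝 0) →
        Tendsto (fun x => f x j l) F (𝓝 ((1 : Mat) j l)) → Tendsto N F (𝓝 ((1 : Mat) j l)) := by
      intro F hF hfl
      have h1 : Tendsto (fun x => (φ x : ℂ) / z * (infMat * f x) j l) F (𝓝 0) := by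
        have h2 : Tendsto (fun x => ‖z‖⁻¹ * (3 * (a * K)) * |φ x|) F (𝓝 0) := by
          have := (hφ0 hF).abs.const_mul (‖z‖⁻¹ * (3 * (a * K)))
          simpa using this
        refine squeeze_zero_norm (fun x => ?_) h2
        rw [norm_mul, norm_div, Complex.norm_real, Real.norm_eq_abs]
        have := hFb x
        calc |φ x| / ‖z‖ * ‖(infMat * f x) j l‖ ≤ |φ x| / ‖z‖ * (3 * (a * K)) := by gcongr
          _ = _ := by ring
      rw [hN]
      simpa using hfl.sub h1
    have hNb : ‖N x - (1 : Mat) j l‖ ≤ K / ‖z‖ * I := by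
      have hv' : Integrable fun x => K / ‖z‖ * v x := hvi.const_mul _
      rw [hI, ← integral_const_mul]
      rcases le_or_gt (lam z l).re (lam z j).re with hle | hlt
      · exact norm_sub_le_of_right hNd h.hasDerivAt_yOf (fun x => (h.qOf_pos x).le)
          (by simpa using hle) (IsJost.lam_sub_mul_one z j l) hgc hv' hgb
          (hNlim h.tendsto_kapOf_atTop (hf.right j l hle)) x
      · exact norm_sub_le_of_left hNd h.hasDerivAt_yOf (fun x => (h.qOf_pos x).le)
          (by simpa using hlt.le) (IsJost.lam_sub_mul_one z j l) hgc hv' hgb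
          (hNlim h.tendsto_kapOf_atBot (hf.left j l hlt)) x
    have e : f x j l - (1 : Mat) j l
        = (N x - (1 : Mat) j l) + φ x / z * (infMat * f x) j l := by
      simp only [hN]; ring
    have h1 : ‖(φ x : ℂ) / z * (infMat * f x) j l‖ ≤ c⁻¹ * κ / ‖z‖ * (3 * (a * K)) := by
      rw [norm_mul, norm_div, Complex.norm_real, Real.norm_eq_abs]
      have i1 : |φ x| ≤ c⁻¹ * κ := (hφb x).trans (by have := hκ x; gcongr)
      have := hFb x
      gcongr
    rw [e]
    refine (norm_add_le _ _).trans ((add_le_add hNb h1).trans (le_of_eq ?_))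
    rw [hC]; ring
  have hθ : C / ‖z‖ ≤ 1 / 2 := by
    rw [div_le_div_iff₀ hzpos two_pos]; linarith
  have hbd := forall_le_two_of_self_improving (ι := ℝ × Fin 3 × Fin 3)
    (F := fun i => ‖f i.1 i.2.1 i.2.2‖) hθ (by positivity)
    (by obtain ⟨C, hC⟩ := hf.bounded; exact ⟨C, fun i => hC _ _ _⟩)
    (fun K hK0 hK i => by
      have h1 := step K hK0 (fun x j l => hK (x, j, l)) i.1 i.2.1 i.2.2
      have h2 : ‖(1 : Mat) i.2.1 i.2.2‖ ≤ 1 := by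
        rw [Matrix.one_apply]; split_ifs <;> simp
      have h3 := norm_sub_norm_le (f i.1 i.2.1 i.2.2) ((1 : Mat) i.2.1 i.2.2)
      change ‖f i.1 i.2.1 i.2.2‖ ≤ _
      linarith)
  intro x j l
  refine (step 2 zero_le_two (fun x j l => hbd (x, j, l)) x j l).trans (le_of_eq (by ring))

end IsInitialDatum

end ProfileJost

/-! ### Column sums to first order at `z = 0` -/

section SmallZ

/-- Both arguments of the minimum are needed: the `1` provides an integrable majorant, and `‖a‖` the
pointwise convergence. -/
theorem norm_cexp_sub_one_le {a : ℂ} (ha : a.re ≤ 0) : ‖Complex.exp a - 1‖ ≤ 2 * min 1 ‖a‖ := by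
  rcases le_total ‖a‖ 1 with h | h
  · rw [min_eq_right h]
    exact Complex.norm_exp_sub_one_le h
  · rw [min_eq_left h]
    refine (norm_sub_le _ _).trans ?_
    have : ‖Complex.exp a‖ ≤ 1 := by rw [Complex.norm_exp]; exact Real.exp_le_one_iff.2 ha
    rw [norm_one]; linarith

/-- The weight controlling `∑ⱼ M_{jl} - 1` as `z → 0`. -/
noncomputable def zeroWeight (w : ℝ → ℝ) (x r : ℝ) : ℝ :=
  ∫ ξ, |iteratedDeriv 2 w ξ| *
    (2 * min 1 (2 * r * |x - ξ|) + 6 * (r * ∫ ξ, |iteratedDeriv 2 w ξ|))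

namespace IsInitialDatum

variable {w : ℝ → ℝ} (h : IsInitialDatum w)
include h

theorem integrable_zeroWeight {r : ℝ} (hr : 0 ≤ r) (x : ℝ) :
    Integrable fun ξ => |iteratedDeriv 2 w ξ| *
      (2 * min 1 (2 * r * |x - ξ|) + 6 * (r * ∫ ξ, |iteratedDeriv 2 w ξ|)) := by
  have hI : 0 ≤ ∫ ξ, |iteratedDeriv 2 w ξ| := integral_nonneg fun _ => abs_nonneg _
  have hc := h.continuous_iteratedDeriv 2
  refine ((h.integrable 2 (by simp)).abs.mul_const
    (2 + 6 * (r * ∫ ξ, |iteratedDeriv 2 w ξ|))).mono' (Continuous.aestronglyMeasurable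
      (by fun_prop)) (Eventually.of_forall fun ξ => ?_)
  rw [Real.norm_of_nonneg (by positivity)]
  have := min_le_left 1 (2 * r * |x - ξ|)
  gcongr
  linarith

/-- Only `w''` is known to be integrable, not `ξ w''`, so no rate in `r` is available; dominated
convergence gives `o(1)`, which is all that is needed. -/
theorem tendsto_zeroWeight (x : ℝ) :
    Tendsto (zeroWeight w x) (𝓝[≥] 0) (𝓝 0) := by
  have hI : 0 ≤ ∫ ξ, |iteratedDeriv 2 w ξ| := integral_nonneg fun _ => abs_nonneg _
  have hc := h.continuous_iteratedDeriv 2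
  have key := tendsto_integral_filter_of_dominated_convergence (μ := volume) (l := 𝓝[≥] (0 : ℝ))
    (F := fun r ξ => |iteratedDeriv 2 w ξ| *
      (2 * min 1 (2 * r * |x - ξ|) + 6 * (r * ∫ ξ, |iteratedDeriv 2 w ξ|)))
    (f := fun _ => 0)
    (fun ξ => |iteratedDeriv 2 w ξ| * (2 + 6 * ∫ ξ, |iteratedDeriv 2 w ξ|))
    (Eventually.of_forall fun r => Continuous.aestronglyMeasurable (by fun_prop))
    (by
      filter_upwards [self_mem_nhdsWithin, nhdsWithin_le_nhds (Iic_mem_nhds one_pos)] with r hr hr1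
      refine Eventually.of_forall fun ξ => ?_
      have hr0 : (0 : ℝ) ≤ r := hr
      have hr1 : r ≤ 1 := hr1
      rw [Real.norm_of_nonneg (by positivity)]
      have := min_le_left 1 (2 * r * |x - ξ|)
      have h2 : r * ∫ ξ, |iteratedDeriv 2 w ξ| ≤ ∫ ξ, |iteratedDeriv 2 w ξ| :=
        mul_le_of_le_one_left hI hr1
      gcongr
      linarith)
    ((h.integrable 2 (by simp)).abs.mul_const _)
    (Eventually.of_forall fun ξ => by
      have : Continuous fun r : ℝ => |iteratedDeriv 2 w ξ| *
        (2 * min 1 (2 * r * |x - ξ|) + 6 * (r * ∫ ξ, |iteratedDeriv 2 w ξ|)) := by fun_prop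
      have := (this.tendsto 0).mono_left (nhdsWithin_le_nhds (s := Set.Ici 0))
      simpa using this)
  rw [integral_zero] at key
  exact key

/-- To first order in `z`, the deviation of entry `(j, l)` from the identity is the integral of
`-w'' λ_j / 3` from the prescribed end. From either end this gives `-w' λ_j / 3`, since `w'`
vanishes at both. Summation over `j` removes the term because `∑ λ_j = 0`, and only the remainder is
left. -/
theorem norm_sum_sub_one_le {z : ℂ} {f : ℝ → Mat}
    (hf : IsJost (fun _ => 1) (zeroPot w z) z f)
    (hz : ‖z‖ * (∫ ξ, |iteratedDeriv 2 w ξ|) ≤ 1 / 2) (x : ℝ) (l : Fin 3) :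
    ‖∑ j, f x j l - 1‖ ≤ ‖z‖ * zeroWeight w x ‖z‖ := by
  set I := ∫ ξ, |iteratedDeriv 2 w ξ| with hI
  have hI0 : 0 ≤ I := integral_nonneg fun _ => abs_nonneg _
  have hw2 : Integrable (iteratedDeriv 2 w) := h.integrable 2 (by simp)
  have hc2 := h.continuous_iteratedDeriv 2
  have hsum : ∀ x, ‖∑ j, f x j l - 1‖ ≤ 6 * (‖z‖ * I) := by
    intro x
    have e : ∑ j, f x j l - 1 = ∑ j, (f x j l - (1 : Mat) j l) := by
      rw [Finset.sum_sub_distrib]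
      congr 1
      simp [Matrix.one_apply]
    rw [e]
    refine (norm_sum_le _ _).trans ((Finset.sum_le_card_nsmul _ _ (‖z‖ * I * 2) fun j _ =>
      h.isJost_norm_sub_one_le_zero hf hz x j l).trans (le_of_eq ?_))
    simp; ring
  have hsc : Continuous fun x => ∑ k, f x k l :=
    continuous_finsetSum _ fun k _ => hf.continuous_apply k l
  obtain ⟨C, hC⟩ := hf.bounded
  have hsb : ∀ x, ‖∑ k, f x k l‖ ≤ 3 * C := fun x =>
    (norm_sum_le _ _).trans ((Finset.sum_le_card_nsmul _ _ C fun k _ => hC x k l).trans (by simp))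
  -- the pointwise estimate
  have hpt : ∀ j ξ, (-(lam z j - lam z l) * ((ξ - x : ℝ) : ℂ)).re ≤ 0 →
      ‖Complex.exp (-(lam z j - lam z l) * ((ξ - x : ℝ) : ℂ)) * (zeroPot w z ξ * f ξ) j l
        - ((-iteratedDeriv 2 w ξ / 3 : ℝ) : ℂ) * lam z j‖
      ≤ ‖z‖ / 3 * (|iteratedDeriv 2 w ξ| *
        (2 * min 1 (2 * ‖z‖ * |x - ξ|) + 6 * (‖z‖ * I))) := by
    intro j ξ hre
    set E := Complex.exp (-(lam z j - lam z l) * ((ξ - x : ℝ) : ℂ)) with hE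
    have e : E * (zeroPot w z ξ * f ξ) j l - ((-iteratedDeriv 2 w ξ / 3 : ℝ) : ℂ) * lam z j
        = ((-iteratedDeriv 2 w ξ / 3 : ℝ) : ℂ) * lam z j *
          ((E - 1) + E * (∑ k, f ξ k l - 1)) := by
      rw [zeroPot_mul_apply]; ring
    have hE1 : ‖E‖ ≤ 1 := by
      rw [hE, Complex.norm_exp]; exact Real.exp_le_one_iff.2 hre
    have hE2 : ‖E - 1‖ ≤ 2 * min 1 (2 * ‖z‖ * |x - ξ|) := by
      refine (norm_cexp_sub_one_le hre).trans ?_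
      have : ‖-(lam z j - lam z l) * ((ξ - x : ℝ) : ℂ)‖ ≤ 2 * ‖z‖ * |x - ξ| := by
        rw [norm_mul, norm_neg, Complex.norm_real, Real.norm_eq_abs, abs_sub_comm]
        have := norm_sub_le (lam z j) (lam z l)
        rw [norm_lam, norm_lam] at this
        gcongr
        linarith
      gcongr
    have h3 : ‖(E - 1) + E * (∑ k, f ξ k l - 1)‖
        ≤ 2 * min 1 (2 * ‖z‖ * |x - ξ|) + 6 * (‖z‖ * I) := by
      refine (norm_add_le _ _).trans (add_le_add hE2 ?_)
      rw [norm_mul]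
      exact (mul_le_of_le_one_left (norm_nonneg _) hE1).trans (hsum ξ)
    rw [e, norm_mul, norm_mul, norm_lam, Complex.norm_real, norm_div, norm_neg, Real.norm_eq_abs,
      show ‖(3 : ℝ)‖ = 3 by norm_num]
    calc _ ≤ |iteratedDeriv 2 w ξ| / 3 * ‖z‖ *
          (2 * min 1 (2 * ‖z‖ * |x - ξ|) + 6 * (‖z‖ * I)) := by gcongr
      _ = _ := by ring
  have hwi := (h.integrable_zeroWeight (norm_nonneg z) x).const_mul (‖z‖ / 3)
  have hgi : ∀ j, Integrable fun ξ => (zeroPot w z ξ * f ξ) j l := by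
    intro j
    refine (hw2.norm.const_mul (‖z‖ * C)).mono' ((IsJost.continuous_mul_apply
      (h.continuous_zeroPot z) hf.continuous_apply j l).aestronglyMeasurable)
      (Eventually.of_forall fun ξ => ?_)
    rw [zeroPot_mul_apply, norm_mul, norm_mul, norm_lam, Complex.norm_real, norm_div, norm_neg,
      show ‖(3 : ℝ)‖ = 3 by norm_num]
    have := hsb ξ
    have h3 : 0 ≤ ‖iteratedDeriv 2 w ξ‖ * ‖z‖ := by positivity
    nlinarith
  have hpi : ∀ j, Integrable fun ξ => ((-iteratedDeriv 2 w ξ / 3 : ℝ) : ℂ) * lam z j := fun j =>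
    ((hw2.neg.div_const 3).ofReal).mul_const _
  have hnn : ∀ ξ, 0 ≤ ‖z‖ / 3 * (|iteratedDeriv 2 w ξ| *
      (2 * min 1 (2 * ‖z‖ * |x - ξ|) + 6 * (‖z‖ * I))) := fun ξ => by positivity
  -- each entry
  have hentry : ∀ j, ‖f x j l - (1 : Mat) j l + iteratedDeriv 1 w x / 3 * lam z j‖
      ≤ ‖z‖ / 3 * zeroWeight w x ‖z‖ := by
    intro j
    have hd : ∀ x, HasDerivAt (fun x => f x j l) (((1 : ℝ) : ℂ) * (lam z j - lam z l) * f x j l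
      + (zeroPot w z x * f x) j l) x := fun x => hf.deriv x j l
    rw [zeroWeight, ← integral_const_mul]
    rcases le_or_gt (lam z l).re (lam z j).re with hle | hlt
    · have h1 := sub_eq_neg_integral_Ioi hd (Y := id) (fun x => hasDerivAt_id x)
        (fun _ => zero_le_one) (by simpa using hle) (IsJost.lam_sub_mul_one z j l) (hgi j)
        (hf.right j l hle) x
      have h2 := eq_neg_integral_Ioi_of_tendsto_zero (h.hasDerivAt 1) hw2
        (h.tendsto_atTop (by norm_num)) x
      have h3 : (iteratedDeriv 1 w x / 3 : ℂ) * lam z j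
          = ∫ ξ in Set.Ioi x, ((-iteratedDeriv 2 w ξ / 3 : ℝ) : ℂ) * lam z j := by
        rw [integral_mul_const, integral_complex_ofReal, integral_div, integral_neg, ← h2]
        push_cast; ring
      rw [h1, h3, neg_add_eq_sub, ← norm_neg, neg_sub, ← integral_sub
        (integrableOn_cexp_mul continuous_id monotone_id (by simpa using hle) (hgi j) x)
        (hpi j).integrableOn]
      refine (norm_integral_le_of_norm_le hwi.integrableOn ((ae_restrict_iff'
        measurableSet_Ioi).2 (Eventually.of_forall fun ξ hξ => hpt j ξ ?_))).trans
        (setIntegral_le_integral hwi (Eventually.of_forall hnn))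
      simp only [Complex.mul_re, Complex.neg_re, Complex.sub_re, Complex.ofReal_re,
        Complex.ofReal_im, mul_zero, sub_zero]
      have : x < ξ := hξ
      nlinarith
    · have h1 := sub_eq_integral_Iic hd (Y := id) (fun x => hasDerivAt_id x)
        (fun _ => zero_le_one) (by simpa using hlt.le) (IsJost.lam_sub_mul_one z j l) (hgi j)
        (hf.left j l hlt) x
      have h2 := eq_integral_Iic_of_tendsto_zero (h.hasDerivAt 1) hw2
        (h.tendsto_atBot (by norm_num)) x
      have h3 : (iteratedDeriv 1 w x / 3 : ℂ) * lam z j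
          = -∫ ξ in Set.Iic x, ((-iteratedDeriv 2 w ξ / 3 : ℝ) : ℂ) * lam z j := by
        rw [integral_mul_const, integral_complex_ofReal, integral_div, integral_neg, ← h2]
        push_cast; ring
      have hI' : IntegrableOn (fun ξ => Complex.exp (-(lam z j - lam z l) *
          ((id ξ - id x : ℝ) : ℂ)) * (zeroPot w z ξ * f ξ) j l) (Set.Iic x) := by
        refine (hgi j).norm.integrableOn.mono' (Continuous.aestronglyMeasurable ?_) ?_
        · exact (by fun_prop : Continuous fun ξ => Complex.exp (-(lam z j - lam z l) *
            ((id ξ - id x : ℝ) : ℂ))).mul (IsJost.continuous_mul_apply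
            (h.continuous_zeroPot z) hf.continuous_apply j l)
        · refine (ae_restrict_iff' measurableSet_Iic).2 (Eventually.of_forall fun ξ hξ => ?_)
          rw [norm_mul]
          refine mul_le_of_le_one_left (norm_nonneg _) ?_
          rw [Complex.norm_exp]
          refine Real.exp_le_one_iff.2 ?_
          simp only [Complex.mul_re, Complex.neg_re, Complex.sub_re, Complex.ofReal_re,
            Complex.ofReal_im, mul_zero, sub_zero, id]
          have : ξ ≤ x := hξ
          nlinarith
      rw [h1, h3, ← sub_eq_add_neg, ← integral_sub hI' (hpi j).integrableOn]
      refine (norm_integral_le_of_norm_le hwi.integrableOn ((ae_restrict_iff'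
        measurableSet_Iic).2 (Eventually.of_forall fun ξ hξ => hpt j ξ ?_))).trans
        (setIntegral_le_integral hwi (Eventually.of_forall hnn))
      simp only [Complex.mul_re, Complex.neg_re, Complex.sub_re, Complex.ofReal_re,
        Complex.ofReal_im, mul_zero, sub_zero]
      have : ξ ≤ x := hξ
      nlinarith
  have e : ∑ j, f x j l - 1
      = ∑ j, (f x j l - (1 : Mat) j l + iteratedDeriv 1 w x / 3 * lam z j) := by
    rw [Finset.sum_add_distrib, ← Finset.mul_sum, sum_lam, mul_zero, add_zero,
      Finset.sum_sub_distrib]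
    congr 1
    simp [Matrix.one_apply]
  rw [e]
  refine (norm_sum_le _ _).trans ((Finset.sum_le_card_nsmul _ _ _ fun j _ => hentry j).trans
    (le_of_eq ?_))
  simp; ring

end IsInitialDatum

end SmallZ

/-! ### Compactness and holomorphic dependence of the integral operators -/

section KernelOperators

theorem isCompactOperator_of_arzela_ascoli {X : Type*} [TopologicalSpace X] [CompactSpace X]
    {E : Type*} [NormedAddCommGroup E] [NormedSpace ℂ E] (T : E →L[ℂ] (X →ᵇ ℂ))
    (b : X → X → ℝ) (hb : ∀ x₀, Tendsto (b x₀) (𝓝 x₀) (𝓝 0))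
    (hT : ∀ f, ‖f‖ ≤ 1 → ∀ x₀ x, dist (T f x₀) (T f x) ≤ b x₀ x) : IsCompactOperator T := by
  refine ⟨closure (T '' Metric.closedBall 0 1), ?_, ?_⟩
  · refine BoundedContinuousFunction.arzela_ascoli (Metric.closedBall (0 : ℂ) ‖T‖)
      (isCompact_closedBall _ _) _ ?_ ?_
    · rintro _ x ⟨f, hf, rfl⟩
      rw [mem_closedBall_zero_iff] at hf ⊢
      exact ((T f).norm_coe_le_norm x).trans ((T.le_opNorm f).trans
        (mul_le_of_le_one_right (norm_nonneg _) hf))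
    · intro x₀
      refine Metric.equicontinuousAt_of_continuity_modulus (b x₀) (hb x₀) _
        (Eventually.of_forall fun x => ?_)
      rintro ⟨_, f, hf, rfl⟩
      exact hT f (mem_closedBall_zero_iff.1 hf) x₀ x
  · exact mem_of_superset (Metric.closedBall_mem_nhds 0 one_pos)
      fun f hf => subset_closure ⟨f, hf, rfl⟩

variable {σ : ℝ} {Y : ℝ → ℝ}

/-- The kernel `k (σ (Y ξ - Y x))`, cut off to `σ (ξ - x) > 0`. -/
noncomputable def kerFun (σ : ℝ) (Y : ℝ → ℝ) (k : ℝ →ᵇ ℂ) (x ξ : ℝ) : ℂ :=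
  Set.indicator {ξ | 0 < σ * (ξ - x)} (fun ξ => k (σ * (Y ξ - Y x))) ξ

theorem norm_kerFun_le (k : ℝ →ᵇ ℂ) (x ξ : ℝ) : ‖kerFun σ Y k x ξ‖ ≤ ‖k‖ := by
  unfold kerFun
  by_cases h : ξ ∈ {ξ | 0 < σ * (ξ - x)}
  · rw [Set.indicator_of_mem h]; exact k.norm_coe_le_norm _
  · rw [Set.indicator_of_notMem h]; simp

theorem kerFun_aestronglyMeasurable (hY : Continuous Y) (k : ℝ →ᵇ ℂ) (x : ℝ) :
    AEStronglyMeasurable (kerFun σ Y k x) := by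
  have : MeasurableSet {ξ : ℝ | 0 < σ * (ξ - x)} :=
    measurableSet_lt measurable_const (by fun_prop)
  exact (Continuous.aestronglyMeasurable (by fun_prop)).indicator this

theorem continuousAt_kerFun (hσ : σ ≠ 0) (hY : Continuous Y) (k : ℝ →ᵇ ℂ) {x₀ ξ : ℝ} (h : ξ ≠ x₀) :
    ContinuousAt (fun x => kerFun σ Y k x ξ) x₀ := by
  have hne : σ * (ξ - x₀) ≠ 0 := mul_ne_zero hσ (sub_ne_zero.2 h)
  have hc : Continuous fun x => σ * (ξ - x) := by fun_prop
  rcases hne.lt_or_gt with h1 | h1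
  · refine (continuousAt_const (y := (0 : ℂ))).congr ?_
    filter_upwards [hc.continuousAt.eventually_lt_const h1] with x hx
    rw [kerFun, Set.indicator_of_notMem]
    simpa using hx.le
  · have hk : Continuous fun x => k (σ * (Y ξ - Y x)) := by fun_prop
    refine hk.continuousAt.congr ?_
    filter_upwards [hc.continuousAt.eventually_const_lt h1] with x hx
    rw [kerFun, Set.indicator_of_mem]
    exact hx

theorem ae_ne_real (x₀ : ℝ) : ∀ᵐ ξ : ℝ, ξ ≠ x₀ :=
  compl_mem_ae_iff.2 (measure_singleton x₀)

variable {a : ℝ → ℂ}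

theorem integrable_kerFun_mul (hY : Continuous Y) (ha : Integrable a) (k f : ℝ →ᵇ ℂ) (x : ℝ) :
    Integrable fun ξ => kerFun σ Y k x ξ * (a ξ * f ξ) := by
  refine (ha.norm.const_mul (‖k‖ * ‖f‖)).mono' ((kerFun_aestronglyMeasurable hY k x).mul
    (ha.aestronglyMeasurable.mul f.continuous.aestronglyMeasurable))
    (Eventually.of_forall fun ξ => ?_)
  rw [norm_mul, norm_mul]
  have h1 := norm_kerFun_le (σ := σ) (Y := Y) k x ξ
  have h2 := f.norm_coe_le_norm ξ
  calc _ ≤ ‖k‖ * (‖a ξ‖ * ‖f‖) := by gcongr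
    _ = _ := by ring

/-- This integral is a modulus of continuity for the images of all `f` in the unit ball. The cut-off
makes the kernel discontinuous at `x = x₀` only for `ξ = x₀`, a null set. -/
theorem tendsto_integral_kerFun_sub (hσ : σ ≠ 0) (hY : Continuous Y) (ha : Integrable a)
    (k : ℝ →ᵇ ℂ) (x₀ : ℝ) :
    Tendsto (fun x => ∫ ξ, ‖kerFun σ Y k x₀ ξ - kerFun σ Y k x ξ‖ * ‖a ξ‖) (𝓝 x₀) (𝓝 0) := by
  have key := tendsto_integral_filter_of_dominated_convergence (μ := volume) (l := 𝓝 x₀)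
    (F := fun x ξ => ‖kerFun σ Y k x₀ ξ - kerFun σ Y k x ξ‖ * ‖a ξ‖) (f := fun _ => 0)
    (fun ξ => 2 * ‖k‖ * ‖a ξ‖)
    (Eventually.of_forall fun x => (((kerFun_aestronglyMeasurable hY k x₀).sub
      (kerFun_aestronglyMeasurable hY k x)).norm).mul ha.norm.aestronglyMeasurable)
    (Eventually.of_forall fun x => Eventually.of_forall fun ξ => by
      rw [Real.norm_of_nonneg (by positivity)]
      have := norm_sub_le (kerFun σ Y k x₀ ξ) (kerFun σ Y k x ξ)
      have := norm_kerFun_le (σ := σ) (Y := Y) k x ξ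
      have := norm_kerFun_le (σ := σ) (Y := Y) k x₀ ξ
      gcongr
      linarith)
    (ha.norm.const_mul _)
    (by
      filter_upwards [ae_ne_real x₀] with ξ hξ
      have := ((continuousAt_kerFun hσ hY k hξ).tendsto.const_sub (kerFun σ Y k x₀ ξ)).norm
      simpa using this.mul_const ‖a ξ‖)
  simpa using key

theorem norm_integral_kerFun_le (ha : Integrable a) (k f : ℝ →ᵇ ℂ) (x : ℝ) :
    ‖∫ ξ, kerFun σ Y k x ξ * (a ξ * f ξ)‖ ≤ (∫ ξ, ‖a ξ‖) * ‖k‖ * ‖f‖ := by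
  have := norm_integral_le_of_norm_le (μ := volume) (ha.norm.const_mul (‖k‖ * ‖f‖))
    (f := fun ξ => kerFun σ Y k x ξ * (a ξ * f ξ)) (Eventually.of_forall fun ξ => by
      rw [norm_mul, norm_mul]
      have h1 := norm_kerFun_le (σ := σ) (Y := Y) k x ξ
      have h2 := f.norm_coe_le_norm ξ
      calc _ ≤ ‖k‖ * (‖a ξ‖ * ‖f‖) := by gcongr
        _ = _ := by ring)
  rw [integral_const_mul] at this
  refine this.trans (le_of_eq (by ring))

theorem dist_integral_kerFun_le (hY : Continuous Y) (ha : Integrable a)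
    (k f : ℝ →ᵇ ℂ) (x₀ x : ℝ) :
    dist (∫ ξ, kerFun σ Y k x₀ ξ * (a ξ * f ξ)) (∫ ξ, kerFun σ Y k x ξ * (a ξ * f ξ))
      ≤ ‖f‖ * ∫ ξ, ‖kerFun σ Y k x₀ ξ - kerFun σ Y k x ξ‖ * ‖a ξ‖ := by
  rw [dist_eq_norm, ← integral_sub (integrable_kerFun_mul hY ha k f x₀)
    (integrable_kerFun_mul hY ha k f x), ← integral_const_mul]
  refine norm_integral_le_of_norm_le ?_ (Eventually.of_forall fun ξ => ?_)
  · refine Integrable.const_mul ?_ _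
    refine (ha.norm.const_mul (2 * ‖k‖)).mono' ((((kerFun_aestronglyMeasurable hY k x₀).sub
      (kerFun_aestronglyMeasurable hY k x)).norm).mul ha.norm.aestronglyMeasurable)
      (Eventually.of_forall fun ξ => ?_)
    rw [Real.norm_of_nonneg (by positivity)]
    have := norm_sub_le (kerFun σ Y k x₀ ξ) (kerFun σ Y k x ξ)
    have := norm_kerFun_le (σ := σ) (Y := Y) k x ξ
    have := norm_kerFun_le (σ := σ) (Y := Y) k x₀ ξ
    gcongr
    linarith
  · rw [← sub_mul, norm_mul, norm_mul]
    have h2 := f.norm_coe_le_norm ξ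
    calc _ ≤ ‖kerFun σ Y k x₀ ξ - kerFun σ Y k x ξ‖ * (‖a ξ‖ * ‖f‖) := by gcongr
      _ = _ := by ring

theorem continuous_integral_kerFun (hσ : σ ≠ 0) (hY : Continuous Y) (ha : Integrable a)
    (k f : ℝ →ᵇ ℂ) : Continuous fun x => ∫ ξ, kerFun σ Y k x ξ * (a ξ * f ξ) := by
  refine continuous_iff_continuousAt.2 fun x₀ => ?_
  rw [ContinuousAt, tendsto_iff_dist_tendsto_zero]
  have := (tendsto_integral_kerFun_sub hσ hY ha k x₀).const_mul ‖f‖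
  rw [mul_zero] at this
  refine squeeze_zero (fun _ => dist_nonneg) (fun x => ?_) this
  rw [dist_comm]
  exact dist_integral_kerFun_le hY ha k f x₀ x

/-- The operator `f ↦ ∫ k (σ (Y ξ - Y x)) a(ξ) f(ξ) dξ` over `σ (ξ - x) > 0`, linear in `k`. -/
noncomputable def kerOp (hσ : σ ≠ 0) (hY : Continuous Y) (ha : Integrable a) :
    (ℝ →ᵇ ℂ) →L[ℂ] (ℝ →ᵇ ℂ) →L[ℂ] (ℝ →ᵇ ℂ) :=
  LinearMap.mkContinuous₂
    (LinearMap.mk₂ ℂ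
      (fun k f => BoundedContinuousFunction.ofNormedAddCommGroup
        (fun x => ∫ ξ, kerFun σ Y k x ξ * (a ξ * f ξ)) (continuous_integral_kerFun hσ hY ha k f)
        ((∫ ξ, ‖a ξ‖) * ‖k‖ * ‖f‖) (norm_integral_kerFun_le ha k f))
      (fun k k' f => by
        ext x
        have := integral_add (integrable_kerFun_mul (σ := σ) hY ha k f x)
          (integrable_kerFun_mul (σ := σ) hY ha k' f x)
        simp only [BoundedContinuousFunction.coe_ofNormedAddCommGroup,
          BoundedContinuousFunction.coe_add, Pi.add_apply]
        rw [← this]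
        congr 1; ext ξ
        simp only [kerFun, Set.indicator_apply]
        split_ifs <;> simp; ring)
      (fun c k f => by
        ext x
        simp only [BoundedContinuousFunction.coe_ofNormedAddCommGroup,
          BoundedContinuousFunction.coe_smul, smul_eq_mul]
        rw [← integral_const_mul]
        congr 1; ext ξ
        simp only [kerFun, Set.indicator_apply]
        split_ifs <;> simp; ring)
      (fun k f f' => by
        ext x
        have := integral_add (integrable_kerFun_mul (σ := σ) hY ha k f x)
          (integrable_kerFun_mul (σ := σ) hY ha k f' x)
        simp only [BoundedContinuousFunction.coe_ofNormedAddCommGroup,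
          BoundedContinuousFunction.coe_add, Pi.add_apply]
        rw [← this]
        congr 1; ext ξ
        ring)
      (fun c k f => by
        ext x
        simp only [BoundedContinuousFunction.coe_ofNormedAddCommGroup,
          BoundedContinuousFunction.coe_smul, smul_eq_mul]
        rw [← integral_const_mul]
        congr 1; ext ξ
        ring))
    (∫ ξ, ‖a ξ‖) (fun k f =>
      BoundedContinuousFunction.norm_ofNormedAddCommGroup_le _ (by
        have : 0 ≤ ∫ ξ, ‖a ξ‖ := integral_nonneg fun _ => norm_nonneg _
        positivity) (norm_integral_kerFun_le ha k f))

theorem kerOp_apply (hσ : σ ≠ 0) (hY : Continuous Y) (ha : Integrable a) (k f : ℝ →ᵇ ℂ) (x : ℝ) :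
    kerOp hσ hY ha k f x = ∫ ξ, kerFun σ Y k x ξ * (a ξ * f ξ) := rfl

theorem norm_kerOp_sub_le (hσ : σ ≠ 0) (hY : Continuous Y) {b : ℝ → ℂ} (ha : Integrable a)
    (hb : Integrable b) (k : ℝ →ᵇ ℂ) :
    ‖kerOp hσ hY ha k - kerOp hσ hY hb k‖ ≤ (∫ ξ, ‖a ξ - b ξ‖) * ‖k‖ := by
  have h0 : 0 ≤ ∫ ξ, ‖a ξ - b ξ‖ := integral_nonneg fun _ => norm_nonneg _
  refine ContinuousLinearMap.opNorm_le_bound _ (by positivity) fun f => ?_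
  refine (BoundedContinuousFunction.norm_le (by positivity)).2 fun x => ?_
  have e : (kerOp hσ hY ha k - kerOp hσ hY hb k) f x
      = ∫ ξ, kerFun σ Y k x ξ * ((a ξ - b ξ) * f ξ) := by
    simp only [sub_apply, BoundedContinuousFunction.coe_sub, Pi.sub_apply,
      kerOp_apply]
    rw [← integral_sub (integrable_kerFun_mul hY ha k f x) (integrable_kerFun_mul hY hb k f x)]
    congr 1; ext ξ; ring
  rw [e]
  exact norm_integral_kerFun_le (ha.sub hb) k f x

/-- The exponential kernel `s ↦ exp (-ν s)` on `s ≥ 0`, for `Re ν ≥ 0`. -/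
noncomputable def kexp (ν : ℂ) : ℝ →ᵇ ℂ :=
  -- The truncation `max s 0` makes the kernel bounded and continuous on the whole line. Only `s ≥
  -- 0` and `Re ν ≥ 0` are used.
  if hν : 0 ≤ ν.re then
    BoundedContinuousFunction.ofNormedAddCommGroup
      (fun s => Complex.exp (-ν * ((max s 0 : ℝ) : ℂ))) (by fun_prop) 1
      (fun s => norm_cexp_le_one hν (le_max_right s 0))
  else 0

theorem kexp_apply {ν : ℂ} (hν : 0 ≤ ν.re) {s : ℝ} (hs : 0 ≤ s) :
    kexp ν s = Complex.exp (-ν * s) := by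
  rw [kexp, dif_pos hν]
  simp [max_eq_left hs]

theorem kexp_add {ν : ℂ} (hν : 0 ≤ ν.re) {s t : ℝ} (hs : 0 ≤ s) (ht : 0 ≤ t) :
    kexp ν (s + t) = kexp ν s * kexp ν t := by
  rw [kexp_apply hν hs, kexp_apply hν ht, kexp_apply hν (add_nonneg hs ht), ← Complex.exp_add]
  push_cast; ring_nf

/-- Differentiability is meant in the supremum norm. It needs `Re ν > 0` strictly, so that the
candidate derivative `-s exp (-ν s)` is bounded on `s ≥ 0`. -/
theorem differentiableAt_kexp {ν : ℂ} (hν : 0 < ν.re) : DifferentiableAt ℂ kexp ν := by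
  have hse : ∀ s : ℝ, 0 ≤ s → s * Real.exp (-(ν.re * s)) ≤ 1 / ν.re := by
    intro s hs
    rw [le_div_iff₀ hν, Real.exp_neg, mul_assoc, ← div_eq_inv_mul, mul_div_assoc', div_le_one
      (Real.exp_pos _), mul_comm]
    have := Real.add_one_le_exp (ν.re * s)
    linarith
  let k' : ℝ →ᵇ ℂ := BoundedContinuousFunction.ofNormedAddCommGroup
    (fun s => -((max s 0 : ℝ) : ℂ) * Complex.exp (-ν * ((max s 0 : ℝ) : ℂ))) (by fun_prop)
    (1 / ν.re) (fun s => by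
      rw [norm_mul, norm_neg, Complex.norm_real, Real.norm_of_nonneg (le_max_right s 0),
        Complex.norm_exp]
      simpa using hse _ (le_max_right s 0))
  have hd : HasDerivAt kexp k' ν := by
    rw [hasDerivAt_iff_isLittleO]
    have hO : (fun ν' => kexp ν' - kexp ν - (ν' - ν) • k')
        =O[𝓝 ν] fun ν' => ‖ν' - ν‖ ^ 2 := by
      -- The quadratic remainder contains `S²`, and `e^a ≥ a²/2` with `a = Re ν S / 2` gives `S² ≤
      -- (8 / (Re ν)²) e^a`. Half of the decay `exp (-Re ν S)` pays for this, the other half for the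
      -- growth of the remainder on `‖ν' - ν‖ < Re ν / 2`.
      refine Asymptotics.IsBigO.of_bound (8 / ν.re ^ 2) ?_
      filter_upwards [Metric.ball_mem_nhds ν (half_pos hν)] with ν' hν'
      have hδ : ‖ν' - ν‖ < ν.re / 2 := by rwa [Metric.mem_ball, dist_eq_norm] at hν'
      have hν'0 : 0 ≤ ν'.re := by
        have := (abs_le.1 (Complex.abs_re_le_norm (ν' - ν))).1
        simp only [Complex.sub_re] at this
        linarith
      rw [Real.norm_of_nonneg (by positivity)]
      refine (BoundedContinuousFunction.norm_le (by positivity)).2 fun s => ?_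
      set S : ℝ := max s 0 with hS
      have hS0 : 0 ≤ S := le_max_right s 0
      have e : (kexp ν' - kexp ν - (ν' - ν) • k') s
          = Complex.exp (-ν * S) * (Complex.exp (-(ν' - ν) * S)
            - ∑ m ∈ Finset.range 2, (-(ν' - ν) * S) ^ m / m.factorial) := by
        have e1 : Complex.exp (-ν' * S) = Complex.exp (-ν * S) * Complex.exp (-(ν' - ν) * S) := by
          rw [← Complex.exp_add]; ring_nf
        simp only [BoundedContinuousFunction.coe_sub, Pi.sub_apply,
          BoundedContinuousFunction.coe_smul, kexp, dif_pos hν'0, dif_pos hν.le, k',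
          BoundedContinuousFunction.coe_ofNormedAddCommGroup, smul_eq_mul, ← hS, e1,
          Finset.sum_range_succ, Finset.sum_range_zero]
        simp
        ring
      have h1 := Complex.norm_exp_sub_sum_le_norm_mul_exp (-(ν' - ν) * S) 2
      have h2 : ‖-(ν' - ν) * (S : ℂ)‖ = ‖ν' - ν‖ * S := by
        rw [norm_mul, norm_neg, Complex.norm_real, Real.norm_of_nonneg hS0]
      rw [h2] at h1
      have h3 : ‖Complex.exp (-ν * S)‖ = Real.exp (-(ν.re * S)) := by
        rw [Complex.norm_exp]; simp
      rw [e, norm_mul, h3]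
      have h4 : Real.exp (‖ν' - ν‖ * S) ≤ Real.exp (ν.re / 2 * S) := by gcongr
      have h5 : Real.exp (-(ν.re * S)) * Real.exp (ν.re / 2 * S)
          * Real.exp (ν.re / 2 * S) = 1 := by
        rw [← Real.exp_add, ← Real.exp_add, Real.exp_eq_one_iff]; ring
      have h6 := Real.quadratic_le_exp_of_nonneg (x := ν.re / 2 * S) (by positivity)
      have h7 : S ^ 2 ≤ 8 / ν.re ^ 2 * Real.exp (ν.re / 2 * S) := by
        rw [div_mul_eq_mul_div, le_div_iff₀ (by positivity)]
        nlinarith [mul_nonneg hν.le hS0]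
      calc Real.exp (-(ν.re * S)) * _ ≤ Real.exp (-(ν.re * S)) *
            ((‖ν' - ν‖ * S) ^ 2 * Real.exp (ν.re / 2 * S)) := by
              gcongr
              exact h1.trans (by gcongr)
        _ = (Real.exp (-(ν.re * S)) * Real.exp (ν.re / 2 * S)) * ‖ν' - ν‖ ^ 2 * S ^ 2 := by ring
        _ ≤ (Real.exp (-(ν.re * S)) * Real.exp (ν.re / 2 * S)) * ‖ν' - ν‖ ^ 2 *
            (8 / ν.re ^ 2 * Real.exp (ν.re / 2 * S)) := by gcongr
        _ = (Real.exp (-(ν.re * S)) * Real.exp (ν.re / 2 * S) * Real.exp (ν.re / 2 * S)) *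
            (8 / ν.re ^ 2 * ‖ν' - ν‖ ^ 2) := by ring
        _ = _ := by rw [h5, one_mul]
    refine hO.trans_isLittleO ?_
    have : (fun ν' => ‖ν' - ν‖ ^ 2) =o[𝓝 ν] fun ν' => ‖ν' - ν‖ ^ 1 := by
      have h0 : Tendsto (fun ν' => ‖ν' - ν‖) (𝓝 ν) (𝓝 0) := by
        have : Continuous fun ν' : ℂ => ‖ν' - ν‖ := by fun_prop
        simpa using this.tendsto ν
      exact (Asymptotics.isLittleO_pow_pow (by norm_num : 1 < 2)).comp_tendsto h0
    simp only [pow_one] at this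
    exact this.of_norm_right
  exact hd.differentiableAt

/-- The Arzelà–Ascoli theorem requires a compact domain. If `a` lives in `(-R, R)`, the image of `f`
is determined by its restriction to `[-R, R]`, so the operator factors through continuous functions
on that interval. -/
theorem isCompactOperator_kerOp_of_support (hσ : σ = 1 ∨ σ = -1) (hσ0 : σ ≠ 0) (hY : Continuous Y)
    (hm : Monotone Y) (ha : Integrable a) {R : ℝ} (hR : 0 < R)
    (hsupp : ∀ ξ, ξ ∉ Set.Ioo (-R) R → a ξ = 0) {ν : ℂ} (hν : 0 ≤ ν.re) :
    IsCompactOperator (kerOp hσ0 hY ha (kexp ν)) := by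
  have hle : -R ≤ R := by linarith
  set T := kerOp hσ0 hY ha (kexp ν) with hT
  let P : ℝ → Set.Icc (-R) R := Set.projIcc (-R) R hle
  have hP : Continuous P := continuous_projIcc
  let res : (ℝ →ᵇ ℂ) →L[ℂ] (Set.Icc (-R) R →ᵇ ℂ) := LinearMap.mkContinuous
    { toFun := fun f => f.compContinuous ⟨Subtype.val, continuous_subtype_val⟩
      map_add' := fun _ _ => rfl
      map_smul' := fun _ _ => rfl } 1 (fun f => by
        rw [one_mul]
        exact (BoundedContinuousFunction.norm_le (norm_nonneg _)).2
          fun x => f.norm_coe_le_norm _)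
  let κ : ℝ →ᵇ ℂ := (kexp ν).compContinuous ⟨fun x => |Y x - Y (P x)|, by fun_prop⟩
  let ext : (Set.Icc (-R) R →ᵇ ℂ) →L[ℂ] (ℝ →ᵇ ℂ) := LinearMap.mkContinuous
    { toFun := fun f => κ * f.compContinuous ⟨P, hP⟩
      map_add' := fun f g => by ext x; simp [mul_add]
      map_smul' := fun c f => by ext x; simp; ring } ‖κ‖ (fun f => by
        refine (norm_mul_le _ _).trans (mul_le_mul_of_nonneg_left ?_ (norm_nonneg _))
        exact (BoundedContinuousFunction.norm_le (norm_nonneg _)).2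
          fun x => f.norm_coe_le_norm _)
  have hcomp : IsCompactOperator (res ∘L T) := by
    refine isCompactOperator_of_arzela_ascoli _
      (fun x₀ x => ∫ ξ, ‖kerFun σ Y (kexp ν) x₀ ξ - kerFun σ Y (kexp ν) x ξ‖ * ‖a ξ‖)
      (fun x₀ => ?_) (fun f hf x₀ x => ?_)
    · exact (tendsto_integral_kerFun_sub hσ0 hY ha (kexp ν) x₀).comp
        (continuous_subtype_val.tendsto x₀)
    · refine (dist_integral_kerFun_le hY ha (kexp ν) f x₀ x).trans ?_
      exact mul_le_of_le_one_left (integral_nonneg fun _ => by positivity) hf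
  -- Beyond one end point the image vanishes. Beyond the other it equals the boundary value times a
  -- factor `exp (-ν |Y x - Y (P x)|)`, by the multiplicativity `kexp_add`.
  have hfac : T = ext ∘L (res ∘L T) := by
    ext f x
    change T f x = kexp ν |Y x - Y (P x)| * T f (P x)
    rw [hT, kerOp_apply, kerOp_apply, ← integral_const_mul]
    refine integral_congr_ae (Eventually.of_forall fun ξ => ?_)
    change kerFun σ Y (kexp ν) x ξ * (a ξ * f ξ)
      = kexp ν |Y x - Y (P x)| * (kerFun σ Y (kexp ν) (P x) ξ * (a ξ * f ξ))
    rw [← mul_assoc (kexp ν |Y x - Y (P x)|)]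
    by_cases hξ : ξ ∈ Set.Ioo (-R) R
    swap
    · rw [hsupp ξ hξ]; simp
    congr 1
    have hk0 : kexp ν 0 = 1 := by rw [kexp_apply hν le_rfl]; simp
    rcases le_or_gt x (-R) with hx | hx
    · have hPx : (P x : ℝ) = -R := by simp only [P]; rw [Set.projIcc_of_le_left hle hx]
      rw [hPx]
      rcases hσ with rfl | rfl
      · have h1 : ξ ∈ {ξ | 0 < (1 : ℝ) * (ξ - x)} := by
          simp only [Set.mem_ofPred_eq]; linarith [hξ.1]
        have h2 : ξ ∈ {ξ | 0 < (1 : ℝ) * (ξ - -R)} := by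
          simp only [Set.mem_ofPred_eq]; linarith [hξ.1]
        simp only [kerFun]
        rw [Set.indicator_of_mem h1, Set.indicator_of_mem h2, one_mul, one_mul,
          abs_sub_comm, abs_of_nonneg (sub_nonneg.2 (hm hx)), ← kexp_add hν
          (sub_nonneg.2 (hm hx)) (sub_nonneg.2 (hm hξ.1.le))]
        congr 1; ring
      · have h1 : ξ ∉ {ξ | 0 < (-1 : ℝ) * (ξ - x)} := by
          simp only [Set.mem_ofPred_eq]; linarith [hξ.1]
        have h2 : ξ ∉ {ξ | 0 < (-1 : ℝ) * (ξ - -R)} := by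
          simp only [Set.mem_ofPred_eq]; linarith [hξ.1]
        simp only [kerFun]
        rw [Set.indicator_of_notMem h1, Set.indicator_of_notMem h2, mul_zero]
    rcases le_or_gt R x with hx' | hx'
    · have hPx : (P x : ℝ) = R := by simp only [P]; rw [Set.projIcc_of_right_le hle hx']
      rw [hPx]
      rcases hσ with rfl | rfl
      · have h1 : ξ ∉ {ξ | 0 < (1 : ℝ) * (ξ - x)} := by
          simp only [Set.mem_ofPred_eq]; linarith [hξ.2]
        have h2 : ξ ∉ {ξ | 0 < (1 : ℝ) * (ξ - R)} := by
          simp only [Set.mem_ofPred_eq]; linarith [hξ.2]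
        simp only [kerFun]
        rw [Set.indicator_of_notMem h1, Set.indicator_of_notMem h2, mul_zero]
      · have h1 : ξ ∈ {ξ | 0 < (-1 : ℝ) * (ξ - x)} := by
          simp only [Set.mem_ofPred_eq]; linarith [hξ.2]
        have h2 : ξ ∈ {ξ | 0 < (-1 : ℝ) * (ξ - R)} := by
          simp only [Set.mem_ofPred_eq]; linarith [hξ.2]
        simp only [kerFun]
        rw [Set.indicator_of_mem h1, Set.indicator_of_mem h2,
          abs_of_nonneg (sub_nonneg.2 (hm hx')), ← kexp_add hν
          (sub_nonneg.2 (hm hx')) (by linarith [hm hξ.2.le])]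
        congr 1; ring
    · have hPx : (P x : ℝ) = x := by
        simp only [P]; rw [Set.projIcc_of_mem hle ⟨hx.le, hx'.le⟩]
      rw [hPx, sub_self, abs_zero, hk0, one_mul]
  rw [hfac]
  exact hcomp.clm_comp ext

/-- The operator depends continuously, in operator norm, on `a` in `L¹`. It is a norm limit of the
compact operators obtained by truncating `a`. -/
theorem isCompactOperator_kerOp (hσ : σ = 1 ∨ σ = -1) (hσ0 : σ ≠ 0) (hY : Continuous Y)
    (hm : Monotone Y) (ha : Integrable a) {ν : ℂ} (hν : 0 ≤ ν.re) :
    IsCompactOperator (kerOp hσ0 hY ha (kexp ν)) := by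
  have hms : ∀ n : ℕ, MeasurableSet (Set.Ioo (-((n : ℝ) + 1)) (n + 1)) := fun n => measurableSet_Ioo
  have hai : ∀ n : ℕ, Integrable ((Set.Ioo (-((n : ℝ) + 1)) (n + 1)).indicator a) := fun n =>
    ha.indicator (hms n)
  refine isCompactOperator_of_tendsto (l := atTop) (F := fun n : ℕ =>
    kerOp hσ0 hY (hai n) (kexp ν)) ?_ (Eventually.of_forall fun n => ?_)
  · rw [tendsto_iff_norm_sub_tendsto_zero]
    have h1 : Tendsto (fun n : ℕ => ∫ ξ, ‖(Set.Ioo (-((n : ℝ) + 1)) (n + 1)).indicator a ξ - a ξ‖)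
        atTop (𝓝 0) := by
      have := tendsto_integral_of_dominated_convergence (μ := volume)
        (F := fun (n : ℕ) ξ => ‖(Set.Ioo (-((n : ℝ) + 1)) (n + 1)).indicator a ξ - a ξ‖)
        (f := fun _ => 0) (fun ξ => ‖a ξ‖)
        (fun n => ((hai n).sub ha).norm.aestronglyMeasurable) ha.norm
        (fun n => Eventually.of_forall fun ξ => by
          rw [norm_norm]
          by_cases h : ξ ∈ Set.Ioo (-((n : ℝ) + 1)) (n + 1)
          · rw [Set.indicator_of_mem h]; simp
          · rw [Set.indicator_of_notMem h]; simp)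
        (Eventually.of_forall fun ξ => by
          refine tendsto_const_nhds.congr' ?_
          filter_upwards [eventually_ge_atTop ⌈|ξ|⌉₊] with n hn
          have h1 : |ξ| ≤ n := (Nat.le_ceil _).trans (by exact_mod_cast hn)
          have h2 := abs_le.1 h1
          rw [Set.indicator_of_mem (show ξ ∈ Set.Ioo (-((n : ℝ) + 1)) (n + 1) from
            ⟨by linarith [h2.1], by linarith [h2.2]⟩)]
          simp)
      simpa using this
    have h2 := h1.mul_const ‖kexp ν‖
    rw [zero_mul] at h2
    exact squeeze_zero (fun _ => norm_nonneg _)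
      (fun n => norm_kerOp_sub_le hσ0 hY (hai n) ha (kexp ν)) h2
  · exact isCompactOperator_kerOp_of_support hσ hσ0 hY hm (hai n) (R := n + 1) (by positivity)
      (fun ξ hξ => Set.indicator_of_notMem hξ a) hν

end KernelOperators

/-! ### Analyticity of the eigenfunctions in `z` by the Fredholm alternative -/

section Analyticity

theorem integral_kerFun_one {Y : ℝ → ℝ} (hm : Monotone Y) {ν : ℂ} (hν : 0 ≤ ν.re) (g : ℝ → ℂ)
    (x : ℝ) : ∫ ξ, kerFun 1 Y (kexp ν) x ξ * g ξ
      = ∫ ξ in Set.Ioi x, Complex.exp (-ν * ((Y ξ - Y x : ℝ) : ℂ)) * g ξ := by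
  rw [← integral_indicator measurableSet_Ioi]
  refine integral_congr_ae (Eventually.of_forall fun ξ => ?_)
  simp only [kerFun]
  by_cases h : x < ξ
  · rw [Set.indicator_of_mem (show ξ ∈ {ξ | 0 < (1 : ℝ) * (ξ - x)} by
      simp only [Set.mem_ofPred_eq]; linarith), Set.indicator_of_mem (show ξ ∈ Set.Ioi x from h),
      one_mul, kexp_apply hν (sub_nonneg.2 (hm h.le))]
  · rw [Set.indicator_of_notMem (show ξ ∉ {ξ | 0 < (1 : ℝ) * (ξ - x)} by
      simp only [Set.mem_ofPred_eq]; linarith), Set.indicator_of_notMem (show ξ ∉ Set.Ioi x from h),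
      zero_mul]

theorem integral_kerFun_neg_one {Y : ℝ → ℝ} (hm : Monotone Y) {ν : ℂ} (hν : 0 ≤ ν.re) (g : ℝ → ℂ)
    (x : ℝ) : ∫ ξ, kerFun (-1) Y (kexp ν) x ξ * g ξ
      = ∫ ξ in Set.Iic x, Complex.exp (ν * ((Y ξ - Y x : ℝ) : ℂ)) * g ξ := by
  rw [integral_Iic_eq_integral_Iio, ← integral_indicator measurableSet_Iio]
  refine integral_congr_ae (Eventually.of_forall fun ξ => ?_)
  simp only [kerFun]
  by_cases h : ξ < x
  · rw [Set.indicator_of_mem (show ξ ∈ {ξ | 0 < (-1 : ℝ) * (ξ - x)} by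
      simp only [Set.mem_ofPred_eq]; linarith), Set.indicator_of_mem (show ξ ∈ Set.Iio x from h),
      kexp_apply hν (by linarith [hm h.le])]
    push_cast; ring_nf
  · rw [Set.indicator_of_notMem (show ξ ∉ {ξ | 0 < (-1 : ℝ) * (ξ - x)} by
      simp only [Set.mem_ofPred_eq]; linarith), Set.indicator_of_notMem (show ξ ∉ Set.Iio x from h),
      zero_mul]

variable {Y : ℝ → ℝ} {a : Fin 3 → Fin 3 → ℝ → ℂ} {s : Fin 3 → ℝ}

/-- The integral operator acting on one column of the system of integral equations. -/
noncomputable def jostOp (hs : ∀ j, s j ≠ 0) (hY : Continuous Y) (ha : ∀ j k, Integrable (a j k))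
    (κ : Fin 3 → (ℝ →ᵇ ℂ)) : (Fin 3 → (ℝ →ᵇ ℂ)) →L[ℂ] (Fin 3 → (ℝ →ᵇ ℂ)) :=
  ∑ j, ∑ k, (ContinuousLinearMap.single ℂ (fun _ => (ℝ →ᵇ ℂ)) j) ∘L
    ((-(s j : ℂ)) • kerOp (hs j) hY (ha j k) (κ j)) ∘L ContinuousLinearMap.proj k

theorem jostOp_apply (hs : ∀ j, s j ≠ 0) (hY : Continuous Y) (ha : ∀ j k, Integrable (a j k))
    (κ : Fin 3 → (ℝ →ᵇ ℂ)) (f : Fin 3 → (ℝ →ᵇ ℂ)) (j : Fin 3) (x : ℝ) :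
    jostOp hs hY ha κ f j x
      = -(s j : ℂ) * ∫ ξ, kerFun (s j) Y (κ j) x ξ * ∑ k, a j k ξ * f k ξ := by
  have h1 : ∫ ξ, kerFun (s j) Y (κ j) x ξ * ∑ k, a j k ξ * f k ξ
      = ∑ k, ∫ ξ, kerFun (s j) Y (κ j) x ξ * (a j k ξ * f k ξ) := by
    simp only [Finset.mul_sum]
    exact integral_finsetSum _ fun k _ => integrable_kerFun_mul hY (ha j k) (κ j) (f k) x
  rw [h1, jostOp]
  simp only [sum_apply, Finset.sum_apply, ContinuousLinearMap.comp_apply,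
    ContinuousLinearMap.single_apply, ContinuousLinearMap.proj_apply]
  rw [Finset.sum_eq_single j]
  · simp only [Pi.single_eq_same, BoundedContinuousFunction.coe_sum, Finset.sum_apply,
      smul_apply, BoundedContinuousFunction.coe_smul, smul_eq_mul, kerOp_apply,
      Finset.mul_sum]
  · intro i _ hi
    simp [Pi.single_eq_of_ne hi.symm]
  · simp

theorem isCompactOperator_jostOp (hs : ∀ j, s j ≠ 0) (hY : Continuous Y)
    (ha : ∀ j k, Integrable (a j k)) (hs1 : ∀ j, s j = 1 ∨ s j = -1) (hm : Monotone Y)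
    {ν : Fin 3 → ℂ} (hν : ∀ j, 0 ≤ (ν j).re) :
    IsCompactOperator (jostOp hs hY ha fun j => kexp (ν j)) := by
  have h : ∀ j k, IsCompactOperator ((ContinuousLinearMap.single ℂ (fun _ => (ℝ →ᵇ ℂ)) j) ∘L
      ((-(s j : ℂ)) • kerOp (hs j) hY (ha j k) (kexp (ν j))) ∘L ContinuousLinearMap.proj k :
      (Fin 3 → (ℝ →ᵇ ℂ)) →L[ℂ] (Fin 3 → (ℝ →ᵇ ℂ))) := fun j k => by
    have h1 : IsCompactOperator ((-(s j : ℂ)) • kerOp (hs j) hY (ha j k) (kexp (ν j))) :=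
      (isCompactOperator_kerOp (hs1 j) (hs j) hY hm (ha j k) (hν j)).smul (-(s j : ℂ))
    have h2 := h1.comp_clm (ContinuousLinearMap.proj (R := ℂ) (φ := fun _ : Fin 3 => (ℝ →ᵇ ℂ)) k)
    exact h2.clm_comp (ContinuousLinearMap.single ℂ (fun _ => (ℝ →ᵇ ℂ)) j)
  simp only [jostOp, Fin.sum_univ_three]
  exact (((h 0 0).add (h 0 1)).add (h 0 2)).add (((h 1 0).add (h 1 1)).add (h 1 2)) |>.add
    (((h 2 0).add (h 2 1)).add (h 2 2))

theorem differentiableAt_jostOp (hs : ∀ j, s j ≠ 0) (hY : Continuous Y)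
    (ha : ∀ j k, Integrable (a j k)) {κ : ℂ → Fin 3 → (ℝ →ᵇ ℂ)} {z₀ : ℂ}
    (hκ : ∀ j, DifferentiableAt ℂ (fun z => κ z j) z₀) :
    DifferentiableAt ℂ (fun z => jostOp hs hY ha (κ z)) z₀ := by
  unfold jostOp
  refine DifferentiableAt.fun_sum (𝕜 := ℂ) (E := ℂ)
    (F := (Fin 3 → (ℝ →ᵇ ℂ)) →L[ℂ] (Fin 3 → (ℝ →ᵇ ℂ))) fun j _ => ?_
  refine DifferentiableAt.fun_sum (𝕜 := ℂ) (E := ℂ)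
    (F := (Fin 3 → (ℝ →ᵇ ℂ)) →L[ℂ] (Fin 3 → (ℝ →ᵇ ℂ))) fun k _ => ?_
  have h1 : DifferentiableAt ℂ (fun z => (-(s j : ℂ)) • kerOp (hs j) hY (ha j k) (κ z j)) z₀ :=
    DifferentiableAt.fun_const_smul (f := fun z => kerOp (hs j) hY (ha j k) (κ z j))
      ((kerOp (hs j) hY (ha j k)).differentiableAt.comp z₀ (hκ j)) _
  have h2 := h1.clm_comp (differentiableAt_const
    (ContinuousLinearMap.proj (R := ℂ) (φ := fun _ : Fin 3 => (ℝ →ᵇ ℂ)) k))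
  exact (differentiableAt_const (ContinuousLinearMap.single ℂ (fun _ => (ℝ →ᵇ ℂ)) j)).clm_comp h2

theorem differentiableAt_ringInverse_clm {E : Type*} [NormedAddCommGroup E] [NormedSpace ℂ E]
    [CompleteSpace E] {T : ℂ → E →L[ℂ] E} {z₀ : ℂ} (hT : DifferentiableAt ℂ T z₀)
    (hu : IsUnit (T z₀)) :
    DifferentiableAt ℂ (fun z => Ring.inverse (T z)) z₀ ∧ ∀ᶠ z in 𝓝 z₀, IsUnit (T z) := by
  constructor
  · have h1 : DifferentiableAt ℂ (Ring.inverse : (E →L[ℂ] E) → (E →L[ℂ] E)) (T z₀) :=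
      differentiableAt_inverse (𝕜 := ℂ) (R := E →L[ℂ] E) hu
    exact h1.comp z₀ hT
  · have h2 : {A : E →L[ℂ] E | IsUnit A} ∈ 𝓝 (T z₀) :=
      (Units.isOpen (R := E →L[ℂ] E)).mem_nhds hu
    exact hT.continuousAt h2

theorem contour_closed : IsClosed contour := by
  have : contour = {z | (z ^ 3).im = 0} := Set.ext fun z => mem_contour_iff z
  rw [this]
  exact isClosed_eq (by fun_prop) continuous_const

theorem isOpen_regularSet (D : ScatteringData) : IsOpen D.regularSet := by
  have : D.regularSet = contourᶜ ∩ ⋂ n, {D.pole n}ᶜ := by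
    ext z; simp [ScatteringData.regularSet]
  rw [this]
  exact contour_closed.isOpen_compl.inter
    (isOpen_iInter_of_finite fun n => isOpen_compl_singleton)

theorem continuous_lam (j : Fin 3) : Continuous fun z => lam z j := by
  unfold lam; fun_prop

theorem lam_re_ne {z : ℂ} (hz : z ∉ contour) {j l : Fin 3} (hjl : j ≠ l) :
    (lam z j).re ≠ (lam z l).re := fun h => hz ⟨j, l, hjl, h⟩

/-- Off the contour, the order of the real parts of the `λ_j` is locally constant. -/
theorem eventually_lam_re_iff {z₀ : ℂ} (hz₀ : z₀ ∉ contour) (j l : Fin 3) :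
    ∀ᶠ z in 𝓝 z₀, ((lam z l).re ≤ (lam z j).re ↔ (lam z₀ l).re ≤ (lam z₀ j).re) := by
  rcases eq_or_ne j l with rfl | hjl
  · simp
  have hc : ∀ i, ContinuousAt (fun z => (lam z i).re) z₀ := fun i =>
    (Complex.continuous_re.comp (continuous_lam i)).continuousAt
  rcases (lam_re_ne hz₀ hjl).lt_or_gt with h | h
  · filter_upwards [(hc j).eventually_lt (hc l) h] with z hz
    exact ⟨fun h' => absurd h' hz.not_ge, fun h' => absurd h' h.not_ge⟩
  · filter_upwards [(hc l).eventually_lt (hc j) h] with z hz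
    exact ⟨fun _ => h.le, fun _ => hz.le⟩

/-- The sign that selects the end point of integration in the `(j, l)` equation. -/
noncomputable def jostSign (z : ℂ) (l j : Fin 3) : ℝ :=
  if (lam z l).re ≤ (lam z j).re then 1 else -1

theorem jostSign_eq (z : ℂ) (l j : Fin 3) : jostSign z l j = 1 ∨ jostSign z l j = -1 := by
  unfold jostSign; split_ifs <;> simp

theorem jostSign_ne_zero (z : ℂ) (l j : Fin 3) : jostSign z l j ≠ 0 := by
  rcases jostSign_eq z l j with h | h <;> rw [h] <;> norm_num

end Analyticity

namespace IsInitialDatum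

variable {w : ℝ → ℝ} (h : IsInitialDatum w)
include h

theorem integrable_UOf (j k : Fin 3) : Integrable fun x => UOf w x j k := by
  simp only [h.UOf_eq, Matrix.smul_apply, smul_eq_mul]
  exact h.integrable_kapOf.ofReal.mul_const _

/-- The integral equations for the `l`-th column in operator form. -/
theorem jostOp_UOf_apply {z z₀ : ℂ} {l : Fin 3}
    (hpat : ∀ j, (lam z l).re ≤ (lam z j).re ↔ (lam z₀ l).re ≤ (lam z₀ j).re)
    (f : Fin 3 → (ℝ →ᵇ ℂ)) (M : ℝ → Mat) (hf : ∀ x j, M x j l = f j x) (j : Fin 3) (x : ℝ) :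
    jostOp (jostSign_ne_zero z₀ l) h.continuous_yOf h.integrable_UOf
        (fun j => kexp (jostSign z₀ l j * (lam z j - lam z l))) f j x
      = if (lam z l).re ≤ (lam z j).re then - ∫ ξ in Set.Ioi x, integrand w z M j l x ξ
        else ∫ ξ in Set.Iic x, integrand w z M j l x ξ := by
  rw [jostOp_apply]
  have e : ∀ ξ, ∑ k, UOf w ξ j k * f k ξ = (UOf w ξ * M ξ) j l := fun ξ => by
    rw [Matrix.mul_apply]; simp only [hf]
  simp only [e, h.integrand_eq]
  by_cases hle : (lam z l).re ≤ (lam z j).re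
  · have hσ : jostSign z₀ l j = 1 := by rw [jostSign, if_pos ((hpat j).1 hle)]
    rw [if_pos hle, hσ, integral_kerFun_one h.strictMono_yOf.monotone (by simpa using hle)]
    simp
  · have hσ : jostSign z₀ l j = -1 := by rw [jostSign, if_neg (mt (hpat j).2 hle)]
    rw [if_neg hle, hσ, integral_kerFun_neg_one h.strictMono_yOf.monotone
      (by simpa using (not_le.1 hle).le)]
    simp

theorem integrableOn_integrand_Ioi {P : ℝ → Mat} (hPc : ∀ j l, Continuous fun x => P x j l)
    (hPb : ∃ C : ℝ, ∀ x j l, ‖P x j l‖ ≤ C) {z : ℂ} {i k : Fin 3}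
    (hle : (lam z k).re ≤ (lam z i).re) (x : ℝ) :
    IntegrableOn (integrand w z P i k x) (Set.Ioi x) := by
  have e : integrand w z P i k x = fun ξ => Complex.exp (-(lam z i - lam z k) *
      ((yOf w ξ - yOf w x : ℝ) : ℂ)) * (UOf w ξ * P ξ) i k := funext fun ξ => h.integrand_eq _ _ _ _ _ _
  rw [e]
  refine (h.integrable_UOf_mul hPc hPb i k).norm.integrableOn.mono'
    (Continuous.aestronglyMeasurable ?_) ?_
  · have := h.continuous_yOf
    exact (Complex.continuous_exp.comp (continuous_const.mul (Complex.continuous_ofReal.comp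
      (this.sub continuous_const)))).mul (IsJost.continuous_mul_apply h.continuous_UOf hPc i k)
  · refine (ae_restrict_mem measurableSet_Ioi).mono fun ξ hξ => ?_
    have hm : yOf w x ≤ yOf w ξ := h.strictMono_yOf.monotone (le_of_lt (Set.mem_Ioi.1 hξ))
    have h1 : 0 ≤ (lam z i - lam z k).re := by simpa using hle
    have h2 := norm_cexp_le_one h1 (sub_nonneg.2 hm)
    rw [norm_mul]
    exact mul_le_of_le_one_left (norm_nonneg _) h2

theorem integrableOn_integrand_Iic {P : ℝ → Mat} (hPc : ∀ j l, Continuous fun x => P x j l)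
    (hPb : ∃ C : ℝ, ∀ x j l, ‖P x j l‖ ≤ C) {z : ℂ} {i k : Fin 3}
    (hlt : (lam z i).re < (lam z k).re) (x : ℝ) :
    IntegrableOn (integrand w z P i k x) (Set.Iic x) := by
  have e : integrand w z P i k x = fun ξ => Complex.exp (-(lam z k - lam z i) *
      ((yOf w x - yOf w ξ : ℝ) : ℂ)) * (UOf w ξ * P ξ) i k := funext fun ξ => by
    rw [h.integrand_eq]; push_cast; ring_nf
  rw [e]
  refine (h.integrable_UOf_mul hPc hPb i k).norm.integrableOn.mono'
    (Continuous.aestronglyMeasurable ?_) ?_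
  · have := h.continuous_yOf
    exact (Complex.continuous_exp.comp (continuous_const.mul (Complex.continuous_ofReal.comp
      (continuous_const.sub this)))).mul (IsJost.continuous_mul_apply h.continuous_UOf hPc i k)
  · refine (ae_restrict_mem measurableSet_Iic).mono fun ξ hξ => ?_
    have hm : yOf w ξ ≤ yOf w x := h.strictMono_yOf.monotone (Set.mem_Iic.1 hξ)
    have h1 : 0 ≤ (lam z k - lam z i).re := by simpa using hlt.le
    have h2 := norm_cexp_le_one h1 (sub_nonneg.2 hm)
    rw [norm_mul]
    exact mul_le_of_le_one_left (norm_nonneg _) h2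

/-- Turns a nontrivial solution of the homogeneous integral equations into a second eigenfunction,
in contradiction to uniqueness. -/
theorem isEigenfunction_add {z : ℂ} {M N : ℝ → Mat} (hM : IsEigenfunction w z M)
    (hNc : ∀ j l, Continuous fun x => N x j l) (hNb : ∃ C : ℝ, ∀ x j l, ‖N x j l‖ ≤ C)
    (hr : ∀ j l, (lam z l).re ≤ (lam z j).re → ∀ x,
      N x j l = - ∫ ξ in Set.Ioi x, integrand w z N j l x ξ)
    (hl : ∀ j l, (lam z j).re < (lam z l).re → ∀ x,
      N x j l = ∫ ξ in Set.Iic x, integrand w z N j l x ξ) :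
    IsEigenfunction w z (fun x => M x + N x) := by
  have hMc : ∀ j l, Continuous fun x => M x j l := fun j l => hM.continuous.matrix_elem j l
  have hadd : ∀ i k x ξ, integrand w z (fun x => M x + N x) i k x ξ
      = integrand w z M i k x ξ + integrand w z N i k x ξ := by
    intro i k x ξ
    simp only [integrand, Matrix.mul_add, Matrix.add_apply]
    ring
  refine ⟨hM.continuous.add (continuous_matrix hNc), ?_, fun i k hle x => ?_, fun i k hlt x => ?_⟩
  · obtain ⟨C, hC⟩ := hM.bounded
    obtain ⟨C', hC'⟩ := hNb
    exact ⟨C + C', fun x i k => (norm_add_le _ _).trans (add_le_add (hC x i k) (hC' x i k))⟩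
  · simp only [Matrix.add_apply, hadd]
    rw [integral_add (h.integrableOn_integrand_Ioi hMc hM.bounded hle x)
      (h.integrableOn_integrand_Ioi hNc hNb hle x), hM.eq_right i k hle x, hr i k hle x]
    ring
  · simp only [Matrix.add_apply, hadd]
    rw [integral_add (h.integrableOn_integrand_Iic hMc hM.bounded hlt x)
      (h.integrableOn_integrand_Iic hNc hNb hlt x), hM.eq_left i k hlt x, hl i k hlt x]
    ring

set_option maxHeartbeats 800000 in
-- The `l`-th column solves `(1 - K(z)) f = e_l` with `K(z₀)` compact. A fixed vector of `K(z₀)`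
-- could be added to the eigenfunction, which uniqueness forbids. Hence `1 - K(z₀)` is invertible,
-- and the column is `(1 - K(z))⁻¹ e_l` near `z₀`, holomorphic because `K` is.
theorem differentiableAt_of_isEigenfunction {D : ScatteringData} {M : ℝ → ℂ → Mat}
    (hM : ∀ z ∈ D.regularSet, IsEigenfunction w z (fun x => M x z) ∧
      ∀ M' : ℝ → Mat, IsEigenfunction w z M' → ∀ x, M' x = M x z)
    {z₀ : ℂ} (hz₀ : z₀ ∈ D.regularSet) (x : ℝ) (j l : Fin 3) :
    DifferentiableAt ℂ (fun z => M x z j l) z₀ := by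
  classical
  -- The end points of integration are frozen at those of `z₀`, so that `K` is differentiable at
  -- `z₀`. Off the contour the order of the `Re λ_j` is locally constant, so `K z` is still the
  -- correct operator near `z₀`.
  set K : ℂ → ((Fin 3 → (ℝ →ᵇ ℂ)) →L[ℂ] (Fin 3 → (ℝ →ᵇ ℂ))) := fun z =>
    jostOp (jostSign_ne_zero z₀ l) h.continuous_yOf h.integrable_UOf
      (fun j => kexp (jostSign z₀ l j * (lam z j - lam z l))) with hK
  have hν : ∀ j, 0 ≤ ((jostSign z₀ l j : ℂ) * (lam z₀ j - lam z₀ l)).re := by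
    intro j
    unfold jostSign
    split_ifs with hle
    · simpa using hle
    · simpa using (not_le.1 hle).le
  have hKd : DifferentiableAt ℂ K z₀ := by
    refine differentiableAt_jostOp _ _ _ fun j => ?_
    rcases eq_or_ne j l with rfl | hjl
    · simp only [sub_self, mul_zero]
      exact differentiableAt_const _
    · have hpos : 0 < ((jostSign z₀ l j : ℂ) * (lam z₀ j - lam z₀ l)).re := by
        refine lt_of_le_of_ne (hν j) fun h0 => ?_
        have h1 : jostSign z₀ l j * ((lam z₀ j).re - (lam z₀ l).re) = 0 := by
          rw [h0]; simp
        rcases mul_eq_zero.1 h1 with h1 | h1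
        · exact jostSign_ne_zero _ _ _ h1
        · exact lam_re_ne hz₀.1 hjl (sub_eq_zero.1 h1)
      have hd : DifferentiableAt ℂ (fun z => (jostSign z₀ l j : ℂ) * (lam z j - lam z l)) z₀ := by
        unfold lam
        fun_prop
      exact DifferentiableAt.comp (g := kexp) z₀ (differentiableAt_kexp hpos) hd
  have hKc : IsCompactOperator (K z₀) :=
    isCompactOperator_jostOp _ _ _ (jostSign_eq z₀ l) h.strictMono_yOf.monotone hν
  have hunit : IsUnit (1 - K z₀) := by
    rcases hKc.hasEigenvalue_or_mem_resolventSet (μ := (1 : ℂ)) one_ne_zero with he | hr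
    · exfalso
      obtain ⟨f, hf⟩ := he.exists_hasEigenvector
      have hfK : K z₀ f = f := by
        have := hf.apply_eq_smul
        rwa [one_smul] at this
      apply hf.2
      obtain ⟨hE, hU⟩ := hM z₀ hz₀
      -- The fixed vector is placed in column `l` and the other columns are zero; columns decouple
      -- in the integral equations.
      let N : ℝ → Mat := fun x => Matrix.of fun i k => if k = l then f i x else 0
      have hNf : ∀ x i, N x i l = f i x := fun x i => by simp [N]
      have hNo : ∀ x i k, k ≠ l → N x i k = 0 := fun x i k hk => by simp [N, hk]
      have hNc : ∀ i k, Continuous fun x => N x i k := fun i k => by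
        rcases eq_or_ne k l with rfl | hk
        · simp only [hNf]; exact (f i).continuous
        · simp only [hNo _ _ _ hk]; exact continuous_const
      have hNb : ∃ C : ℝ, ∀ x i k, ‖N x i k‖ ≤ C := ⟨‖f‖, fun x i k => by
        rcases eq_or_ne k l with rfl | hk
        · rw [hNf]; exact ((f i).norm_coe_le_norm x).trans (norm_le_pi_norm f i)
        · rw [hNo _ _ _ hk, norm_zero]; exact norm_nonneg _⟩
      have hNU : ∀ x i k, k ≠ l → (UOf w x * N x) i k = 0 := fun x i k hk => by
        rw [Matrix.mul_apply]; exact Finset.sum_eq_zero fun a _ => by rw [hNo _ _ _ hk, mul_zero]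
      have key : ∀ i x, N x i l = if (lam z₀ l).re ≤ (lam z₀ i).re then
          - ∫ ξ in Set.Ioi x, integrand w z₀ N i l x ξ
          else ∫ ξ in Set.Iic x, integrand w z₀ N i l x ξ := fun i x => by
        rw [← h.jostOp_UOf_apply (z₀ := z₀) (fun _ => Iff.rfl) f N hNf, hNf]
        change f i x = K z₀ f i x
        rw [hfK]
      have hiN : ∀ i k x, k ≠ l → ∀ ξ, integrand w z₀ N i k x ξ = 0 := fun i k x hk ξ => by
        rw [h.integrand_eq, hNU _ _ _ hk, mul_zero]
      have hsum : IsEigenfunction w z₀ (fun x => M x z₀ + N x) := by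
        refine h.isEigenfunction_add hE hNc hNb (fun i k hle x => ?_) (fun i k hlt x => ?_)
        · rcases eq_or_ne k l with rfl | hk
          · rw [key i x, if_pos hle]
          · simp only [hNo _ _ _ hk, hiN _ _ _ hk, integral_zero, neg_zero]
        · rcases eq_or_ne k l with rfl | hk
          · rw [key i x, if_neg hlt.not_ge]
          · simp only [hNo _ _ _ hk, hiN _ _ _ hk, integral_zero]
      funext i
      ext x
      have := congrArg (fun A : Mat => A i l) (hU _ hsum x)
      simp only [Matrix.add_apply, hNf] at this
      simpa using this
    · simpa [resolventSet] using hr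
  let e : Fin 3 → (ℝ →ᵇ ℂ) := fun i => BoundedContinuousFunction.const ℝ ((1 : Mat) i l)
  have hinv := differentiableAt_ringInverse_clm (T := fun z => 1 - K z)
    ((differentiableAt_const _).fun_sub hKd) hunit
  have hev : ∀ᶠ z in 𝓝 z₀, M x z j l = Ring.inverse (1 - K z) e j x := by
    filter_upwards [(isOpen_regularSet D).mem_nhds hz₀,
      eventually_all.2 fun j => eventually_lam_re_iff hz₀.1 j l,
      hinv.2] with z hz hpat hu
    obtain ⟨hE, -⟩ := hM z hz
    obtain ⟨C, hC⟩ := hE.bounded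
    let f : Fin 3 → (ℝ →ᵇ ℂ) := fun i => BoundedContinuousFunction.ofNormedAddCommGroup
      (fun x => M x z i l) (hE.continuous.matrix_elem i l) C (fun x => hC x i l)
    have hf : (1 - K z) f = e := by
      funext i
      ext x
      change M x z i l - K z f i x = (1 : Mat) i l
      rw [hK]
      simp only
      rw [h.jostOp_UOf_apply hpat f (fun x => M x z) (fun _ _ => rfl)]
      split_ifs with hle
      · rw [hE.eq_right i l hle x]; ring
      · rw [hE.eq_left i l (not_le.1 hle) x]; ring
    rw [← hf, ← mul_apply_eq_comp, Ring.inverse_mul_cancel _ hu]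
    rfl
  refine DifferentiableAt.congr_of_eventuallyEq ?_ hev
  have h2 : DifferentiableAt ℂ (fun z => Ring.inverse (1 - K z) e) z₀ :=
    hinv.1.clm_apply (differentiableAt_const e)
  have h3 : DifferentiableAt ℂ (fun z => Ring.inverse (1 - K z) e j) z₀ :=
    (differentiableAt_pi.1 h2) j
  exact (BoundedContinuousFunction.evalCLM ℂ x).differentiableAt.comp z₀ h3

end IsInitialDatum

/-! ### Partial derivatives of functions smooth on the closed half-plane -/

section HalfPlane

theorem convex_halfPlane : Convex ℝ {p : ℝ × ℝ | 0 ≤ p.2} :=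
  (convex_Ici (0 : ℝ)).is_linear_preimage (f := fun p : ℝ × ℝ => p.2)
    ⟨fun _ _ => rfl, fun _ _ => rfl⟩

theorem isOpen_upperHalfPlane : IsOpen {p : ℝ × ℝ | 0 < p.2} :=
  isOpen_lt continuous_const continuous_snd

theorem uniqueDiffOn_halfPlane : UniqueDiffOn ℝ {p : ℝ × ℝ | 0 ≤ p.2} := by
  refine uniqueDiffOn_convex convex_halfPlane ⟨(0, 1), ?_⟩
  exact mem_interior.2 ⟨{p : ℝ × ℝ | 0 < p.2}, fun p hp => le_of_lt (show (0 : ℝ) < p.2 from hp),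
    isOpen_upperHalfPlane, by simp⟩

theorem halfPlane_mem_nhds {p : ℝ × ℝ} (hp : 0 < p.2) : {p : ℝ × ℝ | 0 ≤ p.2} ∈ 𝓝 p :=
  mem_of_superset (isOpen_upperHalfPlane.mem_nhds hp) fun q (hq : 0 < q.2) => le_of_lt hq

variable {G : ℝ × ℝ → ℝ}

theorem hasFDerivWithinAt_halfPlane (hG : ContDiffOn ℝ ∞ G {p | 0 ≤ p.2}) {p : ℝ × ℝ} (hp : 0 ≤ p.2) :
    HasFDerivWithinAt G (fderivWithin ℝ G {p | 0 ≤ p.2} p) {p | 0 ≤ p.2} p :=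
  (hG.differentiableOn (by simp) p hp).hasFDerivWithinAt

/-- Horizontal lines stay inside the closed half-plane, so the spatial derivative is two-sided even
at `t = 0`. In time only a one-sided derivative is available there. -/
theorem hasDerivAt_fst_halfPlane (hG : ContDiffOn ℝ ∞ G {p | 0 ≤ p.2}) (x : ℝ) {t : ℝ} (ht : 0 ≤ t) :
    HasDerivAt (fun x' => G (x', t)) (fderivWithin ℝ G {p | 0 ≤ p.2} (x, t) (1, 0)) x := by
  have h1 : HasDerivWithinAt (fun x' : ℝ => ((x', t) : ℝ × ℝ)) (1, 0) Set.univ x :=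
    ((hasDerivAt_id x).prodMk (hasDerivAt_const x t)).hasDerivWithinAt
  exact ((hasFDerivWithinAt_halfPlane hG (p := (x, t)) ht).comp_hasDerivWithinAt x h1
    (fun x' _ => ht)).hasDerivAt univ_mem

theorem hasDerivWithinAt_snd_halfPlane (hG : ContDiffOn ℝ ∞ G {p | 0 ≤ p.2}) (x : ℝ) {t : ℝ}
    (ht : 0 ≤ t) : HasDerivWithinAt (fun s => G (x, s))
      (fderivWithin ℝ G {p | 0 ≤ p.2} (x, t) (0, 1)) (Set.Ici 0) t := by
  have h1 : HasDerivWithinAt (fun s : ℝ => ((x, s) : ℝ × ℝ)) (0, 1) (Set.Ici 0) t :=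
    ((hasDerivAt_const t x).prodMk (hasDerivAt_id t)).hasDerivWithinAt
  exact (hasFDerivWithinAt_halfPlane hG (p := (x, t)) ht).comp_hasDerivWithinAt t h1
    (fun s hs => hs)

theorem contDiffOn_fderivWithin_halfPlane (hG : ContDiffOn ℝ ∞ G {p | 0 ≤ p.2}) (v : ℝ × ℝ) :
    ContDiffOn ℝ ∞ (fun p => fderivWithin ℝ G {p | 0 ≤ p.2} p v) {p | 0 ≤ p.2} :=
  (hG.fderivWithin uniqueDiffOn_halfPlane (m := ∞) (by simp)).clm_apply contDiffOn_const

theorem contDiffOn_deriv_fst_halfPlane (hG : ContDiffOn ℝ ∞ G {p | 0 ≤ p.2}) :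
    ContDiffOn ℝ ∞ (fun p : ℝ × ℝ => deriv (fun x' => G (x', p.2)) p.1) {p | 0 ≤ p.2} :=
  (contDiffOn_fderivWithin_halfPlane hG (1, 0)).congr fun p hp =>
    (hasDerivAt_fst_halfPlane hG p.1 hp).deriv

theorem deriv_snd_halfPlane (hG : ContDiffOn ℝ ∞ G {p | 0 ≤ p.2}) (x : ℝ) {t : ℝ} (ht : 0 < t) :
    deriv (fun s => G (x, s)) t = fderivWithin ℝ G {p | 0 ≤ p.2} (x, t) (0, 1) :=
  ((hasDerivWithinAt_snd_halfPlane hG x ht.le).hasDerivAt (Ici_mem_nhds ht)).deriv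

theorem hasDerivAt_clm_comp_apply {E F : Type*} [NormedAddCommGroup E] [NormedSpace ℝ E]
    [NormedAddCommGroup F] [NormedSpace ℝ F] {Φ : E → E →L[ℝ] F} {γ : ℝ → E} {γ' : E} {s : ℝ}
    {Φ' : E →L[ℝ] E →L[ℝ] F} (hΦ : HasFDerivAt Φ Φ' (γ s)) (hγ : HasDerivAt γ γ' s) (v : E) :
    HasDerivAt (fun s => Φ (γ s) v) (Φ' γ' v) s :=
  (ContinuousLinearMap.apply ℝ F v).hasFDerivAt.comp_hasDerivAt s (hΦ.comp_hasDerivAt s hγ)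

theorem deriv_comm_halfPlane (hG : ContDiffOn ℝ ∞ G {p | 0 ≤ p.2}) (x : ℝ) {t : ℝ} (ht : 0 < t) :
    deriv (fun s => deriv (fun x' => G (x', s)) x) t
      = deriv (fun x' => deriv (fun s => G (x', s)) t) x := by
  have hc : ContDiffAt ℝ ∞ G (x, t) := hG.contDiffAt (halfPlane_mem_nhds (p := (x, t)) ht)
  have hsymm := (hc.isSymmSndFDerivAt (by simp; exact ENat.LEInfty.out)).eq (1, 0) (0, 1)
  have hd : DifferentiableAt ℝ (fderiv ℝ G) (x, t) :=
    (hc.fderiv_right (m := 1) (by norm_num; exact ENat.LEInfty.out)).differentiableAt (by simp)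
  have hf : ∀ p : ℝ × ℝ, 0 < p.2 → fderivWithin ℝ G {p | 0 ≤ p.2} p = fderiv ℝ G p := fun p hp =>
    fderivWithin_of_mem_nhds (halfPlane_mem_nhds hp)
  have h1 : (fun s => deriv (fun x' => G (x', s)) x) =ᶠ[𝓝 t] fun s => fderiv ℝ G (x, s) (1, 0) := by
    filter_upwards [Ioi_mem_nhds ht] with s hs
    rw [(hasDerivAt_fst_halfPlane hG x (le_of_lt hs)).deriv, hf (x, s) hs]
  have h2 : (fun x' => deriv (fun s => G (x', s)) t) = fun x' => fderiv ℝ G (x', t) (0, 1) := by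
    ext x'
    rw [deriv_snd_halfPlane hG x' ht, hf (x', t) ht]
  have h3 : HasDerivAt (fun s : ℝ => ((x, s) : ℝ × ℝ)) (0, 1) t :=
    (hasDerivAt_const t x).prodMk (hasDerivAt_id t)
  have h4 : HasDerivAt (fun x' : ℝ => ((x', t) : ℝ × ℝ)) (1, 0) x :=
    (hasDerivAt_id x).prodMk (hasDerivAt_const x t)
  have h5 : HasDerivAt (fun s => fderiv ℝ G (x, s) (1, 0))
      (fderiv ℝ (fderiv ℝ G) (x, t) (0, 1) (1, 0)) t := by
    exact hasDerivAt_clm_comp_apply (γ := fun s => (x, s)) hd.hasFDerivAt h3 (1, 0)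
  have h6 : HasDerivAt (fun x' => fderiv ℝ G (x', t) (0, 1))
      (fderiv ℝ (fderiv ℝ G) (x, t) (1, 0) (0, 1)) x := by
    exact hasDerivAt_clm_comp_apply (γ := fun x' => (x', t)) hd.hasFDerivAt h4 (0, 1)
  rw [h1.deriv_eq, h2, h5.deriv, h6.deriv]
  exact hsymm.symm

end HalfPlane

/-- The `k`-th spatial derivative of `u` at `(x, t)`. -/
noncomputable def dx (u : ℝ → ℝ → ℝ) (k : ℕ) (x t : ℝ) : ℝ := iteratedDeriv k (fun x' => u x' t) x

theorem dx_zero (u : ℝ → ℝ → ℝ) (x t : ℝ) : dx u 0 x t = u x t := by simp [dx]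

theorem dx_succ (u : ℝ → ℝ → ℝ) (k : ℕ) (x t : ℝ) :
    dx u (k + 1) x t = deriv (fun x' => dx u k x' t) x := by
  simp only [dx, iteratedDeriv_succ]

/-! ### Solutions: the equation up to `t = 0`, uniform decay, positivity of `1 - u_xx` -/

namespace IsSolution

variable {u₀ : ℝ → ℝ} {u : ℝ → ℝ → ℝ} (hu : IsSolution u₀ u)
include hu

theorem contDiffOn_dx (k : ℕ) : ContDiffOn ℝ ∞ (fun p : ℝ × ℝ => dx u k p.1 p.2) {p | 0 ≤ p.2} := by
  induction k with
  | zero => simpa only [dx_zero] using hu.smooth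
  | succ k ih => simpa only [dx_succ] using contDiffOn_deriv_fst_halfPlane ih

theorem continuousOn_dx (k : ℕ) :
    ContinuousOn (fun p : ℝ × ℝ => dx u k p.1 p.2) {p | 0 ≤ p.2} := (hu.contDiffOn_dx k).continuousOn

theorem hasDerivAt_dx (k : ℕ) (x : ℝ) {t : ℝ} (ht : 0 ≤ t) :
    HasDerivAt (fun x' => dx u k x' t) (dx u (k + 1) x t) x := by
  rw [dx_succ]
  exact (hasDerivAt_fst_halfPlane (hu.contDiffOn_dx k) x ht).differentiableAt.hasDerivAt

theorem continuousOn_dx_snd (k : ℕ) (x : ℝ) : ContinuousOn (fun t => dx u k x t) (Set.Ici 0) :=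
  (hu.continuousOn_dx k).comp (f := fun t => ((x, t) : ℝ × ℝ)) (by fun_prop) (fun t ht => ht)

/-- The equation, solved for the time derivative of `u_xx`; it holds up to `t = 0`. -/
theorem hasDerivWithinAt_dx_two (x : ℝ) {t : ℝ} (ht : 0 ≤ t) :
    HasDerivWithinAt (fun s => dx u 2 x s)
      (3 * dx u 1 x t - 3 * dx u 1 x t * dx u 2 x t - dx u 0 x t * dx u 3 x t) (Set.Ici 0) t := by
  have hG := hu.contDiffOn_dx 2
  have hd := fun t ht => hasDerivWithinAt_snd_halfPlane hG x (t := t) ht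
  set φ : ℝ → ℝ := fun t => fderivWithin ℝ (fun p : ℝ × ℝ => dx u 2 p.1 p.2) {p | 0 ≤ p.2} (x, t)
    (0, 1) with hφ
  set ψ : ℝ → ℝ := fun t =>
    3 * dx u 1 x t - 3 * dx u 1 x t * dx u 2 x t - dx u 0 x t * dx u 3 x t with hψ
  have hφc : ContinuousOn φ (Set.Ici 0) :=
    (contDiffOn_fderivWithin_halfPlane hG (0, 1)).continuousOn.comp
      (f := fun t => ((x, t) : ℝ × ℝ)) (by fun_prop) (fun t ht => ht)
  have hψc : ContinuousOn ψ (Set.Ici 0) := by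
    have h0 := hu.continuousOn_dx_snd 0 x
    have h1 := hu.continuousOn_dx_snd 1 x
    have h2 := hu.continuousOn_dx_snd 2 x
    have h3 := hu.continuousOn_dx_snd 3 x
    fun_prop
  have hpos : ∀ t, 0 < t → φ t = ψ t := by
    intro t ht
    have e1 : φ t = deriv (fun s => dx u 2 x s) t := (deriv_snd_halfPlane hG x ht).symm
    have e2 : deriv (fun s => dx u 2 x s) t
        = iteratedDeriv 2 (fun x' => deriv (fun s => u x' s) t) x := by
      have c1 := deriv_comm_halfPlane (hu.contDiffOn_dx 1) x ht
      have c0 := fun x => deriv_comm_halfPlane (hu.contDiffOn_dx 0) x ht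
      simp only [← dx_succ] at c0 c1
      rw [show (fun s => dx u 2 x s) = fun s => dx u (1 + 1) x s from rfl, c1]
      simp only [zero_add] at c0
      rw [iteratedDeriv_succ, iteratedDeriv_one]
      simp only [c0, dx_zero]
    have e3 := hu.eq x t ht
    rw [e1, e2, hψ]
    simp only [dx, ← iteratedDeriv_one] at e3 ⊢
    simp only [iteratedDeriv_zero]
    linarith
  -- The equation is given for `t > 0` only. Both sides are continuous on `[0, ∞)`, so it extends to
  -- `t = 0`.
  have hall : φ t = ψ t := by
    rcases ht.eq_or_lt with rfl | h
    · have h1 := (hφc 0 Set.self_mem_Ici).mono Set.Ioi_subset_Ici_self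
      have h2 := (hψc 0 Set.self_mem_Ici).mono Set.Ioi_subset_Ici_self
      refine tendsto_nhds_unique (f := φ) (l := 𝓝[>] 0) h1 (h2.congr' ?_)
      filter_upwards [self_mem_nhdsWithin] with s hs
      exact (hpos s hs).symm
    · exact hpos t h
  have h1 := hd t ht
  change HasDerivWithinAt _ (φ t) _ _ at h1
  rw [hall] at h1
  exact h1

theorem isDecaying {t : ℝ} (ht : 0 ≤ t) : IsDecaying fun x => u x t := by
  refine ⟨?_, ?_, fun k hk => ?_⟩
  · exact hu.smooth.comp_contDiff (f := fun x => ((x, t) : ℝ × ℝ)) (by fun_prop) (fun _ => ht)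
  · rw [Metric.tendsto_nhds]
    intro ε hε
    obtain ⟨R, hR⟩ := hu.tendsto_zero t (ε / 2) (half_pos hε)
    have : ∀ᶠ x : ℝ in cocompact ℝ, R ≤ |x| :=
      (tendsto_norm_cocompact_atTop (E := ℝ)).eventually_ge_atTop R
    filter_upwards [this] with x hx
    rw [Real.dist_eq, sub_zero]
    exact (hR t ⟨ht, le_rfl⟩ x hx).trans_lt (half_lt_self hε)
  · obtain ⟨g, hg, hb⟩ := hu.dominated t
    refine hg.mono' (Continuous.aestronglyMeasurable ?_) (Eventually.of_forall fun x =>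
      hb t ⟨ht, le_rfl⟩ k hk x)
    exact continuous_iff_continuousAt.2 fun x => (hu.hasDerivAt_dx k x ht).continuousAt

/-- For `k = 1, 2, 3` the derivative is the integral of the next one from the nearer infinity, hence
is bounded by a tail of the dominating function. That tail does not depend on `t`. -/
theorem uniform_decay (T : ℝ) {k : ℕ} (hk : k ≤ 3) {ε : ℝ} (hε : 0 < ε) :
    ∃ R : ℝ, ∀ t ∈ Set.Icc 0 T, ∀ x, R ≤ |x| → |dx u k x t| ≤ ε := by
  rcases Nat.eq_zero_or_pos k with rfl | hk0
  · simpa only [dx_zero] using hu.tendsto_zero T ε hε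
  obtain ⟨g, hg, hb⟩ := hu.dominated T
  have h1 := (tendsto_integral_Ioi_atTop hg).eventually_le_const hε
  have h2 := (tendsto_integral_Iic_atBot hg).eventually_le_const hε
  obtain ⟨a, ha⟩ := eventually_atTop.1 h1
  obtain ⟨b, hb'⟩ := eventually_atBot.1 h2
  have hmem : k + 1 ∈ Finset.Icc 2 4 := by simp; omega
  refine ⟨max a (max (-b) 0) + 1, fun t ht x hx => ?_⟩
  have hdec := hu.isDecaying ht.1
  have hm1 := le_max_left a (max (-b) 0)
  have hm2 := (le_max_left (-b) 0).trans (le_max_right a (max (-b) 0))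
  have hm3 := (le_max_right (-b) 0).trans (le_max_right a (max (-b) 0))
  rcases le_or_gt 0 x with h0 | h0
  · rw [abs_of_nonneg h0] at hx
    exact (abs_le_integral_Ioi_of_tendsto_zero (hdec.hasDerivAt k) (hdec.integrable _ hmem) hg
      (hb t ht _ hmem) (hdec.tendsto_atTop hk) x).trans (ha x (by linarith))
  · rw [abs_of_neg h0] at hx
    exact (abs_le_integral_Iic_of_tendsto_zero (hdec.hasDerivAt k) (hdec.integrable _ hmem) hg
      (hb t ht _ hmem) (hdec.tendsto_atBot hk) x).trans (hb' x (by linarith))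

theorem exists_bound_dx (T : ℝ) {k : ℕ} (hk : k ≤ 3) :
    ∃ K : ℝ, 0 ≤ K ∧ ∀ t ∈ Set.Icc 0 T, ∀ x, |dx u k x t| ≤ K := by
  obtain ⟨R, hR⟩ := hu.uniform_decay T hk one_pos
  have hc : IsCompact (Set.Icc (-R) R ×ˢ Set.Icc (0 : ℝ) T) := isCompact_Icc.prod isCompact_Icc
  obtain ⟨C, hC⟩ := hc.exists_bound_of_continuousOn
    ((hu.continuousOn_dx k).mono fun p hp => hp.2.1)
  refine ⟨max C 1, zero_le_one.trans (le_max_right _ _), fun t ht x => ?_⟩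
  rcases le_or_gt R |x| with hx | hx
  · exact (hR t ht x hx).trans (le_max_right _ _)
  · exact (hC (x, t) ⟨⟨(abs_lt.1 hx).1.le, (abs_lt.1 hx).2.le⟩, ht⟩).trans (le_max_left _ _)

/-- A minimum principle. The function `m = 1 - u_xx` satisfies `m_t + u m_x = -3 u_x m`. With `|u_x|
≤ C`, put `n = exp ((3C + 1) t) m`. If `n` first reaches a small level `c > 0` at time `t'`, then it
has a spatial minimum there, so `m_x = 0` and `n_t = (3C + 1 - 3u_x) c > 0`. But `n` came down to
`c` from above, so `n_t ≤ 0`. -/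
theorem isInitialDatum (hu₀ : IsInitialDatum u₀) {T : ℝ} (hT : 0 ≤ T) :
    IsInitialDatum fun x => u x T := by
  have hdec := hu.isDecaying hT
  refine ⟨hdec.smooth, hdec.tendsto_zero, hdec.integrable, fun x₁ => ?_⟩
  obtain ⟨C, hC0, hC⟩ := hu.exists_bound_dx T (k := 1) (by norm_num)
  obtain ⟨R, hR⟩ := hu.uniform_decay T (k := 2) (by norm_num) (ε := 1 / 4) (by norm_num)
  obtain ⟨c₀, hc₀, hc₀'⟩ := hu₀.exists_le_mOf
  -- The level lies below the infimum at `t = 0` and below `3/4`, which bounds `n` from below for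
  -- large `|x|`. The contact set is therefore compact and avoids `t = 0`.
  set c := min (c₀ / 2) (1 / 2) with hc
  have hcpos : 0 < c := lt_min (by linarith) (by norm_num)
  set n : ℝ → ℝ → ℝ := fun x t => Real.exp ((3 * C + 1) * t) * (1 - dx u 2 x t) with hn
  have hexp : ∀ t, 0 ≤ t → 1 ≤ Real.exp ((3 * C + 1) * t) := fun t ht =>
    Real.one_le_exp (by positivity)
  suffices H : ∀ t ∈ Set.Icc 0 T, ∀ x, c < n x t by
    have h1 := H T ⟨hT, le_rfl⟩ x₁
    have h2 : 0 < n x₁ T := hcpos.trans h1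
    exact (mul_pos_iff_of_pos_left (Real.exp_pos _)).1 h2
  by_contra! hex
  obtain ⟨t₁, ht₁, x₁', hx₁⟩ := hex
  have hfar : ∀ t ∈ Set.Icc 0 T, ∀ x, R ≤ |x| → c < n x t := by
    intro t ht x hx
    have h1 := (abs_le.1 (hR t ht x hx)).2
    have h2 := hexp t ht.1
    have h3 : c ≤ 1 / 2 := min_le_right _ _
    have : 1 * (3 / 4) ≤ n x t := mul_le_mul h2 (by linarith) (by norm_num) (by positivity)
    linarith
  have hcont : ContinuousOn (fun p : ℝ × ℝ => n p.1 p.2) {p | 0 ≤ p.2} := by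
    have := hu.continuousOn_dx 2
    fun_prop
  set K := (Set.Icc (-R) R ×ˢ Set.Icc (0 : ℝ) T) ∩ (fun p : ℝ × ℝ => n p.1 p.2) ⁻¹' Set.Iic c
    with hK
  have hKmem : ∀ x t, t ∈ Set.Icc 0 T → n x t ≤ c → (x, t) ∈ K := fun x t ht h => by
    have : |x| < R := by
      by_contra! hx
      exact (hfar t ht x hx).not_ge h
    exact ⟨⟨⟨(abs_lt.1 this).1.le, (abs_lt.1 this).2.le⟩, ht⟩, h⟩
  have hKc : IsCompact K := by
    refine (isCompact_Icc.prod isCompact_Icc).of_isClosed_subset ?_ Set.inter_subset_left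
    exact ContinuousOn.preimage_isClosed_of_isClosed (hcont.mono fun p hp => hp.2.1)
      (isClosed_Icc.prod isClosed_Icc) isClosed_Iic
  -- The earliest contact exists because time attains its minimum on the compact contact set.
  obtain ⟨⟨x', t'⟩, hp, hmin⟩ := hKc.exists_isMinOn ⟨_, hKmem _ _ ht₁ hx₁⟩ continuous_snd.continuousOn
  have ht' : t' ∈ Set.Icc 0 T := hp.1.2
  have hle : n x' t' ≤ c := hp.2
  have hbefore : ∀ t, 0 ≤ t → t < t' → ∀ x, c < n x t := by
    intro t ht htt x
    by_contra! h
    have := hmin (hKmem x t ⟨ht, htt.le.trans ht'.2⟩ h)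
    exact absurd htt (not_lt.2 this)
  have hcz : c < c₀ := (min_le_left _ _).trans_lt (by linarith)
  have ht'0 : 0 < t' := by
    refine lt_of_le_of_ne ht'.1 fun h0 => ?_
    rw [← h0] at hle
    have h1 := hc₀' x'
    have h2 : n x' 0 = mOf u₀ x' := by
      have : (fun x' => u x' 0) = u₀ := funext hu.initial
      simp [hn, dx, mOf, this]
    linarith
  have hge : ∀ x, c ≤ n x t' := by
    intro x
    have h1 : ContinuousOn (fun t => n x t) (Set.Ici 0) :=
      hcont.comp (f := fun t => ((x, t) : ℝ × ℝ)) (by fun_prop) (fun t ht => ht)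
    have h2 : Tendsto (fun t => n x t) (𝓝[<] t') (𝓝 (n x t')) :=
      (h1.continuousAt (Ici_mem_nhds ht'0)).tendsto.mono_left nhdsWithin_le_nhds
    refine ge_of_tendsto h2 ?_
    filter_upwards [Ioo_mem_nhdsLT ht'0] with t ht
    exact (hbefore t ht.1.le ht.2 x).le
  have heq : n x' t' = c := le_antisymm hle (hge x')
  have hx0 : dx u 3 x' t' = 0 := by
    have h1 : HasDerivAt (fun x => n x t') (Real.exp ((3 * C + 1) * t') * (-dx u 3 x' t')) x' :=
      ((hu.hasDerivAt_dx 2 x' ht'0.le).const_sub 1).const_mul _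
    have h2 : IsLocalMin (fun x => n x t') x' := Eventually.of_forall fun x => by
      simp only [heq]; exact hge x
    have h3 := h2.hasDerivAt_eq_zero h1
    have := (Real.exp_pos ((3 * C + 1) * t')).ne'
    simpa [this] using h3
  have htd : HasDerivAt (fun t => n x' t) ((3 * C + 1 - 3 * dx u 1 x' t') * c) t' := by
    have h1 := (hu.hasDerivWithinAt_dx_two x' ht'0.le).hasDerivAt (Ici_mem_nhds ht'0)
    have h2 : HasDerivAt (fun t => Real.exp ((3 * C + 1) * t))
        (Real.exp ((3 * C + 1) * t') * (3 * C + 1)) t' := by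
      simpa using ((hasDerivAt_id t').const_mul (3 * C + 1)).exp
    convert! h2.mul (h1.const_sub 1) using 1
    rw [← heq, hx0, hn]
    simp only
    ring
  have hpos : 0 < (3 * C + 1 - 3 * dx u 1 x' t') * c := by
    have := (abs_le.1 (hC t' ht' x')).2
    exact mul_pos (by linarith) hcpos
  have hslope := (hasDerivAt_iff_tendsto_slope.1 htd).mono_left
    (nhdsWithin_mono t' (fun t (ht : t < t') => ne_of_lt ht) : 𝓝[<] t' ≤ 𝓝[≠] t')
  have hle0 : (3 * C + 1 - 3 * dx u 1 x' t') * c ≤ 0 := by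
    refine le_of_tendsto hslope ?_
    filter_upwards [Ioo_mem_nhdsLT ht'0] with t ht
    rw [slope_def_field, heq]
    exact div_nonpos_of_nonneg_of_nonpos (sub_nonneg.2 (hbefore t ht.1.le ht.2 x').le)
      (sub_nonpos.2 ht.2.le)
  linarith

end IsSolution

/-! ### Fundamental solutions as differentiable functions of a parameter -/

section LinearODEParameter

variable {𝕜 R : Type*} [RCLike 𝕜] [NormedRing R] [NormedAlgebra ℝ R] [CompleteSpace R] [NormedAlgebra 𝕜 R]
  [IsScalarTower ℝ 𝕜 R]

/-- The derivative in the parameter is the solution of the variational equation. Its initial value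
is `0`, as the initial value of `Y` is the same for all parameters. -/
theorem differentiableAt_linearODE_of_nonneg {U : Set 𝕜} (hU : IsOpen U) {a a' : 𝕜 → ℝ → R}
    {Y : 𝕜 → ℝ → R} (ha : ∀ p ∈ U, ∀ t, HasDerivAt (fun p => a p t) (a' p t) p)
    (hac : ContinuousOn (fun x : 𝕜 × ℝ => a x.1 x.2) (U ×ˢ Set.univ))
    (hac' : ContinuousOn (fun x : 𝕜 × ℝ => a' x.1 x.2) (U ×ˢ Set.univ))
    (hY : ∀ p ∈ U, ∀ t, HasDerivAt (Y p) (a p t * Y p t) t) (h0 : ∀ p ∈ U, Y p 0 = 1)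
    {p₀ : 𝕜} (hp₀ : p₀ ∈ U) {T : ℝ} (hT : 0 ≤ T) : DifferentiableAt 𝕜 (fun p => Y p T) p₀ := by
  obtain ⟨r, hr, hrU⟩ := Metric.nhds_basis_closedBall.mem_iff.1 (hU.mem_nhds hp₀)
  have hsub : Metric.closedBall p₀ r ×ˢ Set.Icc 0 T ⊆ U ×ˢ Set.univ := fun x hx => ⟨hrU hx.1, trivial⟩
  have hline : ∀ {f : 𝕜 → ℝ → R}, ContinuousOn (fun x : 𝕜 × ℝ => f x.1 x.2) (U ×ˢ Set.univ) →
      Continuous (f p₀) := fun {f} hf => by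
    have := hf.comp (f := fun t : ℝ => ((p₀, t) : 𝕜 × ℝ)) (s := Set.univ) (by fun_prop)
      (fun t _ => ⟨hp₀, trivial⟩)
    exact continuousOn_univ.1 this
  have hYc : Continuous (Y p₀) := continuous_iff_continuousAt.2 fun t => (hY p₀ hp₀ t).continuousAt
  obtain ⟨Z, hZ0, hZ⟩ := exists_linearODE (g := fun t => a' p₀ t * Y p₀ t) (hline hac)
    ((hline hac').mul hYc) 0
  refine (hasDerivAt_linearODE_param (Z := Z) hr hT (fun p hp t _ => ha p (hrU hp) t)
    (hac.mono hsub) (hac'.mono hsub) (fun p hp t _ => (hY p (hrU hp) t).hasDerivWithinAt)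
    (fun t _ => (hZ t).hasDerivWithinAt) ?_).differentiableAt
  rw [hZ0]
  refine (hasDerivAt_const p₀ (1 : R)).congr_of_eventuallyEq ?_
  filter_upwards [hU.mem_nhds hp₀] with p hp using h0 p hp

theorem differentiableAt_linearODE {U : Set 𝕜} (hU : IsOpen U) {a a' : 𝕜 → ℝ → R}
    {Y : 𝕜 → ℝ → R} (ha : ∀ p ∈ U, ∀ t, HasDerivAt (fun p => a p t) (a' p t) p)
    (hac : ContinuousOn (fun x : 𝕜 × ℝ => a x.1 x.2) (U ×ˢ Set.univ))
    (hac' : ContinuousOn (fun x : 𝕜 × ℝ => a' x.1 x.2) (U ×ˢ Set.univ))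
    (hY : ∀ p ∈ U, ∀ t, HasDerivAt (Y p) (a p t * Y p t) t) (h0 : ∀ p ∈ U, Y p 0 = 1)
    {p₀ : 𝕜} (hp₀ : p₀ ∈ U) (T : ℝ) : DifferentiableAt 𝕜 (fun p => Y p T) p₀ := by
  rcases le_total 0 T with hT | hT
  · exact differentiableAt_linearODE_of_nonneg hU ha hac hac' hY h0 hp₀ hT
  have hrefl : ∀ {f : 𝕜 → ℝ → R}, ContinuousOn (fun x : 𝕜 × ℝ => f x.1 x.2) (U ×ˢ Set.univ) →
      ContinuousOn (fun x : 𝕜 × ℝ => -f x.1 (-x.2)) (U ×ˢ Set.univ) := fun {f} hf =>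
    (hf.comp (f := fun x : 𝕜 × ℝ => ((x.1, -x.2) : 𝕜 × ℝ)) (by fun_prop)
      (fun x hx => ⟨hx.1, trivial⟩)).neg
  have := differentiableAt_linearODE_of_nonneg hU (a := fun p t => -a p (-t))
    (a' := fun p t => -a' p (-t)) (Y := fun p t => Y p (-t)) (fun p hp t => (ha p hp (-t)).neg)
    (hrefl hac) (hrefl hac') (fun p hp t => by
      have := (hY p hp (-t)).scomp t (hasDerivAt_neg t)
      convert! this using 1
      simp) (fun p hp => by simpa using h0 p hp) hp₀ (neg_nonneg.2 hT)
  simpa using this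

end LinearODEParameter

/-! ### The Lax pair, its compatibility, and its fundamental solutions -/

section LaxPair

/-- The commutator part of the `t`-equation. -/
noncomputable def kMat : Mat := Matrix.of fun j l => (1 - lam 1 j * lam 1 l ^ 2) / 3

/-- `Λ(1)⁻¹`. -/
noncomputable def lamInvMat : Mat := Matrix.diagonal fun j => lam 1 j ^ 2

theorem lam_inv (z : ℂ) (j : Fin 3) : (lam z j)⁻¹ = z⁻¹ * lam 1 j ^ 2 := by
  have h : lam 1 j ^ 3 = 1 := by rw [lam_cube, one_pow]
  have h0 : lam 1 j ≠ 0 := lam_ne_zero one_ne_zero j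
  rw [lam_eq_mul, mul_inv]
  congr 1
  field_simp
  exact h.symm

theorem lamMat_mul_lamInvMat : lamMat 1 * lamInvMat = 1 := by
  rw [lamMat, lamInvMat, Matrix.diagonal_mul_diagonal, ← Matrix.diagonal_one]
  congr 1; ext j
  have h : lam 1 j ^ 3 = 1 := by rw [lam_cube, one_pow]
  linear_combination h

theorem lamInvMat_mul_lamMat : lamInvMat * lamMat 1 = 1 := by
  rw [lamMat, lamInvMat, Matrix.diagonal_mul_diagonal, ← Matrix.diagonal_one]
  congr 1; ext j
  have h : lam 1 j ^ 3 = 1 := by rw [lam_cube, one_pow]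
  linear_combination h

theorem lamMat_mul_kMat : lamMat 1 * kMat = kMat * lamMat 1 + lamOnes 1 - lamMat 1 := by
  have h0 := omega_sq_add
  ext j k
  fin_cases j <;> fin_cases k <;>
    simp [kMat, lamMat, lamOnes, Matrix.mul_apply,
      lam_zero, lam_one, lam_two, Matrix.diagonal] <;> grind

theorem lamOnes_mul_kMat : lamOnes 1 * kMat = kMat * lamOnes 1 + (2 : ℂ) • lamOnes 1 := by
  have h0 := omega_sq_add
  ext j k
  fin_cases j <;> fin_cases k <;>
    simp [kMat, lamOnes, Matrix.mul_apply, Fin.sum_univ_three,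
      lam_zero, lam_one, lam_two] <;> grind

theorem lamOnes_mul_lamInvMat :
    lamOnes 1 * lamInvMat = lamInvMat * lamOnes 1 - (3 : ℂ) • kMat := by
  have h0 := omega_sq_add
  ext j k
  fin_cases j <;> fin_cases k <;>
    simp [kMat, lamInvMat, lamOnes, Matrix.mul_apply,
      lam_zero, lam_one, lam_two, Matrix.diagonal] <;> grind

/-- This is `A_t + AB = B_x + BA`, with the time derivative of `u_xx` already eliminated by the
differential equation. The term `-u₀ A` of `B` commutes with `A`, so only the commutators with `Λ⁻¹`
and `kMat` matter. The first yields `u_xx • kMat`, the second lies in the span of `Λ` and `Λ 1 1ᵀ`.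
-/
theorem zero_curvature {z : ℂ} (hz : z ≠ 0) (u₀ u₁ u₂ u₃ : ℂ) (A B : Mat)
    (hA : A = z • (lamMat 1 + (-u₂ / 3) • lamOnes 1))
    (hB : B = z⁻¹ • lamInvMat + u₁ • kMat - u₀ • A) :
    z • ((-(3 * u₁ - 3 * u₁ * u₂ - u₀ * u₃) / 3) • lamOnes 1) + A * B
      = B * A + (u₂ • kMat - (u₁ • A + u₀ • z • ((-u₃ / 3) • lamOnes 1))) := by
  have e1 : A * B - B * A = (A * z⁻¹ • lamInvMat - z⁻¹ • lamInvMat * A)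
      + u₁ • (A * kMat - kMat * A) := by
    rw [hB]
    simp only [mul_add, add_mul, mul_sub, sub_mul, mul_smul_comm, smul_mul_assoc, smul_sub]
    abel
  have e2 : A * z⁻¹ • lamInvMat - z⁻¹ • lamInvMat * A = u₂ • kMat := by
    rw [hA]
    simp only [mul_add, add_mul, mul_smul_comm, smul_mul_assoc, lamMat_mul_lamInvMat,
      lamInvMat_mul_lamMat, lamOnes_mul_lamInvMat, smul_smul, smul_add, smul_sub]
    have h1 : z * z⁻¹ = 1 := mul_inv_cancel₀ hz
    have h2 : z⁻¹ * z = 1 := inv_mul_cancel₀ hz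
    match_scalars <;> field_simp <;> ring
  have e3 : A * kMat - kMat * A
      = z • (lamOnes 1 - lamMat 1 + (-u₂ / 3) • (2 : ℂ) • lamOnes 1) := by
    rw [hA]
    simp only [mul_add, add_mul, mul_smul_comm, smul_mul_assoc, lamMat_mul_kMat, lamOnes_mul_kMat]
    module
  have e4 : A * B = B * A + (A * B - B * A) := by abel
  rw [e4, e1, e2, e3, hA]
  module

/-- `Λ(1) - (w''/3) Λ(1) 1 1ᵀ`. -/
noncomputable def potA (w : ℝ → ℝ) (x : ℝ) : Mat :=
  lamMat 1 + ((-iteratedDeriv 2 w x / 3 : ℝ) : ℂ) • lamOnes 1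

theorem lamMat_eq_smul (z : ℂ) : lamMat z = z • lamMat 1 := by
  rw [lamMat, lamMat, ← Matrix.diagonal_smul]
  congr 1; ext j; simp [lam_eq_mul z]

theorem lamOnes_eq_smul (z : ℂ) : lamOnes z = z • lamOnes 1 := by
  ext j k; simp [lamOnes, lam_eq_mul z]

theorem smul_potA (w : ℝ → ℝ) (z : ℂ) (x : ℝ) : z • potA w x = lamMat z + zeroPot w z x := by
  rw [potA, zeroPot, lamMat_eq_smul z, lamOnes_eq_smul z, smul_add, smul_comm]

/-- The coefficient of the `t`-equation. -/
noncomputable def bMat (u : ℝ → ℝ → ℝ) (z : ℂ) (x t : ℝ) : Mat :=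
  z⁻¹ • lamInvMat + ((dx u 1 x t : ℝ) : ℂ) • kMat
    - ((dx u 0 x t : ℝ) : ℂ) • z • potA (fun x' => u x' t) x

attribute [local instance] Matrix.linftyOpNormedRing Matrix.linftyOpNormedAlgebra

theorem norm_entry_le_norm (A : Mat) (i j : Fin 3) : ‖A i j‖ ≤ ‖A‖ := by
  rw [Matrix.linfty_opNorm_def]
  exact_mod_cast (Finset.single_le_sum (f := fun j => ‖A i j‖₊) (fun _ _ => zero_le)
    (Finset.mem_univ j)).trans (Finset.le_sup (f := fun i => ∑ j, ‖A i j‖₊) (Finset.mem_univ i))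

theorem norm_le_of_entry_le {A : Mat} {c : ℝ} (h : ∀ i j, ‖A i j‖ ≤ c) : ‖A‖ ≤ 3 * c := by
  have hc : 0 ≤ c := (norm_nonneg _).trans (h 0 0)
  lift c to NNReal using hc
  rw [Matrix.linfty_opNorm_def]
  have : Finset.univ.sup (fun i => ∑ j, ‖A i j‖₊) ≤ 3 * c := Finset.sup_le fun i _ => by
    refine (Finset.sum_le_card_nsmul _ _ c fun j _ => ?_).trans (by simp)
    exact_mod_cast h i j
  exact_mod_cast this

theorem hasDerivAt_matrix {f : ℝ → Mat} {f' : Mat} {x : ℝ} :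
    HasDerivAt f f' x ↔ ∀ i j, HasDerivAt (fun x => f x i j) (f' i j) x :=
  ⟨fun h i j => hasDerivAt_pi.1 (hasDerivAt_pi.1 h i) j,
    fun h => hasDerivAt_pi.2 fun i => hasDerivAt_pi.2 fun j => h i j⟩

theorem hasDerivWithinAt_matrix {f : ℝ → Mat} {f' : Mat} {x : ℝ} {s : Set ℝ} :
    HasDerivWithinAt f f' s x ↔ ∀ i j, HasDerivWithinAt (fun x => f x i j) (f' i j) s x :=
  ⟨fun h i j => hasDerivWithinAt_pi.1 (hasDerivWithinAt_pi.1 h i) j,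
    fun h => hasDerivWithinAt_pi.2 fun i => hasDerivWithinAt_pi.2 fun j => h i j⟩

theorem differentiableAt_matrix {f : ℂ → Mat} {x : ℂ} :
    DifferentiableAt ℂ f x ↔ ∀ i j, DifferentiableAt ℂ (fun x => f x i j) x :=
  ⟨fun h i j => differentiableAt_pi.1 (differentiableAt_pi.1 h i) j,
    fun h => differentiableAt_pi.2 fun i => differentiableAt_pi.2 fun j => h i j⟩

/-- The fundamental solution of the `x`-equation for the profile `w`. -/
noncomputable def spaceMat (w : ℝ → ℝ) (z : ℂ) : ℝ → Mat :=
  Classical.epsilon fun Y : ℝ → Mat => Y 0 = 1 ∧ ∀ x, HasDerivAt Y (z • potA w x * Y x) x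

/-- The fundamental solution of the `t`-equation at `x`. -/
noncomputable def timeMat (u : ℝ → ℝ → ℝ) (z : ℂ) (x : ℝ) : ℝ → Mat :=
  Classical.epsilon fun Y : ℝ → Mat =>
    -- For `t < 0` the coefficient is frozen at its value at `t = 0`, so that the equation makes
    -- sense on the whole line.
    Y 0 = 1 ∧ ∀ t, HasDerivAt Y (bMat u z x (max t 0) * Y t) t

namespace IsDecaying

variable {w : ℝ → ℝ} (h : IsDecaying w)
include h

theorem continuous_potA : Continuous (potA w) := by
  have := h.continuous_iteratedDeriv 2
  unfold potA
  fun_prop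

theorem spaceMat_spec (z : ℂ) : spaceMat w z 0 = 1 ∧
    ∀ x, HasDerivAt (spaceMat w z) (z • potA w x * spaceMat w z x) x := by
  refine Classical.epsilon_spec (p := fun Y : ℝ → Mat => Y 0 = 1 ∧ ∀ x,
    HasDerivAt Y (z • potA w x * Y x) x) ?_
  obtain ⟨Y, h0, hY⟩ := exists_linearODE (R := Mat) (a := fun x => z • potA w x) (g := fun _ => 0)
    (h.continuous_potA.const_smul z) continuous_const 1
  refine ⟨Y, h0, fun x => ?_⟩
  have := hY x
  rw [add_zero] at this
  exact this

theorem differentiable_spaceMat (x : ℝ) : Differentiable ℂ fun z => spaceMat w z x := by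
  intro z
  have hc := h.continuous_potA
  refine differentiableAt_linearODE (R := Mat) isOpen_univ (a := fun z x => z • potA w x)
    (a' := fun _ x => potA w x) (fun z _ x => ?_) ?_ ?_ (fun z _ => (h.spaceMat_spec z).2)
    (fun z _ => (h.spaceMat_spec z).1) (Set.mem_univ z) x
  · simpa using (hasDerivAt_id z).smul_const (potA w x)
  · fun_prop
  · fun_prop

end IsDecaying

namespace IsSolution

variable {u₀ : ℝ → ℝ} {u : ℝ → ℝ → ℝ} (hu : IsSolution u₀ u)
include hu

theorem continuous_dx_max (k : ℕ) : Continuous fun p : ℝ × ℝ => dx u k p.1 (max p.2 0) :=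
  continuousOn_univ.1 ((hu.continuousOn_dx k).comp
    (f := fun p : ℝ × ℝ => ((p.1, max p.2 0) : ℝ × ℝ)) (by fun_prop)
    (fun p _ => (le_max_right p.2 0 : (0 : ℝ) ≤ max p.2 0)))

theorem continuous_potA_max :
    Continuous fun p : ℝ × ℝ => potA (fun x' => u x' (max p.2 0)) p.1 := by
  have := hu.continuous_dx_max 2
  unfold dx at this
  unfold potA
  fun_prop

theorem timeMat_spec (z : ℂ) (x : ℝ) : timeMat u z x 0 = 1 ∧
    ∀ t, HasDerivAt (timeMat u z x) (bMat u z x (max t 0) * timeMat u z x t) t := by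
  refine Classical.epsilon_spec (p := fun Y : ℝ → Mat => Y 0 = 1 ∧ ∀ t,
    HasDerivAt Y (bMat u z x (max t 0) * Y t) t) ?_
  have h0 := (hu.continuous_dx_max 0).comp (Continuous.prodMk_right x)
  have h1 := (hu.continuous_dx_max 1).comp (Continuous.prodMk_right x)
  have h2 := hu.continuous_potA_max.comp (Continuous.prodMk_right x)
  simp only [Function.comp_def] at h0 h1 h2
  obtain ⟨Y, h0, hY⟩ := exists_linearODE (R := Mat) (a := fun t => bMat u z x (max t 0))
    (g := fun _ => 0) (by unfold bMat; fun_prop) continuous_const 1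
  refine ⟨Y, h0, fun x => ?_⟩
  have := hY x
  rw [add_zero] at this
  exact this

/-- The coefficient contains `z⁻¹`, which excludes the origin. The behaviour at `z = 0` has to come
from the estimates for normalized solutions instead. -/
theorem differentiableAt_timeMat {z : ℂ} (hz : z ≠ 0) (x T : ℝ) :
    DifferentiableAt ℂ (fun z => timeMat u z x T) z := by
  have h0 := (hu.continuous_dx_max 0).comp (Continuous.prodMk_right x)
  have h1 := (hu.continuous_dx_max 1).comp (Continuous.prodMk_right x)
  have h2 := hu.continuous_potA_max.comp (Continuous.prodMk_right x)
  simp only [Function.comp_def] at h0 h1 h2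
  have hinv : ContinuousOn (fun p : ℂ × ℝ => p.1⁻¹) ({0}ᶜ ×ˢ Set.univ) :=
    ContinuousOn.inv₀ (by fun_prop) (fun p hp => hp.1)
  have c0 : Continuous fun p : ℂ × ℝ => ((dx u 0 x (max p.2 0) : ℝ) : ℂ) :=
    Complex.continuous_ofReal.comp (h0.comp continuous_snd)
  have c1 : Continuous fun p : ℂ × ℝ => ((dx u 1 x (max p.2 0) : ℝ) : ℂ) :=
    Complex.continuous_ofReal.comp (h1.comp continuous_snd)
  have c2 : Continuous fun p : ℂ × ℝ => potA (fun x' => u x' (max p.2 0)) x :=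
    h2.comp continuous_snd
  refine differentiableAt_linearODE (R := Mat) isOpen_compl_singleton
    (a := fun z t => bMat u z x (max t 0))
    (a' := fun z t => (-(z ^ 2)⁻¹) • lamInvMat
      - ((dx u 0 x (max t 0) : ℝ) : ℂ) • potA (fun x' => u x' (max t 0)) x)
    (fun z hz t => ?_) ?_ ?_ (fun z _ => (hu.timeMat_spec z x).2)
    (fun z _ => (hu.timeMat_spec z x).1) (show z ∈ ({0} : Set ℂ)ᶜ from hz) T
  · have d1 := (hasDerivAt_inv (show z ≠ 0 from hz)).smul_const lamInvMat
    have d2 := ((hasDerivAt_id z).smul_const (potA (fun x' => u x' (max t 0)) x)).const_smul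
      ((dx u 0 x (max t 0) : ℝ) : ℂ)
    have d3 := (d1.add_const (((dx u 1 x (max t 0) : ℝ) : ℂ) • kMat)).sub d2
    simp only [one_smul] at d3
    exact d3
  · unfold bMat
    exact ((hinv.smul continuousOn_const).add (c1.smul continuous_const).continuousOn).sub
      (c0.smul (continuous_fst.smul c2)).continuousOn
  · have : ContinuousOn (fun p : ℂ × ℝ => (p.1 ^ 2)⁻¹) ({0}ᶜ ×ˢ Set.univ) :=
      ContinuousOn.inv₀ (by fun_prop) (fun p hp => pow_ne_zero 2 hp.1)
    exact (this.neg.smul continuousOn_const).sub (c0.smul c2).continuousOn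

end IsSolution

end LaxPair

/-! ### Evolution in time of the normalized solutions -/

section Evolution

attribute [local instance] Matrix.linftyOpNormedRing Matrix.linftyOpNormedAlgebra

theorem tendsto_zero_of_le_add_mul {F : Filter ℝ} {g h : ℝ → ℝ} {A E : ℝ} (hA : 0 ≤ A) (hE : 0 ≤ E)
    (hg : ∀ x, 0 ≤ g x) (hh : Tendsto h F (𝓝 0))
    (hgh : ∀ ε > 0, ∀ᶠ x in F, g x ≤ (h x + ε * A) * E) : Tendsto g F (𝓝 0) := by
  rw [Metric.tendsto_nhds]
  intro η hη
  have hδ : 0 < η / (2 * (A + 1) * (E + 1)) := by positivity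
  have hδ' : 0 < η / (2 * (E + 1)) := by positivity
  filter_upwards [hgh _ hδ, hh.eventually_lt_const hδ'] with x h1 h2
  rw [Real.dist_eq, sub_zero, abs_of_nonneg (hg x)]
  refine h1.trans_lt ?_
  have h3 : η / (2 * (A + 1) * (E + 1)) * A ≤ η / (2 * (E + 1)) := by
    rw [div_mul_eq_mul_div, div_le_div_iff₀ (by positivity) (by positivity)]
    have : 0 ≤ η * (2 * (E + 1)) := by positivity
    nlinarith
  calc (h x + η / (2 * (A + 1) * (E + 1)) * A) * E
      ≤ (η / (2 * (E + 1)) + η / (2 * (E + 1))) * E := by gcongr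
    _ = η * (E / (E + 1)) := by field_simp; ring
    _ < η * 1 := by
        gcongr
        rw [div_lt_one (by positivity)]; linarith
    _ = η := mul_one η

/-- The part of `bMat` that depends on `u`. -/
noncomputable def remMat (u : ℝ → ℝ → ℝ) (z : ℂ) (x t : ℝ) : Mat :=
  ((dx u 1 x t : ℝ) : ℂ) • kMat - ((dx u 0 x t : ℝ) : ℂ) • z • potA (fun x' => u x' t) x

theorem bMat_eq (u : ℝ → ℝ → ℝ) (z : ℂ) (x t : ℝ) :
    bMat u z x t = z⁻¹ • lamInvMat + remMat u z x t := by
  rw [bMat, remMat, add_sub_assoc]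

theorem bMat_mul_apply (u : ℝ → ℝ → ℝ) (z : ℂ) (x t : ℝ) (N : Mat) (j l : Fin 3) :
    (bMat u z x t * N) j l = (lam z j)⁻¹ * N j l + (remMat u z x t * N) j l := by
  rw [bMat_eq, add_mul, Matrix.add_apply, lam_inv]
  simp [lamInvMat, mul_assoc]

theorem hasDerivAt_mul_diagonal_exp {f : ℝ → Mat} {f' : Mat} {ν : Fin 3 → ℂ} {x : ℝ}
    (hf : HasDerivAt f f' x) : HasDerivAt
      (fun x : ℝ => f x * Matrix.diagonal fun l => Complex.exp (x * ν l))
      ((f' + f x * Matrix.diagonal ν) * Matrix.diagonal fun l => Complex.exp (x * ν l)) x := by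
  refine hasDerivAt_matrix.2 fun i l => ?_
  simp only [Matrix.mul_diagonal, Matrix.add_apply]
  have h1 : HasDerivAt (fun x : ℝ => Complex.exp (x * ν l)) (Complex.exp (x * ν l) * ν l) x := by
    have := (((hasDerivAt_id x).ofReal_comp).mul_const (ν l)).cexp
    simpa using this
  convert! (hasDerivAt_matrix.1 hf i l).mul h1 using 1
  ring

theorem hasDerivWithinAt_mul_diagonal_exp {f : ℝ → Mat} {f' : Mat} {ν : Fin 3 → ℂ} {x : ℝ}
    {s : Set ℝ} (hf : HasDerivWithinAt f f' s x) : HasDerivWithinAt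
      (fun x : ℝ => f x * Matrix.diagonal fun l => Complex.exp (x * ν l))
      ((f' + f x * Matrix.diagonal ν) * Matrix.diagonal fun l => Complex.exp (x * ν l)) s x := by
  refine hasDerivWithinAt_matrix.2 fun i l => ?_
  simp only [Matrix.mul_diagonal, Matrix.add_apply]
  have h1 : HasDerivAt (fun x : ℝ => Complex.exp (x * ν l)) (Complex.exp (x * ν l) * ν l) x := by
    have := (((hasDerivAt_id x).ofReal_comp).mul_const (ν l)).cexp
    simpa using this
  convert! (hasDerivWithinAt_matrix.1 hf i l).mul h1.hasDerivWithinAt using 1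
  ring

theorem IsJost.hasDerivAt_matrix {p : ℝ → ℝ} {V : ℝ → Mat} {z : ℂ} {f : ℝ → Mat}
    (h : IsJost p V z f) (x : ℝ) :
    HasDerivAt f ((p x : ℂ) • (lamMat z * f x - f x * lamMat z) + V x * f x) x := by
  refine OstrovskyVakhnenko.hasDerivAt_matrix.2 fun j l => ?_
  convert! h.deriv x j l using 1
  simp [lamMat]
  ring

/-- `f exp (xΛ)` solves the `x`-equation of the Lax pair. -/
theorem IsJost.hasDerivAt_mul_exp {w : ℝ → ℝ} {z : ℂ} {f : ℝ → Mat}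
    (h : IsJost (fun _ => 1) (zeroPot w z) z f) (x : ℝ) :
    HasDerivAt (fun x : ℝ => f x * Matrix.diagonal fun l => Complex.exp (x * lam z l))
      (z • potA w x * (f x * Matrix.diagonal fun l => Complex.exp (x * lam z l))) x := by
  have := hasDerivAt_mul_diagonal_exp (ν := lam z) (h.hasDerivAt_matrix x)
  convert! this using 1
  rw [smul_potA, ← mul_assoc]
  congr 1
  change _ = _ + f x * lamMat z
  simp only [Complex.ofReal_one, one_smul, add_mul]
  abel

namespace IsSolution

variable {u₀ : ℝ → ℝ} {u : ℝ → ℝ → ℝ} (hu : IsSolution u₀ u)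
include hu

theorem hasDerivAt_potA (x : ℝ) {t : ℝ} (ht : 0 ≤ t) :
    HasDerivAt (potA fun x' => u x' t) (((-dx u 3 x t / 3 : ℝ) : ℂ) • lamOnes 1) x := by
  have h1 : HasDerivAt (fun x => -dx u 2 x t / 3) (-dx u 3 x t / 3) x :=
    (hu.hasDerivAt_dx 2 x ht).neg.div_const 3
  exact (h1.ofReal_comp.smul_const (lamOnes 1)).const_add _

theorem hasDerivAt_bMat (z : ℂ) (x : ℝ) {t : ℝ} (ht : 0 ≤ t) :
    HasDerivAt (fun x => bMat u z x t)
      (((dx u 2 x t : ℝ) : ℂ) • kMat - (((dx u 1 x t : ℝ) : ℂ) • z • potA (fun x' => u x' t) x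
        + ((dx u 0 x t : ℝ) : ℂ) • z • ((-dx u 3 x t / 3 : ℝ) : ℂ) • lamOnes 1)) x := by
  have h1 := (hu.hasDerivAt_dx 1 x ht).ofReal_comp.smul_const kMat
  have h2 := (hu.hasDerivAt_dx 0 x ht).ofReal_comp.smul ((hu.hasDerivAt_potA x ht).const_smul z)
  have h3 := (h1.const_add (z⁻¹ • lamInvMat)).sub h2
  convert! h3 using 1
  congr 1
  exact add_comm _ _

theorem hasDerivWithinAt_potA (x : ℝ) {t : ℝ} (ht : 0 ≤ t) :
    HasDerivWithinAt (fun t => potA (fun x' => u x' t) x)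
      (((-(3 * dx u 1 x t - 3 * dx u 1 x t * dx u 2 x t - dx u 0 x t * dx u 3 x t) / 3 : ℝ) : ℂ)
        • lamOnes 1) (Set.Ici 0) t := by
  have h1 := ((hu.hasDerivWithinAt_dx_two x ht).neg.div_const 3).ofReal_comp.smul_const (lamOnes 1)
  exact h1.const_add _

theorem hasDerivWithinAt_timeMat (z : ℂ) (x : ℝ) {t : ℝ} (ht : 0 ≤ t) :
    HasDerivWithinAt (timeMat u z x) (bMat u z x t * timeMat u z x t) (Set.Ici 0) t := by
  have := (hu.timeMat_spec z x).2 t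
  rw [max_eq_left ht] at this
  exact this.hasDerivWithinAt

theorem continuous_bMat_max (z : ℂ) : Continuous fun p : ℝ × ℝ => bMat u z p.1 (max p.2 0) := by
  have h0 := hu.continuous_dx_max 0
  have h1 := hu.continuous_dx_max 1
  have h2 := hu.continuous_potA_max
  unfold bMat
  fun_prop

/-- The `t`-evolution preserves the `x`-equation. -/
theorem hasDerivAt_timeMat_mul {z : ℂ} (hz : z ≠ 0) {Φ : ℝ → Mat}
    (hΦ : ∀ x, HasDerivAt Φ (z • potA u₀ x * Φ x) x) {T : ℝ} (hT : 0 ≤ T) (x : ℝ) :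
    HasDerivAt (fun x => timeMat u z x T * Φ x)
      (z • potA (fun x' => u x' T) x * (timeMat u z x T * Φ x)) x := by
  have hmax : ∀ t ∈ Set.Icc 0 T, max t 0 = t := fun t ht => max_eq_left ht.1
  have hu0 : (fun x' => u x' 0) = u₀ := funext hu.initial
  have h0 := hu.continuous_dx_max 0
  have h1 := hu.continuous_dx_max 1
  have h2 := hu.continuous_dx_max 2
  have h3 := hu.continuous_dx_max 3
  have h4 := hu.continuous_potA_max
  -- Here `x` is the parameter of the `t`-equation, and the candidate for the `x`-derivative of `Y =
  -- TΦ` is `Z = A Y`. The zero curvature relation says exactly that `Z` solves the variational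
  -- equation `Z_t = B Z + B_x Y`; at `t = 0` it is the given `x`-equation.
  refine hasDerivAt_linearODE_param (𝕜 := ℝ) (R := Mat) (r := 1) one_pos hT
    (a := fun x t => bMat u z x (max t 0))
    (a' := fun x t => ((dx u 2 x (max t 0) : ℝ) : ℂ) • kMat
      - (((dx u 1 x (max t 0) : ℝ) : ℂ) • z • potA (fun x' => u x' (max t 0)) x
        + ((dx u 0 x (max t 0) : ℝ) : ℂ) • z • ((-dx u 3 x (max t 0) / 3 : ℝ) : ℂ) • lamOnes 1))
    (Y := fun x t => timeMat u z x t * Φ x)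
    (Z := fun t => z • potA (fun x' => u x' t) x * (timeMat u z x t * Φ x))
    (fun x _ t _ => hu.hasDerivAt_bMat z x (le_max_right t 0))
    (hu.continuous_bMat_max z).continuousOn ?_ (fun x _ t ht => ?_) (fun t ht => ?_) ?_
  · exact Continuous.continuousOn (by fun_prop)
  · simp only [hmax t ht, ← mul_assoc]
    exact (hu.hasDerivWithinAt_timeMat z x ht.1).mul_const (Φ x)
  · simp only [hmax t ht]
    have hA := (hu.hasDerivWithinAt_potA x ht.1).const_smul z
    have hY := (hu.hasDerivWithinAt_timeMat z x ht.1).mul_const (Φ x)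
    have hzc := zero_curvature hz (dx u 0 x t) (dx u 1 x t) (dx u 2 x t) (dx u 3 x t)
      (z • potA (fun x' => u x' t) x) (bMat u z x t) (by rw [potA]; simp [dx]) (by rw [bMat])
    have key := hA.mul hY
    convert! key using 1
    rw [Pi.smul_apply, mul_assoc (bMat u z x t), ← mul_assoc (z • potA (fun x' => u x' t) x) (bMat u z x t),
      ← add_mul, ← mul_assoc (bMat u z x t), ← add_mul]
    congr 1
    push_cast at hzc ⊢
    exact hzc.symm
  · have : ∀ x, timeMat u z x 0 = 1 := fun x => (hu.timeMat_spec z x).1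
    simp only [this, one_mul, hu0]
    exact hΦ x

theorem exists_norm_remMat_le (z : ℂ) (T : ℝ) : ∃ C : ℝ, 0 ≤ C ∧ ∀ t ∈ Set.Icc 0 T, ∀ x,
    ‖remMat u z x t‖ ≤ (|dx u 0 x t| + |dx u 1 x t|) * C := by
  obtain ⟨K, hK0, hK⟩ := hu.exists_bound_dx T (k := 2) (by norm_num)
  refine ⟨‖kMat‖ + ‖z‖ * (‖lamMat 1‖ + K * ‖lamOnes 1‖), by positivity, fun t ht x => ?_⟩
  have h1 : ‖potA (fun x' => u x' t) x‖ ≤ ‖lamMat 1‖ + K * ‖lamOnes 1‖ := by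
    rw [potA]
    refine (norm_add_le _ _).trans (add_le_add le_rfl ?_)
    rw [norm_smul]
    gcongr
    rw [Complex.norm_real, Real.norm_eq_abs, abs_div, abs_neg]
    have := hK t ht x
    simp only [dx] at this
    rw [abs_of_pos (by norm_num : (0 : ℝ) < 3)]
    linarith
  rw [remMat]
  refine (norm_sub_le _ _).trans ?_
  rw [norm_smul, norm_smul, norm_smul, Complex.norm_real, Complex.norm_real, Real.norm_eq_abs,
    Real.norm_eq_abs]
  have e1 : 0 ≤ |dx u 0 x t| * ‖kMat‖ := by positivity
  have e2 : 0 ≤ |dx u 1 x t| * (‖z‖ * (‖lamMat 1‖ + K * ‖lamOnes 1‖)) := by positivity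
  have e3 : |dx u 0 x t| * (‖z‖ * ‖potA (fun x' => u x' t) x‖)
      ≤ |dx u 0 x t| * (‖z‖ * (‖lamMat 1‖ + K * ‖lamOnes 1‖)) := by gcongr
  linarith

/-- The `x`-equation is preserved by compatibility. For the normalization, `N_t = B N - N Λ(z)⁻¹`,
and as `|x| → ∞` the coefficient `B` tends to `Λ(z)⁻¹` uniformly in `t ∈ [0, T]`, because `u` and
`u_x` do tend to `0`. Gronwall's inequality gives boundedness, and then shows that an entry close to
`δ_jl` at time `0` is still close to it at time `T`. -/
theorem isJost_evolution {z : ℂ} (hz : z ≠ 0) {f : ℝ → Mat}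
    (hf : IsJost (fun _ => 1) (zeroPot u₀ z) z f) {T : ℝ} (hT : 0 ≤ T) :
    IsJost (fun _ => 1) (zeroPot (fun x => u x T) z) z (fun x => timeMat u z x T * f x *
      Matrix.diagonal fun l => Complex.exp (T * -(lam z l)⁻¹)) := by
  set N : ℝ → ℝ → Mat := fun x t => timeMat u z x t * f x *
      Matrix.diagonal fun l => Complex.exp (t * -(lam z l)⁻¹) with hN
  have hTm : T ∈ Set.Icc 0 T := ⟨hT, le_rfl⟩
  have hN0 : ∀ x, N x 0 = f x := fun x => by simp [hN, (hu.timeMat_spec z x).1]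
  have hNt : ∀ x, ∀ t ∈ Set.Icc 0 T, HasDerivWithinAt (N x)
      (bMat u z x t * N x t + N x t * Matrix.diagonal fun l => -(lam z l)⁻¹) (Set.Ici 0) t := by
    intro x t ht
    have := hasDerivWithinAt_mul_diagonal_exp (ν := fun l => -(lam z l)⁻¹)
      ((hu.hasDerivWithinAt_timeMat z x ht.1).mul_const (f x))
    convert! this using 1
    simp only [hN, add_mul, mul_assoc, Matrix.diagonal_mul_diagonal]
    simp only [mul_comm]
  obtain ⟨Cr, hCr0, hCr⟩ := hu.exists_norm_remMat_le z T
  obtain ⟨K0, hK00, hK0⟩ := hu.exists_bound_dx T (k := 0) (by norm_num)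
  obtain ⟨K1, hK10, hK1⟩ := hu.exists_bound_dx T (k := 1) (by norm_num)
  obtain ⟨Cf, hCf⟩ := hf.bounded
  have hCf0 : 0 ≤ Cf := (norm_nonneg _).trans (hCf 0 0 0)
  set L := ‖(Matrix.diagonal fun l => -(lam z l)⁻¹ : Mat)‖ with hL
  set K := ‖z⁻¹ • lamInvMat‖ + (K0 + K1) * Cr + L with hK
  have hKpos : 0 ≤ K := by positivity
  have hNb : ∀ x, ∀ t ∈ Set.Icc 0 T, ‖N x t‖ ≤ 3 * Cf * Real.exp (K * T) := by
    intro x t ht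
    have h1 := norm_le_of_hasDerivWithinAt_le (E := Mat) (δ := 3 * Cf) (K := K) (ε := 0)
      (by positivity) hKpos le_rfl (hNt x) (by rw [hN0]; exact norm_le_of_entry_le (hCf x))
      (fun s hs => by
        rw [add_zero]
        refine (norm_add_le _ _).trans ?_
        have e1 := norm_mul_le (bMat u z x s) (N x s)
        have e2 := norm_mul_le (N x s) (Matrix.diagonal fun l => -(lam z l)⁻¹)
        have e3 : ‖bMat u z x s‖ ≤ ‖z⁻¹ • lamInvMat‖ + (K0 + K1) * Cr := by
          rw [bMat_eq]
          refine (norm_add_le _ _).trans (add_le_add le_rfl ((hCr s hs x).trans ?_))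
          gcongr
          · exact hK0 s hs x
          · exact hK1 s hs x
        have e4 := mul_le_mul_of_nonneg_right e3 (norm_nonneg (N x s))
        rw [hK]
        calc _ ≤ (‖z⁻¹ • lamInvMat‖ + (K0 + K1) * Cr) * ‖N x s‖ + ‖N x s‖ * L :=
              add_le_add (e1.trans e4) e2
          _ = _ := by ring) t ht
    simpa using h1
  set B := 3 * Cf * Real.exp (K * T) with hB
  have hB0 : 0 ≤ B := by positivity
  have hlim : ∀ (F : Filter ℝ) (j l : Fin 3), (∀ r : ℝ, ∀ᶠ x in F, r ≤ |x|) →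
      Tendsto (fun x => f x j l) F (𝓝 ((1 : Mat) j l)) →
      Tendsto (fun x => N x T j l) F (𝓝 ((1 : Mat) j l)) := by
    intro F j l hF hlim
    rw [tendsto_iff_norm_sub_tendsto_zero] at hlim ⊢
    refine tendsto_zero_of_le_add_mul (A := 2 * Cr * B * T)
      (E := Real.exp (‖(lam z j)⁻¹ - (lam z l)⁻¹‖ * T)) (by positivity) (by positivity)
      (fun x => norm_nonneg _) hlim (fun ε hε => ?_)
    obtain ⟨R0, hR0⟩ := hu.uniform_decay T (k := 0) (by norm_num) hε
    obtain ⟨R1, hR1⟩ := hu.uniform_decay T (k := 1) (by norm_num) hε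
    filter_upwards [hF R0, hF R1] with x hx0 hx1
    -- Entry by entry, the limiting equation has the coefficient `λ_j⁻¹ - λ_l⁻¹`, which annihilates
    -- `δ_jl`. What forces the deviation is the `u`-dependent part, small for large `|x|`.
    have h1 := norm_le_of_hasDerivWithinAt_le (E := ℂ) (f := fun t => N x t j l - (1 : Mat) j l)
      (f' := fun t => ((lam z j)⁻¹ - (lam z l)⁻¹) * (N x t j l - (1 : Mat) j l)
        + (remMat u z x t * N x t) j l) (T := T)
      (δ := ‖f x j l - (1 : Mat) j l‖) (K := ‖(lam z j)⁻¹ - (lam z l)⁻¹‖) (ε := ε * (2 * Cr * B))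
      (norm_nonneg _) (norm_nonneg _) (by positivity) (fun t ht => by
        have := (hasDerivWithinAt_matrix.1 (hNt x t ht) j l).sub_const ((1 : Mat) j l)
        convert! this using 1
        rw [Matrix.add_apply, bMat_mul_apply, Matrix.mul_diagonal]
        have h0 : ((lam z j)⁻¹ - (lam z l)⁻¹) * (1 : Mat) j l = 0 := by
          rcases eq_or_ne j l with rfl | hjl
          · simp
          · rw [Matrix.one_apply_ne hjl, mul_zero]
        linear_combination -h0) (by simp [hN0]) (fun t ht => by
        refine (norm_add_le _ _).trans (add_le_add (norm_mul_le _ _) ?_)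
        refine (norm_entry_le_norm _ j l).trans ((norm_mul_le _ _).trans ?_)
        have e1 := hCr t ht x
        have e2 := hR0 t ht x hx0
        have e3 := hR1 t ht x hx1
        calc ‖remMat u z x t‖ * ‖N x t‖ ≤ ((ε + ε) * Cr) * B := by
              gcongr
              · exact e1.trans (by gcongr)
              · exact hNb x t ht
          _ = ε * (2 * Cr * B) := by ring) T hTm
    refine h1.trans (le_of_eq ?_)
    ring
  refine ⟨fun x j l => ?_, ⟨B, fun x j l => (norm_entry_le_norm _ j l).trans (hNb x T hTm)⟩,
    fun j l hle => hlim _ j l (fun r => ?_) (hf.right j l hle),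
    fun j l hlt => hlim _ j l (fun r => ?_) (hf.left j l hlt)⟩
  · have hΨ := hu.hasDerivAt_timeMat_mul hz (fun x => hf.hasDerivAt_mul_exp x) hT x
    have h2 := hasDerivAt_matrix.1 (hasDerivAt_mul_diagonal_exp (ν := fun l => -lam z l) hΨ) j l
    have h3 := h2.mul_const (Complex.exp (T * -(lam z l)⁻¹))
    have hexp : ∀ x : ℝ, Complex.exp (x * lam z l) * Complex.exp (x * -lam z l) = 1 := fun x => by
      rw [← Complex.exp_add]; simp
    have e1 : ∀ x : ℝ, N x T j l = (timeMat u z x T * (f x * Matrix.diagonal fun l =>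
        Complex.exp (x * lam z l)) * Matrix.diagonal fun l => Complex.exp (x * -lam z l)) j l
          * Complex.exp (T * -(lam z l)⁻¹) := fun x => by
      rw [Matrix.mul_diagonal, ← mul_assoc, Matrix.mul_diagonal, mul_assoc (_ * _ : ℂ) , hN]
      simp only [Matrix.mul_diagonal]
      linear_combination (-(timeMat u z x T * f x) j l * Complex.exp (T * -(lam z l)⁻¹)) * hexp x
    have e2 : (fun x => N x T j l) = _ := funext e1
    change HasDerivAt (fun x => N x T j l) _ x
    rw [e2]
    convert! h3 using 1
    rw [smul_potA]
    have e3 : ((lamMat z + zeroPot (fun x' => u x' T) z x) * (timeMat u z x T * (f x *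
        Matrix.diagonal fun l => Complex.exp (x * lam z l)))) j l
        = (lam z j * (timeMat u z x T * f x) j l
          + (zeroPot (fun x' => u x' T) z x * (timeMat u z x T * f x)) j l)
          * Complex.exp (x * lam z l) := by
      rw [← mul_assoc (timeMat u z x T), ← mul_assoc, Matrix.mul_diagonal, add_mul,
        Matrix.add_apply, lamMat, Matrix.diagonal_mul]
    have e4 : (zeroPot (fun x' => u x' T) z x * N x T) j l
        = (zeroPot (fun x' => u x' T) z x * (timeMat u z x T * f x)) j l
          * Complex.exp (T * -(lam z l)⁻¹) := by
      rw [hN]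
      simp only
      rw [← mul_assoc, Matrix.mul_diagonal]
    rw [e4, Matrix.mul_diagonal, Matrix.mul_diagonal, Matrix.add_apply, e3, Matrix.mul_diagonal,
      ← mul_assoc (timeMat u z x T), Matrix.mul_diagonal]
    push_cast
    linear_combination (-((lam z j - lam z l) * (timeMat u z x T * f x) j l
      + (zeroPot (fun x' => u x' T) z x * (timeMat u z x T * f x)) j l)
        * Complex.exp (T * -(lam z l)⁻¹)) * hexp x
  · exact (tendsto_abs_atTop_atTop).eventually_ge_atTop r
  · exact (tendsto_abs_atBot_atTop).eventually_ge_atTop r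

end IsSolution

end Evolution

/-! ### The conservation law and the change of variables `x ↔ y` -/

section ChangeOfVariables

theorem intervalIntegral_swap_of_continuous {f : ℝ → ℝ → ℝ} (hf : Continuous fun p : ℝ × ℝ => f p.1 p.2)
    (a b c d : ℝ) : ∫ x in a..b, ∫ y in c..d, f x y = ∫ y in c..d, ∫ x in a..b, f x y :=
  intervalIntegral_intervalIntegral_swap ((hf.continuousOn.integrableOn_compact
    (isCompact_uIcc.prod isCompact_uIcc)).mono_set
      (Set.prod_mono Set.uIoc_subset_uIcc Set.uIoc_subset_uIcc))

namespace IsSolution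

variable {u₀ : ℝ → ℝ} {u : ℝ → ℝ → ℝ} (hu : IsSolution u₀ u)
include hu

theorem continuous_mOf_max :
    Continuous fun p : ℝ × ℝ => mOf (fun x' => u x' (max p.2 0)) p.1 := by
  have := hu.continuous_dx_max 2
  unfold dx at this
  unfold mOf
  fun_prop

variable (hu₀ : IsInitialDatum u₀)
include hu₀

theorem continuous_qOf_max :
    Continuous fun p : ℝ × ℝ => qOf (fun x' => u x' (max p.2 0)) p.1 :=
  (hu.continuous_mOf_max).rpow_const fun p =>
    Or.inl ((hu.isInitialDatum hu₀ (le_max_right p.2 0)).mOf_pos p.1).ne'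

theorem continuous_kapOf_max :
    Continuous fun p : ℝ × ℝ => kapOf (fun x' => u x' (max p.2 0)) p.1 := by
  have h := hu.continuous_dx_max 3
  unfold dx at h
  have h2 := hu.continuous_mOf_max
  unfold kapOf
  refine h.neg.div (continuous_const.mul h2) fun p => ?_
  have := ((hu.isInitialDatum hu₀ (le_max_right p.2 0)).mOf_pos p.1).ne'
  positivity

/-- The `t`-part of the conservation law `q_t + (u q)_x = 0`. -/
theorem hasDerivWithinAt_qOf (x : ℝ) {t : ℝ} (ht : 0 ≤ t) :
    HasDerivWithinAt (fun s => qOf (fun x' => u x' s) x)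
      (-(dx u 1 x t * qOf (fun x' => u x' t) x
        + dx u 0 x t * (3 * kapOf (fun x' => u x' t) x * qOf (fun x' => u x' t) x)))
      (Set.Ici 0) t := by
  have hI := hu.isInitialDatum hu₀ ht
  have hm : mOf (fun x' => u x' t) x ≠ 0 := (hI.mOf_pos x).ne'
  have h1 := ((hu.hasDerivWithinAt_dx_two x ht).const_sub 1).rpow_const (p := 1 / 3) (Or.inl hm)
  have h2 : (mOf (fun x' => u x' t) x) ^ ((1 / 3 : ℝ) - 1)
      = qOf (fun x' => u x' t) x / mOf (fun x' => u x' t) x := by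
    rw [Real.rpow_sub (hI.mOf_pos x), Real.rpow_one]; rfl
  have e : 1 - dx u 2 x t = mOf (fun x' => u x' t) x := rfl
  rw [e, h2] at h1
  convert! h1 using 1
  have e2 : dx u 2 x t = 1 - mOf (fun x' => u x' t) x := by rw [← e]; ring
  rw [kapOf, e2]
  simp only [show iteratedDeriv 3 (fun x' => u x' t) x = dx u 3 x t from rfl]
  field_simp
  ring

theorem hasDerivAt_u_mul_qOf (x : ℝ) {t : ℝ} (ht : 0 ≤ t) :
    HasDerivAt (fun x => dx u 0 x t * qOf (fun x' => u x' t) x)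
      (dx u 1 x t * qOf (fun x' => u x' t) x
        + dx u 0 x t * (3 * kapOf (fun x' => u x' t) x * qOf (fun x' => u x' t) x)) x :=
  (hu.hasDerivAt_dx 0 x ht).mul ((hu.isInitialDatum hu₀ ht).hasDerivAt_qOf x)

theorem continuous_flux : Continuous fun p : ℝ × ℝ =>
    dx u 0 p.1 (max p.2 0) * qOf (fun x' => u x' (max p.2 0)) p.1 :=
  (hu.continuous_dx_max 0).mul (hu.continuous_qOf_max hu₀)

/-- The conservation law `q_t + (u q)_x = 0` integrated over a rectangle, the order of integration
being exchanged. -/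
theorem integral_qOf_sub (x R : ℝ) {t : ℝ} (ht : 0 ≤ t) :
    ∫ ξ in x..R, (qOf (fun x' => u x' t) ξ - qOf (fun x' => u x' 0) ξ)
      = (∫ s in (0 : ℝ)..t, dx u 0 x (max s 0) * qOf (fun x' => u x' (max s 0)) x)
        - ∫ s in (0 : ℝ)..t, dx u 0 R (max s 0) * qOf (fun x' => u x' (max s 0)) R := by
  have c0 := hu.continuous_dx_max 0
  have c1 := hu.continuous_dx_max 1
  have cq := hu.continuous_qOf_max hu₀
  have cκ := hu.continuous_kapOf_max hu₀
  have cf := hu.continuous_flux hu₀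
  set g : ℝ → ℝ → ℝ := fun ξ s => dx u 1 ξ (max s 0) * qOf (fun x' => u x' (max s 0)) ξ
    + dx u 0 ξ (max s 0) * (3 * kapOf (fun x' => u x' (max s 0)) ξ
      * qOf (fun x' => u x' (max s 0)) ξ) with hg
  have hgc : Continuous fun p : ℝ × ℝ => g p.1 p.2 := by fun_prop
  have h1 : ∀ ξ, qOf (fun x' => u x' t) ξ - qOf (fun x' => u x' 0) ξ
      = ∫ s in (0 : ℝ)..t, -g ξ s := by
    intro ξ
    refine (intervalIntegral.integral_eq_sub_of_hasDeriv_right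
      (f := fun s => qOf (fun x' => u x' s) ξ) ?_ (fun s hs => ?_) ?_).symm
    · intro s hs
      rw [Set.uIcc_of_le ht] at hs
      exact (hu.hasDerivWithinAt_qOf hu₀ ξ hs.1).continuousWithinAt.mono
        (by rw [Set.uIcc_of_le ht]; exact fun r hr => hr.1)
    · rw [min_eq_left ht] at hs
      have hs0 : 0 ≤ s := hs.1.le
      have := hu.hasDerivWithinAt_qOf hu₀ ξ hs0
      rw [hg]
      simp only [max_eq_left hs0]
      exact this.mono fun r (hr : s < r) => hs0.trans hr.le
    · exact Continuous.intervalIntegrable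
        ((hgc.comp (Continuous.prodMk_right ξ)).neg) _ _
  have h2 : ∀ s, ∫ ξ in x..R, -g ξ s
      = dx u 0 x (max s 0) * qOf (fun x' => u x' (max s 0)) x
        - dx u 0 R (max s 0) * qOf (fun x' => u x' (max s 0)) R := by
    intro s
    rw [intervalIntegral.integral_neg, intervalIntegral.integral_eq_sub_of_hasDerivAt
      (fun ξ _ => hu.hasDerivAt_u_mul_qOf hu₀ ξ (le_max_right s 0))
      (Continuous.intervalIntegrable (hgc.comp (Continuous.prodMk_left s)) _ _)]
    ring
  simp only [h1]
  rw [intervalIntegral_swap_of_continuous (f := fun ξ s => -g ξ s) hgc.neg]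
  simp only [h2]
  exact intervalIntegral.integral_sub
    (Continuous.intervalIntegrable (cf.comp (Continuous.prodMk_right x)) _ _)
    (Continuous.intervalIntegrable (cf.comp (Continuous.prodMk_right R)) _ _)

theorem tendsto_integral_flux (T : ℝ) (hT : 0 ≤ T) :
    Tendsto (fun R => ∫ s in (0 : ℝ)..T, dx u 0 R (max s 0) * qOf (fun x' => u x' (max s 0)) R)
      atTop (𝓝 0) := by
  obtain ⟨K, hK0, hK⟩ := hu.exists_bound_dx T (k := 2) (by norm_num)
  have hq : ∀ t ∈ Set.Icc 0 T, ∀ x, |qOf (fun x' => u x' t) x| ≤ 1 + K := by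
    intro t ht x
    have h1 := (hu.isInitialDatum hu₀ ht.1).abs_qOf_sub_one_le x
    have h2 := hK t ht x
    unfold dx at h2
    have h3 := abs_add_le (qOf (fun x' => u x' t) x - 1) 1
    rw [sub_add_cancel, abs_one] at h3
    linarith
  rw [Metric.tendsto_atTop]
  intro ε hε
  have hδ : 0 < ε / (2 * (1 + K) * (T + 1)) := by positivity
  obtain ⟨R₀, hR₀⟩ := hu.uniform_decay T (k := 0) (by norm_num) hδ
  refine ⟨max R₀ 0, fun R hR => ?_⟩
  have hRa : R₀ ≤ |R| := (le_max_left _ _).trans (hR.trans (le_abs_self R))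
  rw [dist_zero_right]
  have := intervalIntegral.norm_integral_le_of_norm_le_const (a := 0) (b := T)
    (f := fun s => dx u 0 R (max s 0) * qOf (fun x' => u x' (max s 0)) R)
    (C := ε / (2 * (1 + K) * (T + 1)) * (1 + K)) (fun s hs => by
      rw [Set.uIoc_of_le hT] at hs
      have hs' : s ∈ Set.Icc 0 T := ⟨hs.1.le, hs.2⟩
      rw [max_eq_left hs'.1, norm_mul]
      exact mul_le_mul (hR₀ s hs' R hRa) (hq s hs' R) (norm_nonneg _) hδ.le)
  refine this.trans_lt ?_
  rw [sub_zero, abs_of_nonneg hT]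
  have e : ε / (2 * (1 + K) * (T + 1)) * (1 + K) * T = ε / 2 * (T / (T + 1)) := by
    field_simp
  rw [e]
  have : T / (T + 1) < 1 := by rw [div_lt_one (by linarith)]; linarith
  nlinarith

/-- Let `R → ∞` in the integrated conservation law. The flux at `R` vanishes and `y(R, ·) - R → 0`
at both times, so the improper integral defining `y` need not be differentiated under the integral
sign. -/
theorem yVar_eq (x : ℝ) {t : ℝ} (ht : 0 ≤ t) : yVar u x t = yVar u x 0
    - ∫ s in (0 : ℝ)..t, dx u 0 x (max s 0) * qOf (fun x' => u x' (max s 0)) x := by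
  have ht' := hu.isInitialDatum hu₀ ht
  have h0' := hu.isInitialDatum hu₀ le_rfl
  have h1 : ∀ R, (yVar u R t - R) - (yVar u R 0 - R) - (yVar u x t - yVar u x 0)
      = (∫ s in (0 : ℝ)..t, dx u 0 x (max s 0) * qOf (fun x' => u x' (max s 0)) x)
        - ∫ s in (0 : ℝ)..t, dx u 0 R (max s 0) * qOf (fun x' => u x' (max s 0)) R := by
    intro R
    rw [← hu.integral_qOf_sub hu₀ x R ht, intervalIntegral.integral_sub
      (ht'.continuous_qOf.intervalIntegrable _ _) (h0'.continuous_qOf.intervalIntegrable _ _),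
      ht'.integral_qOf, h0'.integral_qOf]
    simp only [yVar]
    ring
  have h2 := ((ht'.tendsto_yOf_sub_atTop.sub h0'.tendsto_yOf_sub_atTop).sub_const
    (yVar u x t - yVar u x 0))
  have h3 := (hu.tendsto_integral_flux hu₀ t ht).const_sub
    (∫ s in (0 : ℝ)..t, dx u 0 x (max s 0) * qOf (fun x' => u x' (max s 0)) x)
  have h4 := tendsto_nhds_unique (h2.congr fun R => h1 R) h3
  linarith

theorem hasDerivWithinAt_yVar (x : ℝ) {t : ℝ} (ht : 0 ≤ t) :
    HasDerivWithinAt (fun s => yVar u x s) (-(u x t * qOf (fun x' => u x' t) x)) (Set.Ici 0) t := by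
  have hc := (hu.continuous_flux hu₀).comp (Continuous.prodMk_right x)
  have h1 := ((hc.integral_hasStrictDerivAt 0 t).hasDerivAt.const_sub (yVar u x 0)).hasDerivWithinAt
    (s := Set.Ici 0)
  simp only [Function.comp_def, max_eq_left ht, dx_zero] at h1
  refine h1.congr (fun s hs => ?_) ?_
  · rw [hu.yVar_eq hu₀ x hs]; simp only [dx_zero]
  · rw [hu.yVar_eq hu₀ x ht]; simp only [dx_zero]

/-- The inverse of the change of variables moves with velocity `u`. -/
theorem hasDerivWithinAt_inverse {X : ℝ → ℝ → ℝ} (hX : ∀ t, 0 ≤ t → ∀ y, yVar u (X y t) t = y)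
    (y : ℝ) {t : ℝ} (ht : 0 ≤ t) :
    HasDerivWithinAt (fun s => X y s) (u (X y t) t) (Set.Ici 0) t := by
  set x := X y t with hx
  have hmono : ∀ s, 0 ≤ s → StrictMono fun x => yVar u x s := fun s hs =>
    (hu.isInitialDatum hu₀ hs).strictMono_yOf
  have hyc : ∀ x, ContinuousWithinAt (fun s => yVar u x s) (Set.Ici 0) t := fun x =>
    (hu.hasDerivWithinAt_yVar hu₀ x ht).continuousWithinAt
  have hXc : Tendsto (fun s => X y s) (𝓝[Set.Ici 0] t) (𝓝 x) := by
    rw [Metric.tendsto_nhds]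
    intro ε hε
    have hyx : yVar u x t = y := hX t ht y
    have h1 : y < yVar u (x + ε) t := by rw [← hyx]; exact hmono t ht (by linarith)
    have h2 : yVar u (x - ε) t < y := by rw [← hyx]; exact hmono t ht (by linarith)
    filter_upwards [(hyc (x + ε)).eventually_const_lt h1, (hyc (x - ε)).eventually_lt_const h2,
      self_mem_nhdsWithin] with s hs1 hs2 hs
    have hys : yVar u (X y s) s = y := hX s hs y
    rw [← hys] at hs1 hs2
    have h3 := (hmono s hs).lt_iff_lt.1 hs1
    have h4 := (hmono s hs).lt_iff_lt.1 hs2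
    rw [Real.dist_eq, abs_lt]
    constructor <;> linarith
  -- The mean value theorem in `x` at the fixed time `s`. It gives `(X y s - x) q(ξ, s) = y(x, t) -
  -- y(x, s)` with `ξ → x`, so the difference quotient of `X` tends to `-y_t / q = u`.
  have hmv : ∀ s, ∃ ξ, |ξ - x| ≤ |X y s - x| ∧ (0 ≤ s →
      yVar u (X y s) s - yVar u x s = qOf (fun x' => u x' (max s 0)) ξ * (X y s - x)) := by
    intro s
    by_cases hs : 0 ≤ s
    swap
    · exact ⟨x, by simp, fun h => absurd h hs⟩
    have hd := (hu.isInitialDatum hu₀ hs).hasDerivAt_yOf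
    rw [max_eq_left hs]
    rcases lt_trichotomy x (X y s) with h | h | h
    · obtain ⟨ξ, hξ, he⟩ := exists_hasDerivAt_eq_slope (fun x => yVar u x s) _ h
        (fun r _ => (hd r).continuousAt.continuousWithinAt) (fun r _ => hd r)
      refine ⟨ξ, ?_, fun _ => ?_⟩
      · rw [abs_of_pos (by linarith [hξ.1]), abs_of_pos (by linarith)]; linarith [hξ.2]
      · rw [he]; field_simp [(sub_pos.2 h).ne']
    · exact ⟨x, by simp, fun _ => by rw [← h]; ring⟩
    · obtain ⟨ξ, hξ, he⟩ := exists_hasDerivAt_eq_slope (fun x => yVar u x s) _ h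
        (fun r _ => (hd r).continuousAt.continuousWithinAt) (fun r _ => hd r)
      refine ⟨ξ, ?_, fun _ => ?_⟩
      · rw [abs_of_neg (by linarith [hξ.2]), abs_of_neg (by linarith)]; linarith [hξ.1]
      · rw [he]
        have := (sub_pos.2 h).ne'
        field_simp
        ring
  choose ξ hξ1 hξ2 using hmv
  have hξ : Tendsto ξ (𝓝[Set.Ici 0] t) (𝓝 x) := by
    rw [tendsto_iff_dist_tendsto_zero] at hXc ⊢
    exact squeeze_zero (fun _ => dist_nonneg) (fun s => hξ1 s) hXc
  have hq : Tendsto (fun s => qOf (fun x' => u x' (max s 0)) (ξ s)) (𝓝[Set.Ici 0] t)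
      (𝓝 (qOf (fun x' => u x' t) x)) := by
    have h1 := ((hu.continuous_qOf_max hu₀).tendsto (x, t)).comp
      (hξ.prodMk_nhds (tendsto_id.mono_left nhdsWithin_le_nhds : Tendsto id (𝓝[Set.Ici 0] t) (𝓝 t)))
    simp only [max_eq_left ht] at h1
    exact h1
  have hq0 : qOf (fun x' => u x' t) x ≠ 0 := ((hu.isInitialDatum hu₀ ht).qOf_pos x).ne'
  rw [hasDerivWithinAt_iff_tendsto_slope]
  have hs1 := hasDerivWithinAt_iff_tendsto_slope.1 (hu.hasDerivWithinAt_yVar hu₀ x ht)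
  have hs2 := hs1.neg.div (hq.mono_left (nhdsWithin_mono t Set.sdiff_subset)) hq0
  rw [neg_neg, mul_div_assoc, div_self hq0, mul_one] at hs2
  refine hs2.congr' ?_
  filter_upwards [self_mem_nhdsWithin] with s hs
  have hs0 : 0 ≤ s := hs.1
  have hqs : qOf (fun x' => u x' (max s 0)) (ξ s) ≠ 0 :=
    ((hu.isInitialDatum hu₀ (le_max_right s 0)).qOf_pos _).ne'
  have e := hξ2 s hs0
  rw [hX s hs0 y] at e
  have e' : yVar u x t = y := hX t ht y
  simp only [Pi.div_apply, slope_def_field]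
  rw [← hx, e', div_eq_iff hqs, div_mul_eq_mul_div, mul_comm (X y s - x), ← e, neg_div']
  congr 1
  ring

end IsSolution

end ChangeOfVariables

/-! ### Local geometry of the contour, and the diagonal exponentials -/

section Contour

theorem zero_mem_contour : (0 : ℂ) ∈ contour := (mem_contour_iff 0).2 (by simp)

theorem ne_zero_of_notMem_contour {z : ℂ} (hz : z ∉ contour) : z ≠ 0 :=
  fun h => hz (h ▸ zero_mem_contour)

theorem im_cube_mul_one_add (z : ℂ) (ε : ℝ) (hz : (z ^ 3).im = 0) :
    ((z * (1 + ε * Complex.I)) ^ 3).im = (z ^ 3).re * (3 * ε - ε ^ 3) := by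
  rw [mul_pow, Complex.mul_im, hz, zero_mul, add_zero]
  congr 1
  simp [pow_succ]
  ring

/-- Every nonzero point of the contour is approached from both sides along `z (1 ± iε)`. Boundary
values are thus limits along nontrivial filters, hence unique. -/
theorem exists_sign_curve {z : ℂ} (hz : z ∈ contour) (h0 : z ≠ 0) :
    ∃ s : ℝ, s ≠ 0 ∧ ∀ ε : ℝ, 0 < ε → ε < 1 → 0 < ((z * (1 + (s * ε : ℝ) * Complex.I)) ^ 3).im ∧
      ((z * (1 + (-s * ε : ℝ) * Complex.I)) ^ 3).im < 0 := by
  have him := (mem_contour_iff z).1 hz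
  have hre : (z ^ 3).re ≠ 0 := fun h => pow_ne_zero 3 h0 (Complex.ext h him)
  rcases hre.lt_or_gt with h | h
  · refine ⟨-1, by norm_num, fun ε h1 h2 => ?_⟩
    rw [im_cube_mul_one_add z _ him, im_cube_mul_one_add z _ him]
    have : 0 < 3 * ε - ε ^ 3 := by nlinarith [mul_pos h1 h1, mul_pos (mul_pos h1 h1) h1]
    constructor <;> nlinarith
  · refine ⟨1, by norm_num, fun ε h1 h2 => ?_⟩
    rw [im_cube_mul_one_add z _ him, im_cube_mul_one_add z _ him]
    have : 0 < 3 * ε - ε ^ 3 := by nlinarith [mul_pos h1 h1, mul_pos (mul_pos h1 h1) h1]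
    constructor <;> nlinarith

theorem neBot_of_curve {z : ℂ} {S : Set ℂ} {s : ℝ}
    (h : ∀ ε : ℝ, 0 < ε → ε < 1 → z * (1 + (s * ε : ℝ) * Complex.I) ∈ S) : (𝓝[S] z).NeBot := by
  have hc : Continuous fun ε : ℝ => z * (1 + (s * ε : ℝ) * Complex.I) := by fun_prop
  have h1 : Tendsto (fun ε : ℝ => z * (1 + (s * ε : ℝ) * Complex.I)) (𝓝[>] 0) (𝓝 z) := by
    have := hc.tendsto 0
    simp only [mul_zero, Complex.ofReal_zero, zero_mul, add_zero, mul_one] at this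
    exact this.mono_left nhdsWithin_le_nhds
  have h2 : Tendsto (fun ε : ℝ => z * (1 + (s * ε : ℝ) * Complex.I)) (𝓝[>] 0) (𝓝[S] z) := by
    refine tendsto_nhdsWithin_iff.2 ⟨h1, ?_⟩
    filter_upwards [Ioo_mem_nhdsGT one_pos] with ε hε using h ε hε.1 hε.2
  exact h2.neBot

theorem neBot_plusSide {z : ℂ} (hz : z ∈ contour) (h0 : z ≠ 0) : (𝓝[plusSide] z).NeBot := by
  obtain ⟨s, -, hs⟩ := exists_sign_curve hz h0
  exact neBot_of_curve fun ε h1 h2 => (hs ε h1 h2).1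

theorem neBot_minusSide {z : ℂ} (hz : z ∈ contour) (h0 : z ≠ 0) : (𝓝[minusSide] z).NeBot := by
  obtain ⟨s, -, hs⟩ := exists_sign_curve hz h0
  exact neBot_of_curve (s := -s) fun ε h1 h2 => (hs ε h1 h2).2

theorem plusSide_subset : plusSide ⊆ contourᶜ := fun z hz h =>
  (ne_of_gt (show 0 < (z ^ 3).im from hz)) ((mem_contour_iff z).1 h)

theorem minusSide_subset : minusSide ⊆ contourᶜ := fun z hz h =>
  (ne_of_lt (show (z ^ 3).im < 0 from hz)) ((mem_contour_iff z).1 h)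

/-- Near a point that is not a pole, the points off the contour are regular. -/
theorem eventually_mem_regularSet (D : ScatteringData) {z : ℂ} (hz : ∀ n, z ≠ D.pole n) :
    ∀ᶠ ζ in 𝓝 z, ζ ∉ contour → ζ ∈ D.regularSet := by
  have h : ∀ᶠ ζ in 𝓝 z, ∀ n, ζ ≠ D.pole n :=
    eventually_all.2 fun n => isOpen_compl_singleton.mem_nhds (hz n)
  filter_upwards [h] with ζ hζ hc using ⟨hc, hζ⟩

theorem eventually_nhdsNE_mem_regularSet (D : ScatteringData) {z : ℂ} (hz : z ∉ contour) :
    ∀ᶠ ζ in 𝓝[≠] z, ζ ∈ D.regularSet := by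
  have h1 : ∀ᶠ ζ in 𝓝[≠] z, ∀ m, ζ ≠ D.pole m := by
    refine eventually_all.2 fun m => ?_
    rcases eq_or_ne z (D.pole m) with h | h
    · rw [← h]; exact self_mem_nhdsWithin
    · exact nhdsWithin_le_nhds (isOpen_compl_singleton.mem_nhds h)
  filter_upwards [h1, nhdsWithin_le_nhds (contour_closed.isOpen_compl.mem_nhds hz)]
    with ζ h1 h2 using ⟨h2, h1⟩

theorem mem_regularSet_nhdsWithin (D : ScatteringData) {z : ℂ} (hz : z ∈ contour) {S : Set ℂ}
    (hS : S ⊆ contourᶜ) : D.regularSet ∈ 𝓝[S] z := by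
  filter_upwards [nhdsWithin_le_nhds (eventually_mem_regularSet D (z := z)
    fun n h => D.pole_notMem n (h ▸ hz)), self_mem_nhdsWithin] with ζ h1 h2 using h1 (hS h2)

theorem expQ_mul_expQ (a b c d : ℝ) (z : ℂ) :
    expQ a b z * expQ c d z = expQ (a + c) (b + d) z := by
  rw [expQ, expQ, expQ, Matrix.diagonal_mul_diagonal]
  congr 1; ext j
  rw [← Complex.exp_add]
  push_cast; ring_nf

theorem expQ_zero (z : ℂ) : expQ 0 0 z = 1 := by simp [expQ]

theorem mul_expQ_apply (A : Mat) (a b : ℝ) (z : ℂ) (i k : Fin 3) :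
    (A * expQ a b z) i k = A i k * Complex.exp (a * lam z k + b * (lam z k)⁻¹) := by
  rw [expQ, Matrix.mul_diagonal]

theorem differentiable_lam (k : Fin 3) : Differentiable ℂ fun z => lam z k := by
  unfold lam; fun_prop

theorem differentiableAt_exp_lam (a b : ℝ) {z : ℂ} (hz : z ≠ 0) (k : Fin 3) :
    DifferentiableAt ℂ (fun z => Complex.exp (a * lam z k + b * (lam z k)⁻¹)) z :=
  ((((differentiable_lam k) z).const_mul _).add
    ((((differentiable_lam k) z).inv (lam_ne_zero hz k)).const_mul _)).cexp

theorem tendsto_matrix {α : Type*} {f : α → Mat} {F : Filter α} {A : Mat} :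
    Tendsto f F (𝓝 A) ↔ ∀ i k, Tendsto (fun a => f a i k) F (𝓝 (A i k)) :=
  ⟨fun h i k => tendsto_pi_nhds.1 (tendsto_pi_nhds.1 h i) k,
    fun h => tendsto_pi_nhds.2 fun i => tendsto_pi_nhds.2 fun k => h i k⟩

theorem continuousAt_expQ (a b : ℝ) {z : ℂ} (hz : z ≠ 0) :
    Tendsto (expQ a b) (𝓝 z) (𝓝 (expQ a b z)) := by
  refine tendsto_matrix.2 fun i k => ?_
  rcases eq_or_ne i k with rfl | hik
  · simp only [expQ, Matrix.diagonal_apply_eq]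
    exact (differentiableAt_exp_lam a b hz i).continuousAt
  · simp only [expQ, Matrix.diagonal_apply_ne _ hik]
    exact tendsto_const_nhds

/-- The row `(1, 1, 1)` is the first row of `P`, so it is a left eigenvector with eigenvalue `q`.
Accordingly `q` cancels from the quotient that recovers `x`. -/
theorem sum_gaugeMat (q : ℝ) (k : Fin 3) : ∑ j, gaugeMat q j k = q := by
  have := omega_sq_add
  fin_cases k <;> simp [gaugeMat, Fin.sum_univ_three] <;> grind

theorem eventually_norm_mul_le (a : ℝ) :
    ∀ᶠ z : ℂ in 𝓝[contourᶜ] 0, ‖z‖ * a ≤ 1 / 2 := by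
  have : Tendsto (fun z : ℂ => ‖z‖ * a) (𝓝 0) (𝓝 0) := by
    have h : Continuous fun z : ℂ => ‖z‖ * a := by fun_prop
    simpa using h.tendsto 0
  exact nhdsWithin_le_nhds (this.eventually_le_const (by norm_num))

end Contour

/-! ### The explicit solution of the Riemann–Hilbert problem -/

section Solution

attribute [local instance] Matrix.linftyOpNormedRing Matrix.linftyOpNormedAlgebra

/-- The analytic factor that carries `M(0, z)` at time `0` to the point `x` at time `t`. -/
noncomputable def transMat (u₀ : ℝ → ℝ) (u : ℝ → ℝ → ℝ) (x t : ℝ) (z : ℂ) : Mat :=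
  gaugeMat (qOf (fun x' => u x' t) x) * timeMat u z x t * spaceMat u₀ z x * gaugeMat (qOf u₀ 0)⁻¹

/-- The solution of the Riemann--Hilbert problem at `y = y(x, t)`. -/
noncomputable def rhSol (u₀ : ℝ → ℝ) (u : ℝ → ℝ → ℝ) (M : ℝ → ℂ → Mat) (x t : ℝ) (z : ℂ) : Mat :=
  transMat u₀ u x t z * M 0 z * expQ (yOf u₀ 0 - yVar u x t) (-t) z

namespace IsSolution

variable {u₀ : ℝ → ℝ} {u : ℝ → ℝ → ℝ} (hu : IsSolution u₀ u) (hu₀ : IsInitialDatum u₀)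
include hu hu₀

theorem differentiableAt_transMat (x t : ℝ) {z : ℂ} (hz : z ≠ 0) (i k : Fin 3) :
    DifferentiableAt ℂ (fun z => transMat u₀ u x t z i k) z := by
  have h1 := hu.differentiableAt_timeMat hz x t
  have h2 := hu₀.isDecaying.differentiable_spaceMat x z
  have h3 := ((((differentiableAt_const (gaugeMat (qOf (fun x' => u x' t) x))).mul h1).mul h2).mul
    (differentiableAt_const (gaugeMat (qOf u₀ 0)⁻¹)))
  exact differentiableAt_matrix.1 h3 i k

theorem tendsto_transMat (x t : ℝ) {z : ℂ} (hz : z ≠ 0) :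
    Tendsto (transMat u₀ u x t) (𝓝 z) (𝓝 (transMat u₀ u x t z)) :=
  tendsto_matrix.2 fun i k => (hu.differentiableAt_transMat hu₀ x t hz i k).continuousAt

variable {M : ℝ → ℂ → Mat}

/-- At regular points, `rhSol` is a gauge transform of an eigenfunction at time `t`. -/
theorem exists_isJost_rhSol {z : ℂ} (hz : z ≠ 0) (hM : IsEigenfunction u₀ z fun x => M x z)
    (x : ℝ) {t : ℝ} (ht : 0 ≤ t) :
    ∃ f : ℝ → Mat, IsJost (fun _ => 1) (zeroPot (fun x' => u x' t) z) z f ∧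
      rhSol u₀ u M x t z = gaugeMat (qOf (fun x' => u x' t) x) * f x *
        Matrix.diagonal fun l => Complex.exp ((x - yVar u x t : ℝ) * lam z l) := by
  have hf := hu₀.isJost_zeroPot_of_gauge (hu₀.isJost_of_isEigenfunction hM)
  have hspec := hu₀.isDecaying.spaceMat_spec z
  have hcont := hu₀.isDecaying.continuous_potA
  obtain ⟨f, hfdef⟩ : ∃ f : ℝ → Mat, f = fun x => gaugeMat (qOf u₀ x)⁻¹ * M x z *
    Matrix.diagonal fun l => Complex.exp ((yOf u₀ x - x : ℝ) * lam z l) := ⟨_, rfl⟩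
  rw [← hfdef] at hf
  have hd := fun x => hf.hasDerivAt_mul_exp x
  refine ⟨_, hu.isJost_evolution hz hf ht, ?_⟩
  -- Both sides solve the `x`-equation at time `0` and agree at `x = 0`. This identifies the
  -- analytic transport of `M(0, z)` with the eigenfunction at `x`.
  have hsol : (f x * Matrix.diagonal fun l => Complex.exp (x * lam z l)) = spaceMat u₀ z x * f 0 := by
    refine linearODE_unique (R := Mat) (a := fun x => z • potA u₀ x) (b := fun _ => 0)
      (f := fun x : ℝ => f x * Matrix.diagonal fun l => Complex.exp (x * lam z l))
      (g := fun x => spaceMat u₀ z x * f 0) (hcont.const_smul z) (fun s => ?_) (fun s => ?_) ?_ x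
    · rw [add_zero]; exact hd s
    · rw [add_zero, ← mul_assoc]
      exact (hspec.2 s).mul_const (f 0)
    · simp [hspec.1]
  have e0 : f 0 = gaugeMat (qOf u₀ 0)⁻¹ * M 0 z * expQ (yOf u₀ 0) 0 z := by
    simp [hfdef, expQ]
  have e1 : spaceMat u₀ z x * (gaugeMat (qOf u₀ 0)⁻¹ * M 0 z)
      = f x * expQ (x - yOf u₀ 0) 0 z := by
    have h1 : f x * expQ x 0 z = spaceMat u₀ z x * f 0 := by
      rw [← hsol]; simp [expQ]
    have h2 := congrArg (fun A => A * expQ (-yOf u₀ 0) 0 z) h1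
    simp only [e0, mul_assoc, expQ_mul_expQ] at h2
    simp only [add_neg_cancel, add_zero, expQ_zero, mul_one] at h2
    rw [sub_eq_add_neg, h2]
  have e2 : (Matrix.diagonal fun l => Complex.exp (t * -(lam z l)⁻¹)) = expQ 0 (-t) z := by
    simp [expQ]
  have e3 : (Matrix.diagonal fun l => Complex.exp ((x - yVar u x t : ℝ) * lam z l))
      = expQ (x - yVar u x t) 0 z := by simp [expQ]
  rw [e2, e3, rhSol, transMat]
  have e4 : gaugeMat (qOf (fun x' => u x' t) x) * timeMat u z x t * spaceMat u₀ z x *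
      gaugeMat (qOf u₀ 0)⁻¹ * M 0 z = gaugeMat (qOf (fun x' => u x' t) x) * timeMat u z x t *
      (spaceMat u₀ z x * (gaugeMat (qOf u₀ 0)⁻¹ * M 0 z)) := by simp only [mul_assoc]
  rw [e4, e1]
  simp only [mul_assoc, expQ_mul_expQ]
  rw [show x - yOf u₀ 0 + (yOf u₀ 0 - yVar u x t) = 0 + (x - yVar u x t) by ring, zero_add (-t),
    add_zero (-t)]

/-- At regular points, `rhSol` is the value of an eigenfunction at time `t`. -/
theorem exists_isJost_frozen {z : ℂ} (hz : z ≠ 0) (hM : IsEigenfunction u₀ z fun x => M x z)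
    (x : ℝ) {t : ℝ} (ht : 0 ≤ t) :
    ∃ f : ℝ → Mat, IsJost (qOf fun x' => u x' t) (UOf fun x' => u x' t) z f ∧
      rhSol u₀ u M x t z = f x := by
  obtain ⟨f, hf, e⟩ := hu.exists_isJost_rhSol hu₀ hz hM x ht
  exact ⟨_, (hu.isInitialDatum hu₀ ht).isJost_gauge_of_zeroPot hf, e⟩

theorem det_rhSol {z : ℂ} (hz : z ≠ 0) (hM : IsEigenfunction u₀ z fun x => M x z)
    (x : ℝ) {t : ℝ} (ht : 0 ≤ t) : (rhSol u₀ u M x t z).det = 1 := by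
  obtain ⟨f, hf, e⟩ := hu.exists_isJost_frozen hu₀ hz hM x ht
  rw [e]
  exact hf.det_eq_one (hu.isInitialDatum hu₀ ht).trace_UOf x

variable {D : ScatteringData}

theorem exists_family_rhSol
    (hM : ∀ z ∈ D.regularSet, IsEigenfunction u₀ z (fun x => M x z) ∧
      ∀ M' : ℝ → Mat, IsEigenfunction u₀ z M' → ∀ x, M' x = M x z) (x : ℝ) {t : ℝ} (ht : 0 ≤ t) :
    ∃ f : ℂ → ℝ → Mat, ∀ z ∈ D.regularSet,
      IsJost (fun _ => 1) (zeroPot (fun x' => u x' t) z) z (f z) ∧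
      rhSol u₀ u M x t z = gaugeMat (qOf (fun x' => u x' t) x) * f z x *
        Matrix.diagonal fun l => Complex.exp ((x - yVar u x t : ℝ) * lam z l) := by
  have : ∀ z, ∃ f : ℝ → Mat, z ∈ D.regularSet →
      IsJost (fun _ => 1) (zeroPot (fun x' => u x' t) z) z f ∧
      rhSol u₀ u M x t z = gaugeMat (qOf (fun x' => u x' t) x) * f x *
        Matrix.diagonal fun l => Complex.exp ((x - yVar u x t : ℝ) * lam z l) := fun z => by
    by_cases hz : z ∈ D.regularSet
    · obtain ⟨f, hf⟩ := hu.exists_isJost_rhSol hu₀ (ne_zero_of_notMem_contour hz.1) (hM z hz).1 x ht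
      exact ⟨f, fun _ => hf⟩
    · exact ⟨fun _ => 0, fun h => absurd h hz⟩
  choose f hf using this
  exact ⟨f, hf⟩

/-- In the gauge adapted to `z = 0` the normalized solution and the phase both tend to `1`, so only
the gauge matrix is left in the limit. -/
theorem tendsto_rhSol_zero
    (hM : ∀ z ∈ D.regularSet, IsEigenfunction u₀ z (fun x => M x z) ∧
      ∀ M' : ℝ → Mat, IsEigenfunction u₀ z M' → ∀ x, M' x = M x z) (x : ℝ) {t : ℝ} (ht : 0 ≤ t) :
    Tendsto (rhSol u₀ u M x t) (𝓝[contourᶜ] 0) (𝓝 (gaugeMat (qOf (fun x' => u x' t) x))) := by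
  have hI := hu.isInitialDatum hu₀ ht
  obtain ⟨f, hf⟩ := hu.exists_family_rhSol hu₀ hM x ht
  have hmem := mem_regularSet_nhdsWithin D zero_mem_contour (S := contourᶜ) subset_rfl
  have h1 : Tendsto (fun z => f z x) (𝓝[contourᶜ] 0) (𝓝 1) := by
    refine tendsto_matrix.2 fun j l => ?_
    rw [tendsto_iff_norm_sub_tendsto_zero]
    have hb : Tendsto (fun z : ℂ => ‖z‖ * (∫ ξ, |iteratedDeriv 2 (fun x' => u x' t) ξ|) * 2)
        (𝓝[contourᶜ] 0) (𝓝 0) := by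
      have h : Continuous fun z : ℂ => ‖z‖ * (∫ ξ, |iteratedDeriv 2 (fun x' => u x' t) ξ|) * 2 := by
        fun_prop
      simpa using (h.tendsto 0).mono_left nhdsWithin_le_nhds
    refine tendsto_of_tendsto_of_tendsto_of_le_of_le' tendsto_const_nhds hb
      (Eventually.of_forall fun _ => norm_nonneg _) ?_
    filter_upwards [hmem, eventually_norm_mul_le (∫ ξ, |iteratedDeriv 2 (fun x' => u x' t) ξ|)]
      with z hz hz2
    exact hI.isJost_norm_sub_one_le_zero (hf z hz).1 hz2 x j l
  have h2 : Tendsto (fun z : ℂ => (Matrix.diagonal fun l =>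
      Complex.exp ((x - yVar u x t : ℝ) * lam z l) : Mat)) (𝓝[contourᶜ] 0) (𝓝 1) := by
    have hc : Continuous fun z : ℂ => (Matrix.diagonal fun l =>
      Complex.exp ((x - yVar u x t : ℝ) * lam z l) : Mat) :=
      Continuous.matrix_diagonal (continuous_pi fun l => by
        have := continuous_lam l
        fun_prop)
    have h := (hc.tendsto 0).mono_left (nhdsWithin_le_nhds (s := contourᶜ))
    simpa [lam] using h
  have h3 := (h1.const_mul (gaugeMat (qOf (fun x' => u x' t) x))).mul h2
  rw [mul_one, mul_one] at h3
  refine h3.congr' ?_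
  filter_upwards [hmem] with z hz using (hf z hz).2.symm

/-- The behaviour of the column sums of `rhSol` at `z = 0`, from which `x` is recovered. -/
theorem tendsto_sum_rhSol
    (hM : ∀ z ∈ D.regularSet, IsEigenfunction u₀ z (fun x => M x z) ∧
      ∀ M' : ℝ → Mat, IsEigenfunction u₀ z M' → ∀ x, M' x = M x z) (x : ℝ) {t : ℝ} (ht : 0 ≤ t) :
    Tendsto (fun z : ℂ => ((∑ j, rhSol u₀ u M x t z j 2) /
        (∑ j, gaugeMat (qOf (fun x' => u x' t) x) j 2) - 1) * (1 / z))
      (𝓝[contourᶜ] 0) (𝓝 ((x - yVar u x t : ℝ) : ℂ)) := by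
  have hI := hu.isInitialDatum hu₀ ht
  obtain ⟨f, hf⟩ := hu.exists_family_rhSol hu₀ hM x ht
  have hmem := mem_regularSet_nhdsWithin D zero_mem_contour (S := contourᶜ) subset_rfl
  set c : ℂ := ((x - yVar u x t : ℝ) : ℂ) with hc
  have hq : ((qOf (fun x' => u x' t) x : ℝ) : ℂ) ≠ 0 := by exact_mod_cast (hI.qOf_pos x).ne'
  have h0 : (𝓝[contourᶜ] (0 : ℂ)) ≤ 𝓝[≠] 0 :=
    nhdsWithin_mono 0 fun z hz => ne_zero_of_notMem_contour hz
  -- Since `λ₃(z) = z`, the normalized third column sum is `s e^{cz}` with `s = ∑ f_{j3}` and `c = x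
  -- - y`. The quotient splits as `((s - 1)/z) e^{cz} + (e^{cz} - 1)/z`, and the first summand tends
  -- to `0` because `s = 1 + o(z)`.
  have h1 : Tendsto (fun z => (∑ j, f z x j 2 - 1) / z) (𝓝[contourᶜ] 0) (𝓝 0) := by
    rw [tendsto_zero_iff_norm_tendsto_zero]
    have hn0 : Tendsto (fun z : ℂ => ‖z‖) (𝓝[contourᶜ] 0) (𝓝 0) := by
      have := (continuous_norm.tendsto (0 : ℂ)).mono_left
        (nhdsWithin_le_nhds (s := contourᶜ))
      simpa using this
    have hn : Tendsto (fun z : ℂ => ‖z‖) (𝓝[contourᶜ] 0) (𝓝[≥] 0) :=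
      tendsto_nhdsWithin_iff.2 ⟨hn0, Eventually.of_forall fun z => norm_nonneg z⟩
    refine tendsto_of_tendsto_of_tendsto_of_le_of_le' tendsto_const_nhds
      ((hI.tendsto_zeroWeight x).comp hn) (Eventually.of_forall fun _ => norm_nonneg _) ?_
    filter_upwards [hmem, eventually_norm_mul_le (∫ ξ, |iteratedDeriv 2 (fun x' => u x' t) ξ|)]
      with z hz hz2
    have hz0 : 0 < ‖z‖ := norm_pos_iff.2 (ne_zero_of_notMem_contour hz.1)
    rw [norm_div, div_le_iff₀ hz0, mul_comm]
    exact hI.norm_sum_sub_one_le (hf z hz).1 hz2 x 2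
  have hexp : HasDerivAt (fun z : ℂ => Complex.exp (c * z)) c 0 := by
    simpa using ((hasDerivAt_id (0 : ℂ)).const_mul c).cexp
  have h2 : Tendsto (fun z => (Complex.exp (c * z) - 1) / z) (𝓝[contourᶜ] 0) (𝓝 c) := by
    have := (hasDerivAt_iff_tendsto_slope.1 hexp).mono_left h0
    refine this.congr fun z => ?_
    rw [slope_def_field]; simp
  have h3 : Tendsto (fun z => Complex.exp (c * z)) (𝓝[contourᶜ] 0) (𝓝 1) := by
    have := hexp.continuousAt.tendsto.mono_left (nhdsWithin_le_nhds (s := contourᶜ))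
    simpa using this
  have h4 := (h1.mul h3).add h2
  rw [zero_mul, zero_add] at h4
  refine h4.congr' ?_
  filter_upwards [hmem] with z hz
  have hz0 := ne_zero_of_notMem_contour hz.1
  have e : ∑ j, rhSol u₀ u M x t z j 2
      = qOf (fun x' => u x' t) x * (∑ j, f z x j 2) * Complex.exp (c * z) := by
    rw [(hf z hz).2]
    simp only [Matrix.mul_diagonal, lam_two]
    rw [← Finset.sum_mul]
    simp only [Matrix.mul_apply]
    rw [Finset.sum_comm]
    simp only [← Finset.sum_mul, sum_gaugeMat, ← Finset.mul_sum, hc]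
  rw [e, sum_gaugeMat]
  field_simp
  ring

/-- The left factor `transMat` is analytic off `0`, so jump and residue relations are inherited from
`M(0, ·)`; the right exponential factor changes `y₀(0)` and time `0` in them into `y(x, t)` and `t`.
At `0` and `∞`, where `transMat` gives no information, `rhSol` is instead regarded as a normalized
solution at time `t`. -/
theorem isRHSolution_rhSol
    (hM : ∀ z ∈ D.regularSet, IsEigenfunction u₀ z (fun x => M x z) ∧
      ∀ M' : ℝ → Mat, IsEigenfunction u₀ z M' → ∀ x, M' x = M x z)
    (hlim : ∀ x, ∀ z ∈ contour, z ≠ 0 →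
      (∃ Mp, Tendsto (M x) (𝓝[plusSide] z) (𝓝 Mp)) ∧
      (∃ Mm, Tendsto (M x) (𝓝[minusSide] z) (𝓝 Mm)))
    (hS : ∀ z ∈ contour, z ≠ 0 → ∀ Mp Mm : Mat,
      Tendsto (M 0) (𝓝[plusSide] z) (𝓝 Mp) → Tendsto (M 0) (𝓝[minusSide] z) (𝓝 Mm) →
      D.S₀ z = expQ (-yOf u₀ 0) 0 z * Mm⁻¹ * Mp * expQ (yOf u₀ 0) 0 z)
    (hreg : ∀ n x i k, k ≠ D.col n → ContinuousAt (fun z => M x z i k) (D.pole n))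
    (hres : ∀ n x i, Tendsto (fun z => (z - D.pole n) * M x z i (D.col n)) (𝓝[≠] D.pole n)
      (𝓝 (M x (D.pole n) i (D.src n) * D.resFactor n (yOf u₀ x) 0)))
    (x : ℝ) {t : ℝ} (ht : 0 ≤ t) : IsRHSolution D (yVar u x t) t (rhSol u₀ u M x t) := by
  have hreg0 : ∀ z ∈ D.regularSet, z ≠ 0 := fun z hz => ne_zero_of_notMem_contour hz.1
  have hpole0 : ∀ n, D.pole n ≠ 0 := fun n => ne_zero_of_notMem_contour (D.pole_notMem n)
  have hMd : ∀ z ∈ D.regularSet, ∀ i k, DifferentiableAt ℂ (fun z => M 0 z i k) z :=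
    fun z hz i k => hu₀.differentiableAt_of_isEigenfunction hM hz 0 i k
  have hMcol : ∀ i k z, z ∉ contour → (∀ n, D.col n = k → z ≠ D.pole n) →
      DifferentiableAt ℂ (fun z => M 0 z i k) z := by
    intro i k z hz hn
    -- At a pole belonging to another column, column `k` is continuous and holomorphic in a
    -- punctured neighbourhood, so the singularity is removable.
    by_cases hzr : z ∈ D.regularSet
    · exact hMd z hzr i k
    obtain ⟨n, hzn⟩ : ∃ n, z = D.pole n := by
      by_contra! h
      exact hzr ⟨hz, h⟩
    have hk : k ≠ D.col n := fun h => hn n h.symm hzn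
    have hc := hreg n 0 i k hk
    rw [← hzn] at hc
    have hev : ∀ᶠ ζ in 𝓝[≠] z, DifferentiableAt ℂ (fun z => M 0 z i k) ζ :=
      (eventually_nhdsNE_mem_regularSet D hz).mono fun ζ hζ => hMd ζ hζ i k
    exact (Complex.analyticAt_of_differentiable_on_punctured_nhds_of_continuousAt hev hc).differentiableAt
  have happ : ∀ z i k, rhSol u₀ u M x t z i k = (∑ j, transMat u₀ u x t z i j * M 0 z j k)
      * Complex.exp ((yOf u₀ 0 - yVar u x t : ℝ) * lam z k + (-t : ℝ) * (lam z k)⁻¹) := by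
    intro z i k
    rw [rhSol, mul_expQ_apply, Matrix.mul_apply]
  refine ⟨fun i k z hz => ?_, fun z hz h0 => ?_, fun n i => ?_, ?_, ?_⟩
  · refine DifferentiableAt.differentiableWithinAt ?_
    have hz0 := ne_zero_of_notMem_contour hz.1
    simp only [happ]
    refine DifferentiableAt.mul ?_ (differentiableAt_exp_lam _ _ hz0 k)
    exact DifferentiableAt.fun_sum fun j _ =>
      (hu.differentiableAt_transMat hu₀ x t hz0 i j).mul (hMcol j k z hz.1 hz.2)
  · obtain ⟨⟨Mp, hMp⟩, ⟨Mm, hMm⟩⟩ := hlim 0 z hz h0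
    have := neBot_minusSide hz h0
    -- The determinant of the boundary value is the limit of determinants equal to `1`. This makes
    -- `Mm⁻¹` a genuine inverse and not the default value.
    have hdet : Mm.det = 1 := by
      have h1 : Tendsto (fun ζ => (M 0 ζ).det) (𝓝[minusSide] z) (𝓝 Mm.det) :=
        ((Continuous.matrix_det continuous_id).tendsto Mm).comp hMm
      have h2 : Tendsto (fun ζ => (M 0 ζ).det) (𝓝[minusSide] z) (𝓝 1) := by
        refine tendsto_const_nhds.congr' ?_
        filter_upwards [mem_regularSet_nhdsWithin D hz minusSide_subset] with ζ hζ
        exact ((hu₀.isJost_of_isEigenfunction (hM ζ hζ).1).det_eq_one hu₀.trace_UOf 0).symm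
      exact tendsto_nhds_unique h1 h2
    have hlimF : ∀ {S : Set ℂ} {N : Mat}, Tendsto (M 0) (𝓝[S] z) (𝓝 N) →
        Tendsto (rhSol u₀ u M x t) (𝓝[S] z)
          (𝓝 (transMat u₀ u x t z * N * expQ (yOf u₀ 0 - yVar u x t) (-t) z)) := fun hN =>
      (((hu.tendsto_transMat hu₀ x t h0).mono_left nhdsWithin_le_nhds).mul hN).mul
        ((continuousAt_expQ _ _ h0).mono_left nhdsWithin_le_nhds)
    refine ⟨_, _, hlimF hMp, hlimF hMm, ?_⟩
    have hinv : Mm * Mm⁻¹ = 1 := Matrix.mul_nonsing_inv _ (by rw [hdet]; exact isUnit_one)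
    rw [ScatteringData.jump, hS z hz h0 Mp Mm hMp hMm]
    have e1 : transMat u₀ u x t z * Mm * expQ (yOf u₀ 0 - yVar u x t) (-t) z *
        (expQ (yVar u x t) t z * (expQ (-yOf u₀ 0) 0 z * Mm⁻¹ * Mp * expQ (yOf u₀ 0) 0 z) *
          expQ (-yVar u x t) (-t) z)
        = transMat u₀ u x t z * Mm * (expQ (yOf u₀ 0 - yVar u x t) (-t) z * expQ (yVar u x t) t z
          * expQ (-yOf u₀ 0) 0 z) * Mm⁻¹ * Mp *
            (expQ (yOf u₀ 0) 0 z * expQ (-yVar u x t) (-t) z) := by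
      simp only [mul_assoc]
    rw [e1]
    simp only [expQ_mul_expQ]
    have e2 : yOf u₀ 0 - yVar u x t + yVar u x t + -yOf u₀ 0 = 0 := by ring
    have e3 : -t + t + 0 = 0 := by ring
    rw [e2, e3, expQ_zero, mul_one, mul_assoc (transMat u₀ u x t z) Mm, hinv, mul_one, zero_add,
      ← sub_eq_add_neg]
  · have hp := hpole0 n
    simp only [happ]
    have h1 : ∀ j, Tendsto (fun z => transMat u₀ u x t z i j) (𝓝[≠] D.pole n)
        (𝓝 (transMat u₀ u x t (D.pole n) i j)) := fun j =>
      (hu.differentiableAt_transMat hu₀ x t hp i j).continuousAt.mono_left nhdsWithin_le_nhds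
    have h2 := ((differentiableAt_exp_lam (yOf u₀ 0 - yVar u x t) (-t) hp
      (D.col n)).continuousAt.mono_left nhdsWithin_le_nhds : Tendsto _ (𝓝[≠] D.pole n) _)
    have h3 := (tendsto_finsetSum Finset.univ fun j _ => (h1 j).mul (hres n 0 j)).mul h2
    have e : ∀ a : ℂ, a * D.resFactor n (yOf u₀ 0) 0 * Complex.exp
        ((yOf u₀ 0 - yVar u x t : ℝ) * lam (D.pole n) (D.col n)
          + (-t : ℝ) * (lam (D.pole n) (D.col n))⁻¹)
        = a * Complex.exp ((yOf u₀ 0 - yVar u x t : ℝ) * lam (D.pole n) (D.src n)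
          + (-t : ℝ) * (lam (D.pole n) (D.src n))⁻¹) * D.resFactor n (yVar u x t) t := by
      intro a
      rw [ScatteringData.resFactor, ScatteringData.resFactor]
      have : ∀ b c d e v : ℂ, b + c = d + e → a * (v * Complex.exp b) * Complex.exp c
          = a * Complex.exp d * (v * Complex.exp e) := by
        intro b c d e v hbc
        have h := congrArg Complex.exp hbc
        rw [Complex.exp_add, Complex.exp_add] at h
        linear_combination a * v * h
      apply this
      push_cast
      ring
    have s1 : ∀ (a b : Fin 3 → ℂ) (c : ℂ), ∑ j, a j * (c * b j) = c * ∑ j, a j * b j :=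
      fun a b c => by rw [Finset.mul_sum]; exact Finset.sum_congr rfl fun j _ => by ring
    have s2 : ∀ (a b : Fin 3 → ℂ) (c : ℂ), ∑ j, a j * (b j * c) = (∑ j, a j * b j) * c :=
      fun a b c => by rw [Finset.sum_mul]; exact Finset.sum_congr rfl fun j _ => by ring
    refine (h3.congr fun z => ?_).trans_eq ?_
    · rw [s1]; ring
    · congr 1
      simp only [s2]
      exact e _
  · have h0 := hu.tendsto_rhSol_zero hu₀ hM x ht
    obtain ⟨C, hC0, hC⟩ := exists_norm_apply_le (gaugeMat (qOf (fun x' => u x' t) x))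
    have h1 : ∀ᶠ z in 𝓝[contourᶜ] 0, ∀ i k, ‖rhSol u₀ u M x t z i k‖ < C + 1 :=
      eventually_all.2 fun i => eventually_all.2 fun k =>
        ((tendsto_matrix.1 h0 i k).norm).eventually_lt_const (by linarith [hC i k])
    obtain ⟨r, hr, h2⟩ := Metric.mem_nhdsWithin_iff.1 h1
    exact ⟨C + 1, r, hr, fun z hz hzr i k =>
      (h2 ⟨by rwa [mem_ball_zero_iff], hz⟩ : ∀ i k, _) i k |>.le⟩
  · obtain ⟨C, R, hR, h1⟩ := (hu.isInitialDatum hu₀ ht).isJost_norm_sub_one_le_infty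
    -- No pole has modulus larger than the sum of the moduli of all poles, so every point considered
    -- is regular.
    refine ⟨C, max R (∑ n, ‖D.pole n‖), fun z hz hzR i k => ?_⟩
    have hzr : z ∈ D.regularSet := ⟨hz, fun n h => by
      have h2 := Finset.single_le_sum (f := fun n => ‖D.pole n‖) (fun _ _ => norm_nonneg _)
        (Finset.mem_univ n)
      rw [h] at hzR
      exact absurd ((le_max_right R _).trans_lt hzR) (not_lt.2 h2)⟩
    obtain ⟨f, hf, e⟩ := hu.exists_isJost_frozen hu₀ (hreg0 z hzr) (hM z hzr).1 x ht
    rw [e]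
    exact h1 z ((le_max_left _ _).trans_lt hzR) f hf x i k

end IsSolution

end Solution

/-! ### Removable singularities across the contour, and a Liouville theorem -/

section Removable

/-- A continuous function on a disc centred on the real axis that is holomorphic off the real axis
is holomorphic. -/
theorem differentiableOn_ball_of_im_ne_zero {r : ℝ} {f : ℂ → ℂ}
    (hc : ContinuousOn f (Metric.ball 0 r))
    (hd : ∀ z ∈ Metric.ball (0 : ℂ) r, z.im ≠ 0 → DifferentiableAt ℂ f z) :
    DifferentiableOn ℂ f (Metric.ball 0 r) := by
  refine (Complex.isConservativeOn_and_continuousOn_iff_isDifferentiableOn Metric.isOpen_ball).1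
    ⟨fun z w hzw => ?_, hc⟩
  -- Morera's criterion: it is enough that integrals over boundaries of rectangles vanish.
  rw [← add_eq_zero_iff_eq_neg, Complex.wedgeIntegral_add_wedgeIntegral_eq]
  have hsub : ∀ b : ℝ, b ∈ Set.uIcc z.im w.im →
      Set.uIcc z.re w.re ×ℂ Set.uIcc b 0 ⊆ Metric.ball (0 : ℂ) r := by
    intro b hb p hp
    rw [Complex.mem_reProdIm] at hp
    have h1 : (⟨p.re, b⟩ : ℂ) ∈ Metric.ball (0 : ℂ) r :=
      hzw (Complex.mem_reProdIm.2 ⟨hp.1, hb⟩)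
    rw [mem_ball_zero_iff] at h1 ⊢
    refine lt_of_le_of_lt ?_ h1
    rw [Complex.norm_def, Complex.norm_def]
    refine Real.sqrt_le_sqrt ?_
    rw [Complex.normSq_apply, Complex.normSq_apply]
    have h2 : |p.im| ≤ |b| := by
      have := Set.abs_sub_right_of_mem_uIcc hp.2
      simpa using this
    have := sq_le_sq.2 h2
    nlinarith
  -- A rectangle with one edge on the real axis has its interior off the axis, so Cauchy's theorem
  -- applies to it. A general rectangle is the difference of two such.
  have hrect : ∀ b ∈ Set.uIcc z.im w.im,
      (((∫ x : ℝ in z.re..w.re, f (x + b * Complex.I)) -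
        ∫ x : ℝ in z.re..w.re, f (x + (0 : ℝ) * Complex.I)) +
          Complex.I • ∫ y : ℝ in b..0, f (w.re + y * Complex.I)) -
            Complex.I • ∫ y : ℝ in b..0, f (z.re + y * Complex.I) = 0 := by
    intro b hb
    have h := Complex.integral_boundary_rect_eq_zero_of_continuousOn_of_differentiableOn f
      ⟨z.re, b⟩ ⟨w.re, 0⟩ (hc.mono (hsub b hb)) fun p hp => ?_
    · exact h
    · rw [Complex.mem_reProdIm] at hp
      refine (hd p (hsub b hb ?_) fun h0 => ?_).differentiableWithinAt
      · exact Complex.mem_reProdIm.2 ⟨Set.Ioo_subset_Icc_self hp.1, Set.Ioo_subset_Icc_self hp.2⟩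
      · have := hp.2
        rw [h0] at this
        rcases le_total b 0 with h | h
        · simp [max_eq_right h] at this
        · simp [min_eq_right h] at this
  have hint : ∀ a ∈ Set.uIcc z.re w.re, ∀ b ∈ Set.uIcc z.im w.im,
      IntervalIntegrable (fun y : ℝ => f (a + y * Complex.I)) volume b 0 := by
    intro a ha b hb
    refine ContinuousOn.intervalIntegrable (hc.comp (by fun_prop) fun y hy => hsub b hb ?_)
    exact Complex.mem_reProdIm.2 ⟨by simpa using ha, by simpa using hy⟩
  have hadd : ∀ a ∈ Set.uIcc z.re w.re, ∫ y : ℝ in z.im..w.im, f (a + y * Complex.I)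
      = (∫ y : ℝ in z.im..0, f (a + y * Complex.I)) - ∫ y : ℝ in w.im..0, f (a + y * Complex.I) :=
    fun a ha => by
      rw [← intervalIntegral.integral_add_adjacent_intervals (hint a ha _ Set.left_mem_uIcc)
        (hint a ha _ Set.right_mem_uIcc).symm, intervalIntegral.integral_symm 0 w.im]
      ring
  have h1 := hrect z.im Set.left_mem_uIcc
  have h2 := hrect w.im Set.right_mem_uIcc
  rw [hadd _ Set.left_mem_uIcc, hadd _ Set.right_mem_uIcc]
  simp only [smul_eq_mul] at h1 h2 ⊢
  linear_combination h1 - h2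

/-- Near a point `z ≠ 0` of the contour, the contour is the line through `0` and `z`. -/
theorem mul_one_add_notMem_contour {z s : ℂ} (hz : z ∈ contour) (h0 : z ≠ 0) (hs : ‖s‖ < 1 / 2)
    (him : s.im ≠ 0) : z * (1 + s) ∉ contour := by
  rw [mem_contour_iff] at hz ⊢
  have hre : (z ^ 3).re ≠ 0 := fun h => pow_ne_zero 3 h0 (Complex.ext h hz)
  rw [mul_pow, Complex.mul_im, hz, zero_mul, add_zero]
  refine mul_ne_zero hre ?_
  have e : ((1 + s) ^ 3).im = s.im * (3 * (1 + s.re) ^ 2 - s.im ^ 2) := by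
    simp [pow_succ]; ring
  rw [e]
  refine mul_ne_zero him ?_
  have h1 := abs_lt.1 ((Complex.abs_re_le_norm s).trans_lt hs)
  have h2 := abs_lt.1 ((Complex.abs_im_le_norm s).trans_lt hs)
  nlinarith

theorem mem_closure_regularSet (D : ScatteringData) {z : ℂ} (h0 : z ≠ 0) :
    z ∈ closure D.regularSet := by
  by_cases hz : z ∈ contour
  · have := neBot_plusSide hz h0
    exact mem_closure_iff_nhdsWithin_neBot.2 <| NeBot.mono this <|
      le_inf nhdsWithin_le_nhds (le_principal_iff.2
        (mem_regularSet_nhdsWithin D hz plusSide_subset))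
  · rw [mem_closure_iff_frequently]
    exact (eventually_nhdsNE_mem_regularSet D hz).frequently.filter_mono nhdsWithin_le_nhds

/-- Liouville's theorem for functions that are holomorphic off the contour and the poles, extend
continuously to all points other than `0`, and are bounded near `0`. -/
theorem eq_of_tendsto_cocompact (D : ScatteringData) {H : ℂ → ℂ} {c : ℂ}
    (hd : ∀ z ∈ D.regularSet, DifferentiableAt ℂ H z)
    (hc : ∀ z, z ≠ 0 → ∃ y, Tendsto H (𝓝[D.regularSet] z) (𝓝 y))
    (hb : ∃ C r : ℝ, 0 < r ∧ ∀ z ∈ D.regularSet, ‖z‖ < r → ‖H z‖ ≤ C)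
    (hinf : Tendsto H (cocompact ℂ ⊓ 𝓟 D.regularSet) (𝓝 c)) {z : ℂ} (hz : z ∈ D.regularSet) :
    H z = c := by
  -- `G` is the continuous extension to all `z ≠ 0`. It is then shown to be holomorphic across the
  -- rays and at the poles, and lastly at `0` by boundedness.
  set G := extendFrom D.regularSet H with hG
  have hcl : ∀ z, z ≠ 0 → z ∈ closure D.regularSet := fun z h => mem_closure_regularSet D h
  have hGc : ContinuousOn G {0}ᶜ := continuousOn_extendFrom (fun z h => hcl z h) fun z h => hc z h
  have hGat : ∀ z, z ≠ 0 → ContinuousAt G z := fun z h =>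
    hGc.continuousAt (isOpen_compl_singleton.mem_nhds h)
  have hGt : ∀ z, z ≠ 0 → Tendsto H (𝓝[D.regularSet] z) (𝓝 (G z)) := fun z h => by
    obtain ⟨y, hy⟩ := hc z h
    rwa [hG, extendFrom_eq (hcl z h) hy]
  have hGH : ∀ z ∈ D.regularSet, G z = H z := fun z hz =>
    extendFrom_eq (subset_closure hz) ((hd z hz).continuousAt.mono_left nhdsWithin_le_nhds)
  have hGd : ∀ z ∈ D.regularSet, DifferentiableAt ℂ G z := fun z hz =>
    (hd z hz).congr_of_eventuallyEq
      (by filter_upwards [(isOpen_regularSet D).mem_nhds hz] with ζ hζ using hGH ζ hζ)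
  have hGd' : ∀ z, z ≠ 0 → DifferentiableAt ℂ G z := by
    intro z h0
    by_cases hz : z ∈ contour
    · obtain ⟨r, hr, hball⟩ := Metric.eventually_nhds_iff_ball.1
        (eventually_mem_regularSet D (z := z) fun n h => D.pole_notMem n (h ▸ hz))
      set ρ : ℝ := min (1 / 2) (r / ‖z‖) with hρ
      have hz0 : 0 < ‖z‖ := norm_pos_iff.2 h0
      have hρ0 : 0 < ρ := lt_min (by norm_num) (by positivity)
      have hne : ∀ s ∈ Metric.ball (0 : ℂ) ρ, z * (1 + s) ≠ 0 := by
        intro s hs h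
        rw [mem_ball_zero_iff] at hs
        have h1 : s = -1 := by
          have := (mul_eq_zero.1 h).resolve_left h0
          linear_combination this
        have h2 := hs.trans_le (min_le_left _ _)
        rw [h1] at h2
        norm_num at h2
      -- The coordinate `s = ζ / z - 1` straightens the contour near `z` to the real axis. The
      -- radius `ρ` keeps `ζ` away from `0`, from the other rays and from the poles.
      have hg : DifferentiableOn ℂ (fun s => G (z * (1 + s))) (Metric.ball 0 ρ) := by
        refine differentiableOn_ball_of_im_ne_zero
          (hGc.comp (by fun_prop) fun s hs => hne s hs) fun s hs him => ?_
        rw [mem_ball_zero_iff] at hs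
        have h1 := mul_one_add_notMem_contour hz h0 (hs.trans_le (min_le_left _ _)) him
        have h2 : z * (1 + s) ∈ D.regularSet := by
          refine hball _ ?_ h1
          rw [mem_ball_iff_norm, show z * (1 + s) - z = s * z by ring, norm_mul]
          exact (lt_div_iff₀ hz0).1 (hs.trans_le (min_le_right _ _))
        exact DifferentiableAt.comp (g := G) (f := fun s => z * (1 + s)) s (hGd _ h2) (by fun_prop)
      have hg0 : DifferentiableAt ℂ (fun s => G (z * (1 + s))) (z / z - 1) := by
        rw [div_self h0, sub_self]
        exact hg.differentiableAt (Metric.ball_mem_nhds 0 hρ0)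
      have h3 : DifferentiableAt ℂ (fun ζ : ℂ => ζ / z - 1) z := by fun_prop
      have h4 := DifferentiableAt.comp z hg0 h3
      refine h4.congr_of_eventuallyEq (Eventually.of_forall fun ζ => ?_)
      simp only [Function.comp]
      congr 1
      field_simp
      ring
    · refine (Complex.analyticAt_of_differentiable_on_punctured_nhds_of_continuousAt ?_
        (hGat z h0)).differentiableAt
      exact (eventually_nhdsNE_mem_regularSet D hz).mono hGd
  have hclosed : ∀ {z : ℂ} {S : Set ℂ}, z ≠ 0 → IsClosed S →
      (∀ᶠ ζ in 𝓝[D.regularSet] z, H ζ ∈ S) → G z ∈ S := by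
    intro z S h0 hS hev
    have := mem_closure_iff_nhdsWithin_neBot.1 (hcl z h0)
    exact hS.mem_of_tendsto (hGt z h0) hev
  obtain ⟨C, r, hr, hC⟩ := hb
  -- `E` is entire, and its limit at infinity makes it constant.
  set E := Function.update G 0 ((𝓝[≠] 0).limUnder G) with hE
  have hEG : ∀ z, z ≠ 0 → E z = G z := fun z h => Function.update_of_ne h _ _
  have hEd : Differentiable ℂ E := by
    intro z
    rcases eq_or_ne z 0 with rfl | h0
    · have hball := Metric.ball_mem_nhds (0 : ℂ) hr
      refine (Complex.differentiableOn_update_limUnder_of_bddAbove hball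
        (fun ζ hζ => (hGd' ζ hζ.2).differentiableWithinAt) ⟨C, ?_⟩).differentiableAt hball
      rintro _ ⟨ζ, hζ, rfl⟩
      have h1 := hclosed (z := ζ) (S := Metric.closedBall 0 C) hζ.2 Metric.isClosed_closedBall (by
        filter_upwards [self_mem_nhdsWithin,
          nhdsWithin_le_nhds (Metric.isOpen_ball.mem_nhds hζ.1)] with ξ h1 h2
        exact mem_closedBall_zero_iff.2 (hC ξ h1 (mem_ball_zero_iff.1 h2)))
      exact mem_closedBall_zero_iff.1 h1
    · refine (hGd' z h0).congr_of_eventuallyEq ?_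
      filter_upwards [isOpen_compl_singleton.mem_nhds h0] with ζ hζ using hEG ζ hζ
  have hEt : Tendsto E (cocompact ℂ) (𝓝 c) := by
    refine (Metric.nhds_basis_closedBall.tendsto_right_iff).2 fun ε hε => ?_
    have h1 := hinf.eventually (Metric.closedBall_mem_nhds c hε)
    rw [eventually_inf_principal, ← Metric.cobounded_eq_cocompact] at h1
    rw [← Metric.cobounded_eq_cocompact]
    obtain ⟨R, -, hR⟩ := (hasBasis_cobounded_norm (E := ℂ)).eventually_iff.1 h1
    filter_upwards [(Bornology.eventually_ne_cobounded (0 : ℂ)),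
      tendsto_norm_cobounded_atTop.eventually_gt_atTop R] with z h0 hz
    rw [hEG z h0]
    refine hclosed h0 Metric.isClosed_closedBall ?_
    filter_upwards [self_mem_nhdsWithin, nhdsWithin_le_nhds
      ((isOpen_lt continuous_const continuous_norm).mem_nhds hz)] with ζ h1 h2
    exact hR (le_of_lt h2) h1
  have hz0 := ne_zero_of_notMem_contour hz.1
  rw [← hGH z hz, ← hEG z hz0]
  exact hEd.apply_eq_of_tendsto_cocompact z hEt

end Removable

/-! ### Uniqueness for the Riemann–Hilbert problem -/

section Uniqueness

theorem differentiableAt_adjugate {R : ℂ → Mat} {z : ℂ}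
    (h : ∀ i k, DifferentiableAt ℂ (fun z => R z i k) z) (i k : Fin 3) :
    DifferentiableAt ℂ (fun z => (R z).adjugate i k) z := by
  simp only [Matrix.adjugate_apply, Matrix.det_apply]
  refine DifferentiableAt.fun_sum fun σ _ => DifferentiableAt.const_smul ?_ _
  refine DifferentiableAt.fun_finsetProd fun j _ => ?_
  simp only [Matrix.updateRow_apply]
  split_ifs
  · exact differentiableAt_const _
  · exact h _ _

/-- A common right factor of determinant `1` cancels. It is applied with `E` the jump matrix and
with `E` a column operation that removes a pole. The adjugate replaces the inverse because it is
polynomial in the entries and needs no invertibility. -/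
theorem mul_mul_adjugate {A B E : Mat} (hE : E.det = 1) :
    A * E * (B * E).adjugate = A * B.adjugate := by
  rw [Matrix.adjugate_mul_distrib, mul_assoc, ← mul_assoc E, Matrix.mul_adjugate, hE, one_smul,
    one_mul]

theorem tendsto_mul_adjugate {α : Type*} {l : Filter α} {F R : α → Mat} {A B : Mat}
    (hF : Tendsto F l (𝓝 A)) (hR : Tendsto R l (𝓝 B)) :
    Tendsto (fun z => F z * (R z).adjugate) l (𝓝 (A * B.adjugate)) := by
  have h : Tendsto (fun z => (R z).adjugate) l (𝓝 B.adjugate) :=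
    Tendsto.comp (g := fun R : Mat => R.adjugate)
      ((Continuous.matrix_adjugate continuous_id).tendsto B) hR
  exact hF.mul h

/-- The product is continuous in the two matrices, hence bounded on the compact set of pairs with
bounded entries. -/
theorem exists_norm_mul_adjugate_le (C₁ C₂ : ℝ) : ∃ C : ℝ, ∀ A B : Mat, (∀ i k, ‖A i k‖ ≤ C₁) →
    (∀ i k, ‖B i k‖ ≤ C₂) → ∀ i k, ‖(A * B.adjugate) i k‖ ≤ C := by
  have hK : ∀ C : ℝ, IsCompact {A : Mat | ∀ i k, A i k ∈ Metric.closedBall (0 : ℂ) C} :=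
    fun C => by
      have := isCompact_univ_pi fun _ : Fin 3 => isCompact_univ_pi fun _ : Fin 3 =>
        isCompact_closedBall (0 : ℂ) C
      have e : (Set.univ.pi fun _ : Fin 3 => Set.univ.pi fun _ : Fin 3 =>
          Metric.closedBall (0 : ℂ) C)
            = {A : Fin 3 → Fin 3 → ℂ | ∀ i k, A i k ∈ Metric.closedBall (0 : ℂ) C} := by
        ext A
        simp [Set.mem_pi]
      rwa [e] at this
  have hcont : Continuous fun p : Mat × Mat => p.1 * p.2.adjugate :=
    continuous_fst.mul continuous_snd.matrix_adjugate
  have h : ∀ i k, ∃ C : ℝ, ∀ p ∈ {A : Mat | ∀ i k, A i k ∈ Metric.closedBall (0 : ℂ) C₁} ×ˢ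
      {A : Mat | ∀ i k, A i k ∈ Metric.closedBall (0 : ℂ) C₂}, ‖(p.1 * p.2.adjugate) i k‖ ≤ C :=
    fun i k => ((hK C₁).prod (hK C₂)).exists_bound_of_continuousOn
      (f := fun p : Mat × Mat => (p.1 * p.2.adjugate) i k) (hcont.matrix_elem i k).continuousOn
  choose C hC using h
  refine ⟨∑ i, ∑ k, |C i k|, fun A B hA hB i k => ?_⟩
  have h1 := hC i k (A, B) ⟨fun i k => mem_closedBall_zero_iff.2 (hA i k),
    fun i k => mem_closedBall_zero_iff.2 (hB i k)⟩
  have h2 := Finset.single_le_sum (f := fun k => |C i k|) (fun _ _ => abs_nonneg _)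
    (Finset.mem_univ k)
  have h3 := Finset.single_le_sum (f := fun i => ∑ k, |C i k|)
    (fun _ _ => Finset.sum_nonneg fun _ _ => abs_nonneg _) (Finset.mem_univ i)
  exact h1.trans ((le_abs_self _).trans (h2.trans h3))

namespace IsRHSolution

variable {D : ScatteringData} {y t : ℝ} {F R : ℂ → Mat}

theorem differentiableAt (hF : IsRHSolution D y t F) {z : ℂ} {k : Fin 3} (hz : z ∉ contour)
    (hn : ∀ n, D.col n = k → z ≠ D.pole n) (i : Fin 3) :
    DifferentiableAt ℂ (fun z => F z i k) z := by
  refine (hF.analytic i k).differentiableAt ?_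
  have h : ∀ᶠ ζ in 𝓝 z, ∀ n, D.col n = k → ζ ≠ D.pole n :=
    eventually_all.2 fun n => by
      by_cases hk : D.col n = k
      · filter_upwards [isOpen_compl_singleton.mem_nhds (hn n hk)] with ζ hζ _ using hζ
      · exact Eventually.of_forall fun _ h => absurd h hk
  filter_upwards [h, contour_closed.isOpen_compl.mem_nhds hz] with ζ h1 h2 using ⟨h2, h1⟩

theorem differentiableAt_of_mem (hF : IsRHSolution D y t F) {z : ℂ} (hz : z ∈ D.regularSet)
    (i k : Fin 3) : DifferentiableAt ℂ (fun z => F z i k) z :=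
  hF.differentiableAt hz.1 (fun n _ => hz.2 n) i

/-- A column operation removes the pole. -/
theorem exists_tendsto_transvection (hF : IsRHSolution D y t F) (n : Fin D.N) :
    ∃ A : Mat, Tendsto (fun z => F z * Matrix.transvection (D.src n) (D.col n)
      (-(D.resFactor n y t / (z - D.pole n)))) (𝓝[≠] D.pole n) (𝓝 A) := by
  set p := D.pole n with hp
  set r := D.resFactor n y t with hr
  have hreg : ∀ i k, k ≠ D.col n → DifferentiableAt ℂ (fun z => F z i k) p := fun i k hk =>
    hF.differentiableAt (D.pole_notMem n) (fun m hm h => hk (by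
      rw [D.pole_injective h]; exact hm.symm)) i
  have hcol : ∀ i, ∃ a, Tendsto (fun z => F z i (D.col n) + -(r / (z - p)) * F z i (D.src n))
      (𝓝[≠] p) (𝓝 a) := by
    intro i
    -- The residue relation says that `z - p` times this combination of columns tends to `0`, so the
    -- singularity is removable.
    refine ⟨_, Complex.tendsto_limUnder_of_differentiable_on_punctured_nhds_of_isLittleO ?_ ?_⟩
    · filter_upwards [eventually_nhdsNE_mem_regularSet D (D.pole_notMem n)] with z hz
      have hz1 : z - p ≠ 0 := sub_ne_zero.2 (hz.2 n)
      have h1 := hF.differentiableAt_of_mem hz i (D.col n)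
      have h2 := hF.differentiableAt_of_mem hz i (D.src n)
      fun_prop (disch := assumption)
    · rw [Asymptotics.isLittleO_iff_tendsto']
      · have h1 := (hF.residue n i).sub
          (((hreg i _ (D.src_ne_col n)).continuousAt.mono_left nhdsWithin_le_nhds).mul_const r)
        -- The criterion subtracts the value of the function at `p` itself. That value is an
        -- irrelevant constant, in which `r / (p - p)` is `0` by convention.
        have h2 : Tendsto (fun z => (z - p) * (F p i (D.col n) + -(r / (p - p)) * F p i (D.src n)))
            (𝓝[≠] p) (𝓝 0) := by
          have hc : Continuous fun z => (z - p) *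
            (F p i (D.col n) + -(r / (p - p)) * F p i (D.src n)) := by fun_prop
          simpa using (hc.tendsto p).mono_left nhdsWithin_le_nhds
        have h3 := h1.sub h2
        refine (h3.congr' ?_).trans_eq (congrArg 𝓝 (by simp [hp, hr]))
        filter_upwards [self_mem_nhdsWithin] with z hz
        have hz1 : z - p ≠ 0 := sub_ne_zero.2 hz
        rw [div_inv_eq_mul]
        field_simp
        ring
      · filter_upwards [self_mem_nhdsWithin] with z hz h
        exact absurd (inv_eq_zero.1 h) (sub_ne_zero.2 hz)
  choose a ha using hcol
  refine ⟨fun i k => if k = D.col n then a i else F p i k, tendsto_matrix.2 fun i k => ?_⟩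
  by_cases hk : k = D.col n
  · simp only [hk, if_true]
    simpa only [Matrix.mul_transvection_apply_same] using ha i
  · simp only [hk, if_false]
    simp only [Matrix.mul_transvection_apply_of_ne _ _ _ _ hk]
    exact (hreg i k hk).continuousAt.mono_left nhdsWithin_le_nhds

theorem tendsto_one (hF : IsRHSolution D y t F) :
    Tendsto F (cocompact ℂ ⊓ 𝓟 D.regularSet) (𝓝 1) := by
  obtain ⟨C, R, h⟩ := hF.normalization
  refine tendsto_matrix.2 fun i k => tendsto_iff_norm_sub_tendsto_zero.2 ?_
  have h1 : Tendsto (fun z : ℂ => ‖z‖) (cocompact ℂ ⊓ 𝓟 D.regularSet) atTop :=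
    tendsto_norm_cocompact_atTop.mono_left inf_le_left
  refine squeeze_zero' (Eventually.of_forall fun _ => norm_nonneg _) ?_ (h1.const_div_atTop C)
  filter_upwards [h1.eventually_gt_atTop R, mem_inf_of_right (mem_principal_self _)] with z h1 h2
  exact h z h2.1 h1 i k

/-- The Riemann--Hilbert problem has no other solution than a solution of determinant `1`. -/
theorem eq_of_det_eq_one (hF : IsRHSolution D y t F) (hR : IsRHSolution D y t R)
    (hdet : ∀ z ∈ D.regularSet, (R z).det = 1) {z : ℂ} (hz : z ∈ D.regularSet) : F z = R z := by
  have hH : ∀ i k, (F z * (R z).adjugate) i k = (1 : Mat) i k := by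
    intro i k
    refine eq_of_tendsto_cocompact D (H := fun z => (F z * (R z).adjugate) i k)
      (fun z hz => ?_) (fun z h0 => ?_) ?_ ?_ hz
    · simp only [Matrix.mul_apply]
      exact DifferentiableAt.fun_sum fun j _ => (hF.differentiableAt_of_mem hz i j).mul
        (differentiableAt_adjugate (hR.differentiableAt_of_mem hz) j k)
    · suffices h : ∃ A, Tendsto (fun z => F z * (R z).adjugate) (𝓝[D.regularSet] z) (𝓝 A) from
        h.imp' (fun A => A i k) fun A hA => tendsto_matrix.1 hA i k
      by_cases hzc : z ∈ contour
      · obtain ⟨Fp, Fm, hFp, hFm, hFj⟩ := hF.jump z hzc h0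
        obtain ⟨Rp, Rm, hRp, hRm, hRj⟩ := hR.jump z hzc h0
        have hd : ∀ {S : Set ℂ} {N : Mat}, S ⊆ contourᶜ → (𝓝[S] z).NeBot →
            Tendsto R (𝓝[S] z) (𝓝 N) → N.det = 1 := by
          intro S N hS _ hN
          refine tendsto_nhds_unique (((Continuous.matrix_det continuous_id).tendsto N).comp hN)
            (tendsto_const_nhds.congr' ?_)
          filter_upwards [mem_regularSet_nhdsWithin D hzc hS] with ζ hζ using (hdet ζ hζ).symm
        -- Nothing is assumed about the determinant of the jump matrix. It equals `1` because both
        -- boundary values of `R` have determinant `1`.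
        have hJ : (D.jump y t z).det = 1 := by
          have h1 := hd plusSide_subset (neBot_plusSide hzc h0) hRp
          rwa [hRj, Matrix.det_mul, hd minusSide_subset (neBot_minusSide hzc h0) hRm,
            one_mul] at h1
        have hp := tendsto_mul_adjugate hFp hRp
        rw [hFj, hRj, mul_mul_adjugate hJ] at hp
        have h := hp.sup (tendsto_mul_adjugate hFm hRm)
        rw [← nhdsWithin_union] at h
        refine ⟨_, h.mono_left (nhdsWithin_mono z fun ζ hζ => ?_)⟩
        exact (lt_or_gt_of_ne fun h => hζ.1 ((mem_contour_iff ζ).2 h)).symm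
      by_cases hzr : z ∈ D.regularSet
      · exact ⟨_, (tendsto_mul_adjugate
          (tendsto_matrix.2 fun i k => (hF.differentiableAt_of_mem hzr i k).continuousAt)
          (tendsto_matrix.2 fun i k => (hR.differentiableAt_of_mem hzr i k).continuousAt)).mono_left
            nhdsWithin_le_nhds⟩
      · obtain ⟨n, rfl⟩ : ∃ n, z = D.pole n := by
          by_contra! h
          exact hzr ⟨hzc, h⟩
        -- Both solutions obey the same residue relation, so the same column operation, of
        -- determinant `1`, regularizes both and cancels in the product.
        obtain ⟨A, hA⟩ := hF.exists_tendsto_transvection n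
        obtain ⟨B, hB⟩ := hR.exists_tendsto_transvection n
        have h := tendsto_mul_adjugate hA hB
        simp only [mul_mul_adjugate (Matrix.det_transvection_of_ne _ _ (D.src_ne_col n) _)] at h
        exact ⟨_, h.mono_left (nhdsWithin_mono _ fun ζ hζ => hζ.2 n)⟩
    · obtain ⟨C₁, r₁, hr₁, h₁⟩ := hF.bounded_zero
      obtain ⟨C₂, r₂, hr₂, h₂⟩ := hR.bounded_zero
      obtain ⟨C, hC⟩ := exists_norm_mul_adjugate_le C₁ C₂
      exact ⟨C, min r₁ r₂, lt_min hr₁ hr₂, fun z hz hzr => hC (F z) (R z)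
        (h₁ z hz.1 (hzr.trans_le (min_le_left _ _)))
        (h₂ z hz.1 (hzr.trans_le (min_le_right _ _))) i k⟩
    · have h := tendsto_mul_adjugate hF.tendsto_one hR.tendsto_one
      rw [Matrix.adjugate_one, mul_one] at h
      exact tendsto_matrix.1 h i k
  have h1 : F z * (R z).adjugate = 1 := by ext i k; exact hH i k
  calc F z = F z * ((R z).adjugate * R z) := by
        rw [Matrix.adjugate_mul, hdet z hz, one_smul, mul_one]
    _ = R z := by rw [← mul_assoc, h1, one_mul]

end IsRHSolution

end Uniqueness

end OstrovskyVakhnenko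

/-! ### The main theorem -/

theorem mainTheorem2 (u₀ : ℝ → ℝ) (u : ℝ → ℝ → ℝ) (D : ScatteringData)
    (hu₀ : IsInitialDatum u₀) (hu : IsSolution u₀ u) (hD : IsScatteringDataOf u₀ D) :
    -- the change of variables is meaningful
    (∀ t, 0 ≤ t →
      (∀ x, 0 < 1 - iteratedDeriv 2 (fun x' => u x' t) x) ∧
      Integrable (fun x => qOf (fun x' => u x' t) x - 1) ∧
      Function.Bijective (fun x => yVar u x t)) ∧
    ∃ (Mhat : ℝ → ℝ → ℂ → Mat) (X uhat : ℝ → ℝ → ℝ),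
      -- `Mhat` is the solution of the Riemann--Hilbert problem
      (∀ y t, 0 ≤ t → IsRHSolution D y t (Mhat y t) ∧
        ∀ F : ℂ → Mat, IsRHSolution D y t F → ∀ z ∈ D.regularSet, F z = Mhat y t z) ∧
      -- `X y t = y + lim_{z → 0} ((∑ Mhat_{j3}(z)) / (∑ Mhat_{j3}(0)) - 1) / z`
      (∀ y t, 0 ≤ t → ∃ A : Mat, Tendsto (Mhat y t) (𝓝[contourᶜ] 0) (𝓝 A) ∧
        ∑ j, A j 2 ≠ 0 ∧
        Tendsto (fun z : ℂ => ((∑ j, Mhat y t z j 2) / (∑ j, A j 2) - 1) * (1 / z))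
          (𝓝[contourᶜ] 0) (𝓝 ((X y t - y : ℝ) : ℂ))) ∧
      -- `X` is the inverse of the change of variables
      (∀ t, 0 ≤ t → (∀ x, X (yVar u x t) t = x) ∧ ∀ y, yVar u (X y t) t = y) ∧
      -- `uhat = ∂X/∂t` (one-sided at `t = 0`)
      (∀ y t, 0 ≤ t → HasDerivWithinAt (fun s => X y s) (uhat y t) (Set.Ici 0) t) ∧
      -- the representation of `u`
      ∀ x t, 0 ≤ t → u x t = uhat (yVar u x t) t := by
  obtain ⟨M, hM, hlim, hS, hreg, hres⟩ := hD
  have hI : ∀ t, 0 ≤ t → IsInitialDatum fun x' => u x' t := fun t ht => hu.isInitialDatum hu₀ ht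
  have hbij : ∀ t, 0 ≤ t → Function.Bijective fun x => yVar u x t := fun t ht =>
    (hI t ht).bijective_yOf
  refine ⟨fun t ht => ⟨(hI t ht).pos, (hI t ht).integrable_qOf_sub_one, hbij t ht⟩, ?_⟩
  -- This is the inverse change of variables for `t ≥ 0`; for negative `t` its values play no role.
  set X : ℝ → ℝ → ℝ := fun y t => Function.invFun (fun x => yVar u x t) y with hX
  have hXl : ∀ t, 0 ≤ t → ∀ x, X (yVar u x t) t = x := fun t ht x =>
    Function.leftInverse_invFun (hbij t ht).1 x
  have hXr : ∀ t, 0 ≤ t → ∀ y, yVar u (X y t) t = y := fun t ht y =>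
    Function.rightInverse_invFun (hbij t ht).2 y
  have hsol : ∀ y t, 0 ≤ t → IsRHSolution D y t (rhSol u₀ u M (X y t) t) := fun y t ht => by
    have h := hu.isRHSolution_rhSol hu₀ hM hlim hS hreg hres (X y t) ht
    rwa [hXr t ht y] at h
  refine ⟨fun y t => rhSol u₀ u M (X y t) t, X, fun y t => u (X y t) t, fun y t ht =>
    ⟨hsol y t ht, fun F hF z hz => hF.eq_of_det_eq_one (hsol y t ht) (fun ζ hζ =>
      hu.det_rhSol hu₀ (ne_zero_of_notMem_contour hζ.1) (hM ζ hζ).1 _ ht) hz⟩,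
    fun y t ht => ⟨gaugeMat (qOf (fun x' => u x' t) (X y t)),
      hu.tendsto_rhSol_zero hu₀ hM _ ht, ?_, ?_⟩,
    fun t ht => ⟨hXl t ht, hXr t ht⟩,
    fun y t ht => hu.hasDerivWithinAt_inverse hu₀ hXr y ht,
    fun x t ht => by simp only [hXl t ht x]⟩
  · rw [sum_gaugeMat]
    exact_mod_cast ((hI t ht).qOf_pos _).ne'
  · have h := hu.tendsto_sum_rhSol hu₀ hM (X y t) ht
    rwa [hXr t ht y] at h
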